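/- Let $K$ be an algebraically closed field of characteristic $0$, $n\ge 1$, and let $G$ be $\mathrm{Sp}_{2n}(K)$, $\mathrm{O}_{2n}(K)$ or $\mathrm{O}_{2n+1}(K)$, a group of $m\times m$ matrices ($m=2n$, $2n$, $2n+1$) with rows and columns labelled by $1\prec2\prec\dots\prec n\prec 0\prec -n\prec\dots\prec-2\prec-1$ (the label $0$ only for $\mathrm{O}_{2n+1}$), preserving the bilinear form with matrix $\sum_i s_iE_{i,-i}$, where all $s_i=1$, except that $s_{-1}=\dots=s_{-n}=-1$ for $\mathrm{Sp}_{2n}$. Let $N$ be the group of upper unitriangular matrices in $G$. Let $P$ be the group of block upper triangular matrices of $G$ for diagonal blocks of sizes $(r_1,\dots,r_{p-1},r_p,r_{p-1},\dots,r_1)$, where $r_1,\dots,r_{p-1}\ge1$, $R=r_1+\dots+r_{p-1}\le n$, $r_p=m-2R\ge0$ (no central block if $r_p=0$). In $\mathfrak g=\mathrm{Lie}\,G$ let $\mathfrak r$ be the subalgebra of block diagonal matrices and $\mathfrak m$ the subalgebra of strictly block upper triangular matrices (the nilradical of $\mathrm{Lie}\,P$). The group $N$ acts on $K[\mathfrak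 m]$ and $K(\mathfrak m)$ by $(\mathrm{Ad}_gf)(x)=f(g^{-1}xg)$. *Roots.* The set $\Delta^+$ of positive roots consists of $\varepsilon_i\pm\varepsilon_j$ ($i<j$), together with the $2\varepsilon_i$ for $\mathrm{Sp}_{2n}$ and the $\varepsilon_i$ for $\mathrm{O}_{2n+1}$. Put $\mathcal E(\varepsilon_i-\varepsilon_j)=(-j,-i)$, $\mathcal E(\varepsilon_i+\varepsilon_j)=(j,-i)$, $\mathcal E(2\varepsilon_i)=(i,-i)$ (for all three groups), $\mathcal E(\varepsilon_i)=(0,-i)$. Let $M\subset\Delta^+$ be the set of roots whose root spaces lie in $\mathfrak m$ and $\Delta^+_{\mathfrak r}$ the set of those whose root spaces lie in $\mathfrak r$. Write $\gamma'\succ\gamma$ if $\gamma'-\gamma\in\Delta^+\cup\{2\varepsilon_1,\dots,2\varepsilon_n\}$. Let $S$ be the base of $M$: the unique subset such that $\gamma'\not\succ\gamma$ for all $\gamma,\gamma'\in S$ and every $\gamma\in M\setminus S$ satisfies $\gamma\succ\xi$ for some $\xi\in S$. *Minors.* $K[\mathfrak m]$ is the polynomial ring in the variables $x_{i,j}$ with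 $(-j,-i)=\mathcal E(\gamma)$, $\gamma\in M$. Let $\mathbb X$ be the $m\times m$ matrix which for each such $\gamma$ has $x_{i,j}$ in position $(i,j)$ and, in position $(-j,-i)$ if this is a different position, $x_{i,j}$ if $G=\mathrm{Sp}_{2n}$ and $j<0$, and $-x_{i,j}$ otherwise; all other entries are $0$. For $\gamma\in M$, $\mathcal E(\gamma)=(a,-b)$, let $S_\gamma$ be the set of $\xi\in S$ with $\mathcal E(\xi)=(i,j)$, $i\succ a$, $j\prec-b$; let $(a_1,-b_1),\dots,(a_k,-b_k)$ be the entries $\mathcal E(\xi)$, $\xi\in S_\gamma$, and let $b_{i_1},\dots,b_{i_s}$ be those $b_i$ with $b_i\succ a$. Let $M_\gamma$ be the minor of $\mathbb X$ with set of rows $I=\{b_1,\dots,b_k,b,a_{i_1},\dots,a_{i_s}\}$ and set of columns $J=\{-a,-a_1,\dots,-a_k,-b_{i_1},\dots,-b_{i_s}\}$, and $\overline M_\gamma$ the minor with rows $-J$ and columns $-I$ (rows and columns in increasing order; a minor with $|I|\neq|J|$ is read as $0$). *Admissible pairs.* Let $k$ be the greatest number with $\varepsilon_k+\varepsilon_{k+1}\in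 M$ ($k=0$ if there is none) and $D=\{2\varepsilon_i:k<i\le n\}$. Put $\Gamma=\Delta^+_{\mathfrak r}\setminus D$ and $\Lambda=\Delta^+_{\mathfrak r}$ if $G=\mathrm{Sp}_{2n}$, and $\Gamma=\Lambda=\Delta^+_{\mathfrak r}\cup D$ for the orthogonal groups. A root $\gamma$ with $\mathcal E(\gamma)=(a,-b)$ lies to the right of the central block if $a$ is one of the labels of the central rows, i.e. is neither among the first $R$ nor among the last $R$ labels. Let $\xi,\xi'\in S$, $\mathcal E(\xi)=(a,-b)$, $\mathcal E(\xi')=(a',-b')$. The pair $q=(\xi,\xi')$ is admissible with root $\alpha_q$ if either $\xi,\xi'$ do not both lie to the right of the central block, $\alpha_q\in\Delta^+_{\mathfrak r}$ and $\mathcal E(\alpha_q)=(-b,a')$, or both do, $\alpha_q\in\Gamma$ and $\mathcal E(\alpha_q)=(-a,a')$. Put $\varphi_q=\alpha_q+\xi'$, and let $\Phi\subset\Delta^+$ be the set of all the roots $\varphi_q$. For $\varphi=\varphi_q\in\Phi$ put $$L_\varphi=\sum M_{\xi+\alpha_1}\overline M_{\alpha_2+\xi'},$$ the sum being over all $\alpha_1,\alpha_2\in\Lambda\cup\{0\}$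 with $\alpha_1+\alpha_2=\alpha_q$ and $\xi+\alpha_1,\ \alpha_2+\xi'\in M$ (for any choice of $q$ with $\varphi_q=\varphi$). **Theorem.** For every such $P$, all $M_\xi$, $\xi\in S$, and all $L_\varphi$, $\varphi\in\Phi$, belong to $K[\mathfrak m]^N$; the system $\{M_\xi,\ \xi\in S;\ L_\varphi,\ \varphi\in\Phi\}$ (indexed by the disjoint union of $S$ and $\Phi$) is algebraically independent over $K$; and consequently $\operatorname{trdeg}_KK(\mathfrak m)^N\ge|S|+|\Phi|$. -/

import Mathlib

open MvPolynomial

namespace ParabolicInvariants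

/-- The three families of classical groups: `O_{2n+1}`, `Sp_{2n}` and `O_{2n}`. -/
inductive ClassicalType
  | oddOrthogonal
  | symplectic
  | evenOrthogonal
  deriving DecidableEq

/-- The size `m` of the matrices. -/
def dim (ty : ClassicalType) (n : ℕ) : ℕ :=
  match ty with
  | .oddOrthogonal => 2 * n + 1
  | .symplectic => 2 * n
  | .evenOrthogonal => 2 * n

theorem two_mul_le_dim (ty : ClassicalType) (n : ℕ) : 2 * n ≤ dim ty n := by
  cases ty <;> simp [dim]

/-- Row and column labels. The labels `1 ≺ 2 ≺ … ≺ n ≺ 0 ≺ -n ≺ … ≺ -2 ≺ -1` (with `0` present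
only for `O_{2n+1}`), in the mirror order, are the elements `0 < 1 < … < m - 1` of `Fin m`.
Under this identification the mirror order is the usual order and the change of sign `v ↦ -v`
is `Fin.rev`. -/
abbrev Idx (ty : ClassicalType) (n : ℕ) : Type := Fin (dim ty n)

/-- The label `i` (where `i : Fin n` stands for one of `1, …, n`). -/
def posIdx (ty : ClassicalType) {n : ℕ} (i : Fin n) : Idx ty n :=
  ⟨i, by have := two_mul_le_dim ty n; omega⟩

/-- The label `-i`. -/
def negIdx (ty : ClassicalType) {n : ℕ} (i : Fin n) : Idx ty n := (posIdx ty i).rev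

/-- The label `0`; only meaningful, and only used, for `O_{2n+1}`. (The argument only witnesses
`n ≠ 0`.) -/
def zeroIdx (ty : ClassicalType) {n : ℕ} (i : Fin n) : Idx ty n :=
  ⟨n, by have := two_mul_le_dim ty n; have := i.2; omega⟩

/-! ### The groups and Lie algebras -/

/-- The bilinear form preserved by the group: the antidiagonal matrix with entries `1`, except
that for `Sp_{2n}` the entries in the rows `-n, …, -1` are `-1`. -/
def form (A : Type*) [CommRing A] (ty : ClassicalType) (n : ℕ) :
    Matrix (Idx ty n) (Idx ty n) A :=
  Matrix.of fun i j =>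
    if j = i.rev then (if ty = .symplectic ∧ n ≤ (i : ℕ) then -1 else 1) else 0

/-- The Lie algebra `𝔤` of matrices that are skew with respect to the form. -/
def lieAlg (A : Type*) [CommRing A] (ty : ClassicalType) (n : ℕ) :
    Set (Matrix (Idx ty n) (Idx ty n) A) :=
  {x | x.transpose * form A ty n + form A ty n * x = 0}

/-- The classical group `G`. -/
def classicalGroup (K : Type*) [Field K] (ty : ClassicalType) (n : ℕ) :
    Subgroup (GL (Idx ty n) K) where
  carrier := {g | g.val.transpose * form K ty n * g.val = form K ty n}
  one_mem' := by simp
  mul_mem' := by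
    intro a b ha hb
    simp only [Set.mem_ofPred_eq, Units.val_mul, Matrix.transpose_mul] at *
    calc _ = b.val.transpose * (a.val.transpose * form K ty n * a.val) * b.val := by
            simp only [Matrix.mul_assoc]
      _ = _ := by rw [ha, hb]
  inv_mem' := by
    intro a ha
    simp only [Set.mem_ofPred_eq] at *
    have h1 : a.val * (a⁻¹).val = 1 := by simp
    have h2 : (a⁻¹).val.transpose * a.val.transpose = 1 := by
      rw [← Matrix.transpose_mul, h1, Matrix.transpose_one]
    calc _ = (a⁻¹).val.transpose * (a.val.transpose * form K ty n * a.val) * (a⁻¹).val := by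
            rw [ha]
      _ = ((a⁻¹).val.transpose * a.val.transpose) * form K ty n * (a.val * (a⁻¹).val) := by
            simp only [Matrix.mul_assoc]
      _ = _ := by rw [h1, h2]; simp

theorem inv_upper {K : Type*} [Field K] {m : ℕ} (g : GL (Fin m) K)
    (hg : ∀ i j, j < i → g.val i j = 0) : ∀ i j, j < i → (g⁻¹).val i j = 0 := by
  intro i j hij
  have h : Matrix.BlockTriangular g.val id := fun a b hab => hg a b hab
  let _ : Invertible g.val := g.invertible
  have := Matrix.blockTriangular_inv_of_blockTriangular h hij
  rwa [← Matrix.coe_units_inv] at this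

/-- The group `U_m` of upper unitriangular matrices. -/
def unitriangular (K : Type*) [Field K] (m : ℕ) : Subgroup (GL (Fin m) K) where
  carrier := {g | (∀ i j, j < i → g.val i j = 0) ∧ ∀ i, g.val i i = 1}
  one_mem' := by
    refine ⟨fun i j h => ?_, fun i => ?_⟩
    · simp [h.ne']
    · simp
  mul_mem' := by
    rintro a b ⟨ha, ha'⟩ ⟨hb, hb'⟩
    refine ⟨fun i j h => ?_, fun i => ?_⟩
    · rw [Units.val_mul, Matrix.mul_apply]
      refine Finset.sum_eq_zero fun k _ => ?_
      rcases lt_or_ge k i with hk | hk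
      · rw [ha _ _ hk, zero_mul]
      · rw [hb _ _ (h.trans_le hk), mul_zero]
    · rw [Units.val_mul, Matrix.mul_apply, Finset.sum_eq_single i]
      · rw [ha', hb', one_mul]
      · intro k _ hk
        rcases lt_or_gt_of_ne hk with hk | hk
        · rw [ha _ _ hk, zero_mul]
        · rw [hb _ _ hk, mul_zero]
      · simp
  inv_mem' := by
    rintro a ⟨ha, ha'⟩
    have hu := inv_upper a ha
    refine ⟨hu, fun i => ?_⟩
    have h1 : (a.val * (a⁻¹).val) i i = 1 := by
      rw [← Units.val_mul, mul_inv_cancel]; simp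
    rw [Matrix.mul_apply, Finset.sum_eq_single i] at h1
    · rwa [ha', one_mul] at h1
    · intro k _ hk
      rcases lt_or_gt_of_ne hk with hk | hk
      · rw [ha _ _ hk, zero_mul]
      · rw [hu _ _ hk, mul_zero]
    · simp

/-- The maximal unipotent subgroup `N = G ∩ U_m`. -/
def unipotentRadical (K : Type*) [Field K] (ty : ClassicalType) (n : ℕ) :
    Subgroup (GL (Idx ty n) K) :=
  classicalGroup K ty n ⊓ unitriangular K (dim ty n)

/-! ### Parabolic subalgebras -/

/-- The datum of a parabolic subgroup `P ⊇ B` with block diagonal Levi subalgebra: the sizes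
`(r_1, …, r_{p-1})` of the blocks before the central one. All block sizes are then
`(r_1, …, r_{p-1}, r_p, r_{p-1}, …, r_1)` with central size `r_p = m - 2 (r_1 + … + r_{p-1}) ≥ 0`
(no central block if this is `0`), and `P` consists of the block upper triangular matrices of
`G`. -/
structure BlockSizes (n : ℕ) where
  /-- The list `(r_1, …, r_{p-1})`. -/
  blocks : List ℕ
  blocks_pos : ∀ r ∈ blocks, 0 < r
  sum_le : blocks.sum ≤ n

namespace BlockSizes

variable {n : ℕ} (P : BlockSizes n)

/-- The number `R = r_1 + … + r_{p-1}`. -/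
def R : ℕ := P.blocks.sum

/-- The number of `t` in `{1, …, p-1}` such that `r_1 + … + r_t ≤ v`. -/
def count (v : ℕ) : ℕ :=
  ((Finset.range P.blocks.length).filter fun t => (P.blocks.take (t + 1)).sum ≤ v).card

/-- The number of the diagonal block that contains the label `v`, numbered from top to bottom by
`-(p-1), …, -1, 0, 1, …, p-1`, where `0` is the central block. -/
def blockNumber (ty : ClassicalType) (v : Idx ty n) : ℤ := P.count v - P.count v.rev

end BlockSizes

/-- The Levi subalgebra `𝔯`: the block diagonal matrices of `𝔤`. -/
def levi (A : Type*) [CommRing A] (ty : ClassicalType) {n : ℕ} (P : BlockSizes n) :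
    Set (Matrix (Idx ty n) (Idx ty n) A) :=
  {x | x ∈ lieAlg A ty n ∧ ∀ i j, P.blockNumber ty i ≠ P.blockNumber ty j → x i j = 0}

/-- The nilradical `𝔪`: the strictly block upper triangular matrices of `𝔤`. -/
def nilradical (A : Type*) [CommRing A] (ty : ClassicalType) {n : ℕ} (P : BlockSizes n) :
    Set (Matrix (Idx ty n) (Idx ty n) A) :=
  {x | x ∈ lieAlg A ty n ∧ ∀ i j, P.blockNumber ty j ≤ P.blockNumber ty i → x i j = 0}

/-! ### Roots -/

/-- The weights `ε_i - ε_j`, `ε_i + ε_j` (`i < j`), `2 ε_i` and `ε_i`, from which the positive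
roots of all three types are taken. -/
inductive Weight (n : ℕ) : Type
  | diff (i j : Fin n) (h : i < j)
  | sum (i j : Fin n) (h : i < j)
  | double (i : Fin n)
  | single (i : Fin n)

namespace Weight

variable {n : ℕ}

/-- The coordinates of a weight in the basis `ε_1, …, ε_n`. -/
def vec : Weight n → (Fin n → ℤ)
  | diff i j _ => Pi.single i 1 - Pi.single j 1
  | sum i j _ => Pi.single i 1 + Pi.single j 1
  | double i => Pi.single i 2
  | single i => Pi.single i 1

/-- The entry `ℰ(γ)`: `(-j,-i)` for `ε_i - ε_j`, `(j,-i)` for `ε_i + ε_j`, `(i,-i)` for `2 ε_i`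
and `(0,-i)` for `ε_i`. -/
def entry (ty : ClassicalType) : Weight n → Idx ty n × Idx ty n
  | diff i j _ => (negIdx ty j, negIdx ty i)
  | sum i j _ => (posIdx ty j, negIdx ty i)
  | double i => (posIdx ty i, negIdx ty i)
  | single i => (zeroIdx ty i, negIdx ty i)

/-- The root vector `E_γ`. -/
def rootVector (A : Type*) [CommRing A] (ty : ClassicalType) :
    Weight n → Matrix (Idx ty n) (Idx ty n) A
  | diff i j _ =>
      Matrix.single (posIdx ty i) (posIdx ty j) 1 - Matrix.single (negIdx ty j) (negIdx ty i) 1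
  | sum i j _ =>
      if ty = .symplectic then
        Matrix.single (posIdx ty i) (negIdx ty j) 1 + Matrix.single (posIdx ty j) (negIdx ty i) 1
      else
        Matrix.single (posIdx ty i) (negIdx ty j) 1 - Matrix.single (posIdx ty j) (negIdx ty i) 1
  | double i => Matrix.single (posIdx ty i) (negIdx ty i) 1
  | single i =>
      Matrix.single (posIdx ty i) (zeroIdx ty i) 1 - Matrix.single (zeroIdx ty i) (negIdx ty i) 1

end Weight

/-- The positive roots `Δ⁺`. -/
def posRoots (ty : ClassicalType) (n : ℕ) : Set (Weight n) :=
  {γ | match γ with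
    | .diff _ _ _ => True
    | .sum _ _ _ => True
    | .double _ => ty = .symplectic
    | .single _ => ty = .oddOrthogonal}

/-- The relation `γ' ≻ γ`: the difference `γ' - γ` is a positive root or one of the `2 ε_i`. -/
def Succ (ty : ClassicalType) {n : ℕ} (γ' γ : Weight n) : Prop :=
  ∃ δ : Weight n, (δ ∈ posRoots ty n ∨ ∃ i, δ = .double i) ∧ γ'.vec - γ.vec = δ.vec

section Roots

variable (K : Type*) [Field K] (ty : ClassicalType) {n : ℕ} (P : BlockSizes n)

/-- The set `M` of positive roots whose root subspace `K E_γ` lies in `𝔪`. -/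
def nilRoots : Set (Weight n) :=
  {γ | γ ∈ posRoots ty n ∧ γ.rootVector K ty ∈ nilradical K ty P}

/-- The positive roots `Δ⁺_𝔯` of the Levi subalgebra. -/
def leviRoots : Set (Weight n) :=
  {γ | γ ∈ posRoots ty n ∧ γ.rootVector K ty ∈ levi K ty P}

end Roots

/-- A base of a set `M` of positive roots: a subset of pairwise incomparable roots such that each
other root of `M` is `≻` some root of the subset. -/
def IsBase (ty : ClassicalType) {n : ℕ} (M S : Set (Weight n)) : Prop :=
  S ⊆ M ∧ (∀ γ ∈ S, ∀ γ' ∈ S, ¬ Succ ty γ' γ) ∧ ∀ γ ∈ M \ S, ∃ ξ ∈ S, Succ ty γ ξ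

theorem existsUnique_kernel {α : Type*} (r : α → α → Prop) (f : α → ℕ)
    (hf : ∀ a b, r a b → f b < f a) (M : Set α) :
    ∃! S : Set α, S ⊆ M ∧ (∀ a ∈ S, ∀ b ∈ S, ¬ r b a) ∧ ∀ a ∈ M \ S, ∃ b ∈ S, r a b := by
  have wf : WellFounded (fun b a => f b < f a) := InvImage.wf f wellFounded_lt
  let F : (a : α) → ((b : α) → f b < f a → Prop) → Prop :=
    fun a ih => a ∈ M ∧ ∀ b, ∀ h : r a b, ¬ ih b (hf a b h)
  have hS : ∀ a, wf.fix F a ↔ a ∈ M ∧ ∀ b, r a b → ¬ wf.fix F b := by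
    intro a
    rw [wf.fix_eq F a]
  refine ⟨{a | wf.fix F a}, ⟨fun a ha => ((hS a).1 ha).1, ?_, ?_⟩, ?_⟩
  · intro a ha b hb hr
    exact ((hS b).1 hb).2 a hr ha
  · rintro a ⟨haM, ha⟩
    by_contra hcon
    push Not at hcon
    exact ha ((hS a).2 ⟨haM, fun b hb hb' => hcon b hb' hb⟩)
  · rintro T ⟨hT1, hT2, hT3⟩
    ext a
    induction a using wf.induction with
    | _ a ih =>
    show a ∈ T ↔ wf.fix F a
    rw [hS a]
    constructor
    · intro ha
      exact ⟨hT1 ha, fun b hb hb' => hT2 b ((ih b (hf a b hb)).2 hb') a ha hb⟩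
    · rintro ⟨haM, ha⟩
      by_contra hcon
      obtain ⟨b, hb, hr⟩ := hT3 a ⟨haM, hcon⟩
      exact ha b hr ((ih b (hf a b hr)).1 hb)

/-- A positive height on weights. -/
def Weight.height {n : ℕ} (γ : Weight n) : ℤ := ∑ i : Fin n, ((n : ℤ) - i) * γ.vec i

theorem Weight.height_pos {n : ℕ} (γ : Weight n) : 0 < γ.height := by
  cases γ with
  | diff i j h =>
    have : (i : ℤ) < j := by exact_mod_cast h
    simp [height, vec, mul_sub, Finset.sum_sub_distrib, Pi.single_apply]
    omega
  | sum i j h =>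
    have := i.2
    have := j.2
    simp [height, vec, mul_add, Finset.sum_add_distrib, Pi.single_apply]
    omega
  | double i =>
    have := i.2
    simp [height, vec, Pi.single_apply]
  | single i =>
    have := i.2
    simp [height, vec, Pi.single_apply]

theorem existsUnique_isBase (ty : ClassicalType) {n : ℕ} (M : Set (Weight n)) :
    ∃! S, IsBase ty M S := by
  refine existsUnique_kernel (Succ ty) (fun γ => γ.height.toNat) ?_ M
  rintro a b ⟨δ, -, h⟩
  have h1 : a.height - b.height = δ.height := by
    simp only [Weight.height, ← Finset.sum_sub_distrib, ← mul_sub, ← h, Pi.sub_apply]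
  have h2 := δ.height_pos
  have h3 := b.height_pos
  have h4 := a.height_pos
  show b.height.toNat < a.height.toNat
  omega

section Base

variable (K : Type*) [Field K] (ty : ClassicalType) {n : ℕ} (P : BlockSizes n)

/-- The base `S` of `M`. -/
noncomputable def base : Set (Weight n) := (existsUnique_isBase ty (nilRoots K ty P)).choose

theorem base_isBase : IsBase ty (nilRoots K ty P) (base K ty P) :=
  (existsUnique_isBase ty (nilRoots K ty P)).choose_spec.1

/-- A root `γ` with `ℰ(γ) = (a,-b)` lies to the right of the central block if
`R ≺ a ≺ -R`. -/
def RightOfCentral (γ : Weight n) : Prop :=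
  P.R ≤ ((γ.entry ty).1 : ℕ) ∧ ((γ.entry ty).1 : ℕ) < dim ty n - P.R

/-- The weights `2 ε_i` with `k < i ≤ n`, where `k` is the greatest number such that
`ε_k + ε_{k+1} ∈ M` (all `2 ε_i` if there is none). -/
def tailDoubles : Set (Weight n) :=
  {γ | ∃ i, γ = .double i ∧ ∀ (k l : Fin n) (h : k < l), (k : ℕ) + 1 = l →
    .sum k l h ∈ nilRoots K ty P → k < i}

/-- The set `Γ_𝔯`, used for the admissible pairs. -/
def gammaSet : Set (Weight n) :=
  if ty = .symplectic then leviRoots K ty P \ tailDoubles K ty P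
  else leviRoots K ty P ∪ tailDoubles K ty P

/-- The set of weights over which the sum defining the invariants `L_φ` extends: `Δ⁺_𝔯` for the
symplectic group and `Γ_𝔯` for the orthogonal groups. -/
def summationSet : Set (Weight n) :=
  if ty = .symplectic then leviRoots K ty P else gammaSet K ty P

/-- An admissible pair `q = (ξ, ξ')`, together with the root `α_q`. -/
structure AdmissiblePair where
  ξ : Weight n
  ξ' : Weight n
  α : Weight n
  ξ_mem : ξ ∈ base K ty P
  ξ'_mem : ξ' ∈ base K ty P
  admissible :
    (¬ (RightOfCentral ty P ξ ∧ RightOfCentral ty P ξ') ∧ α ∈ leviRoots K ty P ∧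
      (ξ.entry ty).2 = (α.entry ty).1 ∧ (α.entry ty).2 = (ξ'.entry ty).1) ∨
    (RightOfCentral ty P ξ ∧ RightOfCentral ty P ξ' ∧ α ∈ gammaSet K ty P ∧
      α.entry ty = ((ξ.entry ty).1.rev, (ξ'.entry ty).1))

/-- `φ` is the root `φ_q = α_q + ξ'` of the admissible pair `q = (ξ, ξ')`. -/
def AdmissiblePair.IsRoot {K : Type*} [Field K] {ty : ClassicalType} {n : ℕ} {P : BlockSizes n}
    (q : AdmissiblePair K ty P) (φ : Weight n) : Prop :=
  φ ∈ posRoots ty n ∧ φ.vec = q.α.vec + q.ξ'.vec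

/-- The set `Φ` of the roots `φ_q` of all admissible pairs. -/
def phiSet : Set (Weight n) := {φ | ∃ q : AdmissiblePair K ty P, q.IsRoot φ}

end Base

/-! ### The algebra `K[𝔪]`, the generic matrix and the minors -/

section Polynomials

variable (K : Type*) [Field K] (ty : ClassicalType) {n : ℕ} (P : BlockSizes n)

/-- The coordinate algebra `K[𝔪]`: polynomials in the variables `x_{i,j}`, one for each `γ ∈ M`,
where `ℰ(γ) = (-j,-i)`. -/
abbrev CoordRing : Type _ := MvPolynomial (nilRoots K ty P) K

instance : Finite (Weight n) := by
  refine Finite.of_injective (β := Fin 4 × Fin n × Fin n)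
    (fun γ => match γ with
      | .diff i j _ => (0, i, j)
      | .sum i j _ => (1, i, j)
      | .double i => (2, i, i)
      | .single i => (3, i, i)) ?_
  intro a b h
  cases a <;> cases b <;> simp_all

noncomputable instance : Fintype (Weight n) := Fintype.ofFinite _

noncomputable instance : Fintype (nilRoots K ty P) := Fintype.ofFinite _

/-- The value of the coordinate `x_{i,j}`, `ℰ(γ) = (-j,-i)`, at a matrix `y`. -/
def coordinate {A : Type*} (γ : Weight n) (y : Matrix (Idx ty n) (Idx ty n) A) : A :=
  y (γ.entry ty).2.rev (γ.entry ty).1.rev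

open Classical in
/-- The matrix in `𝔪` over a ring `A` with given coordinates `v`. For each `γ ∈ M` with
`ℰ(γ) = (-j,-i)` it has `v γ` in the position `(i,j)` and, in the position `(-j,-i)`, the element
`v γ` if the group is symplectic and `j < 0`, and `-v γ` otherwise. -/
noncomputable def matrixOf {A : Type*} [CommRing A] (v : nilRoots K ty P → A) :
    Matrix (Idx ty n) (Idx ty n) A :=
  Matrix.of fun r c => ∑ γ : nilRoots K ty P,
    if (γ.1.entry ty).2.rev = r ∧ (γ.1.entry ty).1.rev = c then v γ
    else if γ.1.entry ty = (r, c) then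
      (if ty = .symplectic ∧ n ≤ (((γ.1.entry ty).1.rev : Idx ty n) : ℕ) then v γ else -v γ)
    else 0

/-- The formal matrix `𝕏`. -/
noncomputable def formalMatrix : Matrix (Idx ty n) (Idx ty n) (CoordRing K ty P) :=
  matrixOf K ty P fun γ => X γ

/-- The minor `M_I^J` of `𝕏` with ordered rows `I` and ordered columns `J` (set to be `0` if
`I` and `J` have different sizes). -/
noncomputable def minor (I J : Finset (Idx ty n)) : CoordRing K ty P :=
  if h : J.card = I.card then
    ((formalMatrix K ty P).submatrix (I.orderEmbOfFin rfl) (J.orderEmbOfFin h)).det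
  else 0

open Classical in
/-- The set `S_γ` of all `ξ ∈ S` with `ℰ(ξ) = (i,j)`, `i ≻ a`, `j ≺ -b`, where
`ℰ(γ) = (a,-b)`. -/
noncomputable def baseBelow (γ : Weight n) : Finset (Weight n) :=
  Finset.univ.filter fun ξ => ξ ∈ base K ty P ∧
    (γ.entry ty).1 < (ξ.entry ty).1 ∧ (ξ.entry ty).2 < (γ.entry ty).2

open Classical in
/-- Those `ξ ∈ S_γ`, `ℰ(ξ) = (a_i,-b_i)`, for which `b_i ≻ a`. -/
noncomputable def baseBelowLarge (γ : Weight n) : Finset (Weight n) :=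
  (baseBelow K ty P γ).filter fun ξ => (γ.entry ty).1 < (ξ.entry ty).2.rev

/-- The set of rows `{b_1, …, b_k, b, a_{i_1}, …, a_{i_s}}`. -/
noncomputable def rowSet (γ : Weight n) : Finset (Idx ty n) :=
  (baseBelow K ty P γ).image (fun ξ => (ξ.entry ty).2.rev) ∪ {(γ.entry ty).2.rev} ∪
    (baseBelowLarge K ty P γ).image (fun ξ => (ξ.entry ty).1)

/-- The set of columns `{-a, -a_1, …, -a_k, -b_{i_1}, …, -b_{i_s}}`. -/
noncomputable def colSet (γ : Weight n) : Finset (Idx ty n) :=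
  {(γ.entry ty).1.rev} ∪ (baseBelow K ty P γ).image (fun ξ => (ξ.entry ty).1.rev) ∪
    (baseBelowLarge K ty P γ).image (fun ξ => (ξ.entry ty).2)

/-- The minor `M_γ`. -/
noncomputable def minorM (γ : Weight n) : CoordRing K ty P :=
  minor K ty P (rowSet K ty P γ) (colSet K ty P γ)

/-- The minor `M̄_γ`, with rows `{a, a_1, …, a_k, b_{i_1}, …, b_{i_s}}` and columns
`{-b_1, …, -b_k, -b, -a_{i_1}, …, -a_{i_s}}`. -/
noncomputable def minorMBar (γ : Weight n) : CoordRing K ty P :=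
  minor K ty P ((colSet K ty P γ).image Fin.rev) ((rowSet K ty P γ).image Fin.rev)

open Classical in
/-- The polynomial `L_φ = ∑ M_{ξ+α₁} M̄_{α₂+ξ'}` of an admissible pair, the sum being over all
`α₁, α₂` in the summation set or `0` such that `α₁ + α₂ = α_q` and such that `ξ + α₁` and
`α₂ + ξ'` are roots in `M`. It is written as a sum over the roots `γ = ξ + α₁`,
`γ' = α₂ + ξ'`. -/
noncomputable def polyL (q : AdmissiblePair K ty P) : CoordRing K ty P :=
  ∑ γ : nilRoots K ty P, ∑ γ' : nilRoots K ty P,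
    if (∃ α₁ ∈ insert 0 (Weight.vec '' summationSet K ty P),
        ∃ α₂ ∈ insert 0 (Weight.vec '' summationSet K ty P),
          α₁ + α₂ = q.α.vec ∧ γ.1.vec = q.ξ.vec + α₁ ∧ γ'.1.vec = α₂ + q.ξ'.vec)
    then minorM K ty P γ.1 * minorMBar K ty P γ'.1 else 0

/-! ### The action of `N` and the invariants -/

/-- The action `(Ad_g f)(x) = f (g⁻¹ x g)` on `K[𝔪]`, written at the generic point `𝕏`. -/
noncomputable def adPoly (g : GL (Idx ty n) K) : CoordRing K ty P →ₐ[K] CoordRing K ty P :=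
  aeval fun γ => coordinate ty γ.1
    ((g⁻¹).val.map (algebraMap K (CoordRing K ty P)) * formalMatrix K ty P *
      g.val.map (algebraMap K (CoordRing K ty P)))

/-- The algebra of invariants `K[𝔪]^N`. -/
noncomputable def invariantRing : Subalgebra K (CoordRing K ty P) where
  carrier := {f | ∀ g ∈ unipotentRadical K ty n, adPoly K ty P g f = f}
  mul_mem' := fun ha hb g hg => by rw [map_mul, ha g hg, hb g hg]
  add_mem' := fun ha hb g hg => by rw [map_add, ha g hg, hb g hg]
  algebraMap_mem' := fun r g _ => by simp

end Polynomials

/-! ### The action on the field of rational functions -/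

/-- The sign of a row of the form. -/
def rowSign (A : Type*) [CommRing A] (ty : ClassicalType) {n : ℕ} (i : Idx ty n) : A :=
  if ty = .symplectic ∧ n ≤ (i : ℕ) then -1 else 1

theorem mem_lieAlg_iff {A : Type*} [CommRing A] {ty : ClassicalType} {n : ℕ}
    (x : Matrix (Idx ty n) (Idx ty n) A) :
    x ∈ lieAlg A ty n ↔
      ∀ a b, rowSign A ty a * x a b + rowSign A ty b * x b.rev a.rev = 0 := by
  have key : ∀ u v, (x.transpose * form A ty n + form A ty n * x) u v =
      rowSign A ty v.rev * x v.rev u + rowSign A ty u * x u.rev v := by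
    intro u v
    rw [Matrix.add_apply, Matrix.mul_apply, Matrix.mul_apply, Finset.sum_eq_single v.rev,
      Finset.sum_eq_single u.rev]
    · simp [form, rowSign]
    · intro b _ hb
      simp [form, hb]
    · simp
    · intro b _ hb
      have : v ≠ b.rev := fun h => hb (by rw [h, Fin.rev_rev])
      simp [form, this]
    · simp
  constructor
  · intro h a b
    have := key b a.rev
    rw [Fin.rev_rev] at this
    rw [← this, show x.transpose * form A ty n + form A ty n * x = 0 from h]
    rfl
  · intro h
    show x.transpose * form A ty n + form A ty n * x = 0
    ext u v
    rw [key]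
    simpa using h v.rev u

section Field

variable {ty : ClassicalType} {n : ℕ}

theorem BlockSizes.blockNumber_rev (P : BlockSizes n) (v : Idx ty n) :
    P.blockNumber ty v.rev = - P.blockNumber ty v := by
  simp [blockNumber]

theorem BlockSizes.count_mono (P : BlockSizes n) {a b : ℕ} (h : a ≤ b) :
    P.count a ≤ P.count b :=
  Finset.card_le_card (Finset.monotone_filter_right _ fun _ _ ht => ht.trans h)

theorem BlockSizes.blockNumber_mono (P : BlockSizes n) {a b : Idx ty n} (h : a ≤ b) :
    P.blockNumber ty a ≤ P.blockNumber ty b := by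
  have h1 := P.count_mono (show (a : ℕ) ≤ b from h)
  have h2 := P.count_mono (show (b.rev : ℕ) ≤ a.rev from Fin.rev_le_rev.2 h)
  simp only [blockNumber]
  omega

theorem rootVector_apply (A : Type*) [CommRing A] {γ : Weight n} (hγ : γ ∈ posRoots ty n)
    (r c : Idx ty n) :
    γ.rootVector A ty r c =
      if (γ.entry ty).2.rev = r ∧ (γ.entry ty).1.rev = c then 1
      else if γ.entry ty = (r, c) then
        (if ty = .symplectic ∧ n ≤ (((γ.entry ty).1.rev : Idx ty n) : ℕ) then 1 else -1)
      else 0 := by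
  have hd := two_mul_le_dim ty n
  cases γ with
  | diff i j h =>
    have := i.2
    have := j.2
    have h' : (i : ℕ) < j := h
    have hn : ¬ n ≤ (posIdx ty j : ℕ) := by simp [posIdx]
    have hne : ¬ (posIdx ty i = r ∧ (posIdx ty j).rev = r) := by
      rintro ⟨h1, h3⟩
      rw [← h1] at h3
      simp only [posIdx, Fin.ext_iff, Fin.val_rev] at h3
      omega
    simp only [Weight.rootVector, Weight.entry, Matrix.sub_apply, Matrix.single_apply,
      negIdx, Fin.rev_rev, Prod.mk.injEq, hn, and_false, if_false]
    split_ifs <;> simp_all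
  | sum i j h =>
    have := i.2
    have := j.2
    have h' : (i : ℕ) < j := h
    have hn : n ≤ ((posIdx ty j).rev : ℕ) := by simp only [posIdx, Fin.val_rev]; omega
    have hne : ¬ (posIdx ty i = r ∧ posIdx ty j = r) := by
      rintro ⟨h1, h3⟩
      rw [← h1] at h3
      simp only [posIdx, Fin.ext_iff] at h3
      omega
    simp only [Weight.rootVector, Weight.entry, negIdx, Fin.rev_rev, Prod.mk.injEq, hn, and_true]
    by_cases hty : ty = .symplectic
    · simp only [hty, if_true, Matrix.add_apply, Matrix.single_apply]
      subst hty
      split_ifs <;> simp_all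
    · simp only [hty, if_false, Matrix.sub_apply, Matrix.single_apply]
      split_ifs <;> simp_all
  | double i =>
    simp only [Weight.rootVector, Weight.entry, negIdx, Fin.rev_rev, Prod.mk.injEq,
      Matrix.single_apply]
    split_ifs <;> simp_all
  | single i =>
    have hty : ty = .oddOrthogonal := hγ
    subst hty
    have := i.2
    have hz : (zeroIdx .oddOrthogonal i).rev = zeroIdx .oddOrthogonal i := by
      simp only [zeroIdx, Fin.ext_iff, Fin.val_rev, dim]
      omega
    have hne : ¬ (posIdx .oddOrthogonal i = r ∧ zeroIdx .oddOrthogonal i = r) := by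
      rintro ⟨h1, h3⟩
      rw [← h1] at h3
      simp only [posIdx, zeroIdx, Fin.ext_iff] at h3
      omega
    simp only [Weight.rootVector, Weight.entry, Matrix.sub_apply, Matrix.single_apply,
      negIdx, Fin.rev_rev, Prod.mk.injEq, hz]
    split_ifs <;> simp_all

/-- The positions `ℰ(γ)` lie on or below the antidiagonal, in the columns `-n, …, -1`, and on the
antidiagonal only for the symplectic group. -/
theorem entry_spec {γ : Weight n} (hγ : γ ∈ posRoots ty n) :
    ((γ.entry ty).2.rev : ℕ) < n ∧ ((γ.entry ty).2.rev : ℕ) ≤ (γ.entry ty).1 ∧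
      ((γ.entry ty).2.rev = (γ.entry ty).1 → ty = .symplectic) := by
  have hd := two_mul_le_dim ty n
  cases γ with
  | diff i j h =>
    have := i.2
    have := j.2
    have h' : (i : ℕ) < j := h
    simp only [Weight.entry, negIdx, Fin.rev_rev, posIdx, Fin.val_rev, Fin.ext_iff]
    exact ⟨by omega, by omega, fun _ => by omega⟩
  | sum i j h =>
    have := i.2
    have := j.2
    have h' : (i : ℕ) < j := h
    simp only [Weight.entry, negIdx, Fin.rev_rev, posIdx, Fin.ext_iff]
    exact ⟨by omega, by omega, fun _ => by omega⟩
  | double i =>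
    simp only [Weight.entry, negIdx, Fin.rev_rev, posIdx]
    exact ⟨i.2, le_rfl, fun _ => hγ⟩
  | single i =>
    have := i.2
    simp only [Weight.entry, negIdx, Fin.rev_rev, posIdx, zeroIdx, Fin.ext_iff]
    exact ⟨i.2, by omega, fun _ => by omega⟩

theorem exists_entry {r c : Idx ty n} (h1 : r < c) (h2 : c.rev ≤ r)
    (h3 : c.rev = r → ty = .symplectic) : ∃ γ ∈ posRoots ty n, γ.entry ty = (r, c) := by
  have h1' : (r : ℕ) < c := h1
  have h2' : (c.rev : ℕ) ≤ r := h2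
  rw [Fin.val_rev] at h2'
  have hc := c.2
  have hd : dim ty n = 2 * n ∨ dim ty n = 2 * n + 1 ∧ ty = .oddOrthogonal := by
    cases ty <;> simp [dim]
  have hi : dim ty n - 1 - c < n := by omega
  let i : Fin n := ⟨dim ty n - 1 - c, hi⟩
  have hic : negIdx ty i = c := by
    simp only [negIdx, posIdx, i, Fin.ext_iff, Fin.val_rev]
    omega
  by_cases e : c.rev = r
  · refine ⟨.double i, h3 e, ?_⟩
    simp only [Weight.entry, hic, Prod.mk.injEq, and_true]
    rw [← e, ← hic, negIdx, Fin.rev_rev]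
  have e' : dim ty n - 1 - c ≠ r := by
    intro h
    apply e
    simp only [Fin.ext_iff, Fin.val_rev]
    omega
  rcases lt_or_ge (r : ℕ) n with hr | hr
  · refine ⟨.sum i ⟨r, hr⟩ ?_, trivial, ?_⟩
    · simp only [i, Fin.mk_lt_mk]
      omega
    · simp only [Weight.entry, hic, posIdx]
  · by_cases hz : (r : ℕ) = n ∧ ty = .oddOrthogonal
    · refine ⟨.single i, hz.2, ?_⟩
      simp only [Weight.entry, hic, zeroIdx, Prod.mk.injEq, Fin.ext_iff, and_true]
      exact hz.1.symm
    · have hj : dim ty n - 1 - r < n := by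
        rcases hd with hd | ⟨hd, hty⟩
        · omega
        · have : (r : ℕ) ≠ n := fun h => hz ⟨h, hty⟩
          omega
      refine ⟨.diff i ⟨dim ty n - 1 - r, hj⟩ ?_, trivial, ?_⟩
      · simp only [i, Fin.mk_lt_mk]
        omega
      · refine Prod.ext (Fin.ext ?_) hic
        simp only [Weight.entry, negIdx, posIdx, Fin.val_rev]
        omega

theorem entry_injective {γ γ' : Weight n} (hγ : γ ∈ posRoots ty n) (hγ' : γ' ∈ posRoots ty n)
    (h : γ.entry ty = γ'.entry ty) : γ = γ' := by
  have hd := two_mul_le_dim ty n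
  have hb : ty = .oddOrthogonal → dim ty n = 2 * n + 1 := by
    rintro rfl
    rfl
  have hE1 := congrArg (fun e => (e.1 : ℕ)) h
  have hE2 := congrArg (fun e => (e.2 : ℕ)) h
  cases γ with
  | diff i j hh =>
    have hij : (i : ℕ) < j := hh
    have := i.2
    have := j.2
    cases γ' with
    | diff i' j' hh' =>
      have := i'.2
      have := j'.2
      simp only [Weight.entry, negIdx, posIdx, Fin.val_rev] at hE1 hE2
      have hi : i = i' := by ext; omega
      have hj : j = j' := by ext; omega
      subst hi hj
      rfl
    | sum i' j' hh' =>
      have := i'.2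
      have := j'.2
      simp only [Weight.entry, negIdx, posIdx, Fin.val_rev] at hE1 hE2
      omega
    | double i' =>
      have := i'.2
      simp only [Weight.entry, negIdx, posIdx, Fin.val_rev] at hE1 hE2
      omega
    | single i' =>
      have := i'.2
      have := hb hγ'
      simp only [Weight.entry, negIdx, posIdx, zeroIdx, Fin.val_rev] at hE1 hE2
      omega
  | sum i j hh =>
    have hij : (i : ℕ) < j := hh
    have := i.2
    have := j.2
    cases γ' with
    | diff i' j' hh' =>
      have := i'.2
      have := j'.2
      simp only [Weight.entry, negIdx, posIdx, Fin.val_rev] at hE1 hE2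
      omega
    | sum i' j' hh' =>
      have := i'.2
      have := j'.2
      simp only [Weight.entry, negIdx, posIdx, Fin.val_rev] at hE1 hE2
      have hi : i = i' := by ext; omega
      have hj : j = j' := by ext; omega
      subst hi hj
      rfl
    | double i' =>
      have := i'.2
      simp only [Weight.entry, negIdx, posIdx, Fin.val_rev] at hE1 hE2
      omega
    | single i' =>
      have := i'.2
      simp only [Weight.entry, negIdx, posIdx, zeroIdx, Fin.val_rev] at hE1 hE2
      omega
  | double i =>
    have := i.2
    cases γ' with
    | diff i' j' hh' =>
      have := i'.2
      have := j'.2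
      simp only [Weight.entry, negIdx, posIdx, Fin.val_rev] at hE1 hE2
      omega
    | sum i' j' hh' =>
      have hij' : (i' : ℕ) < j' := hh'
      have := i'.2
      simp only [Weight.entry, negIdx, posIdx, Fin.val_rev] at hE1 hE2
      omega
    | double i' =>
      simp only [Weight.entry, negIdx, posIdx, Fin.val_rev] at hE1 hE2
      have hi : i = i' := by ext; omega
      rw [hi]
    | single i' =>
      simp only [Weight.entry, negIdx, posIdx, zeroIdx, Fin.val_rev] at hE1 hE2
      omega
  | single i =>
    have := i.2
    have := hb hγ
    cases γ' with
    | diff i' j' hh' =>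
      have := i'.2
      have := j'.2
      simp only [Weight.entry, negIdx, posIdx, zeroIdx, Fin.val_rev] at hE1 hE2
      omega
    | sum i' j' hh' =>
      have := j'.2
      simp only [Weight.entry, negIdx, posIdx, zeroIdx, Fin.val_rev] at hE1 hE2
      omega
    | double i' =>
      have := i'.2
      simp only [Weight.entry, negIdx, posIdx, zeroIdx, Fin.val_rev] at hE1 hE2
      omega
    | single i' =>
      have := i'.2
      simp only [Weight.entry, negIdx, posIdx, zeroIdx, Fin.val_rev] at hE1 hE2
      have hi : i = i' := by ext; omega
      rw [hi]

theorem rootVector_mem_lieAlg (A : Type*) [CommRing A] {γ : Weight n}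
    (hγ : γ ∈ posRoots ty n) : γ.rootVector A ty ∈ lieAlg A ty n := by
  rw [mem_lieAlg_iff]
  intro a b
  obtain ⟨h1, h2, h3⟩ := entry_spec hγ
  have hd := two_mul_le_dim ty n
  rw [rootVector_apply A hγ, rootVector_apply A hγ]
  generalize γ.entry ty = e at *
  obtain ⟨r, c⟩ := e
  simp only [Prod.mk.injEq, Fin.rev_inj] at *
  have hc := c.2
  have hcn : n ≤ (c : ℕ) := by
    rw [Fin.val_rev] at h1
    omega
  have h1n : ¬ n ≤ (c.rev : ℕ) := not_le.2 h1
  by_cases e1 : c.rev = a ∧ r.rev = b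
  · obtain ⟨rfl, rfl⟩ := e1
    by_cases e2 : r = c.rev
    · have hty := h3 e2.symm
      subst hty e2
      simp [rowSign, hcn, h1n, -Fin.val_rev]
    · have e3 : ¬ c = r.rev := fun h => e2 (by rw [h, Fin.rev_rev])
      by_cases hty : ty = .symplectic <;> by_cases hn : n ≤ (r.rev : ℕ) <;>
        simp [rowSign, e2, e3, hty, h1n, hn, -Fin.val_rev]
  · by_cases e2 : r = a ∧ c = b
    · obtain ⟨rfl, rfl⟩ := e2
      have e3 : ¬ c.rev = r := by
        intro h
        exact e1 ⟨h, by rw [← h, Fin.rev_rev]⟩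
      have e4 : ¬ r.rev = c := fun h => e3 (by rw [← h, Fin.rev_rev])
      by_cases hty : ty = .symplectic
      · have hrn : n ≤ (r.rev : ℕ) ↔ ¬ n ≤ (r : ℕ) := by
          have e5 : dim ty n = 2 * n := by rw [hty]; rfl
          have := r.2
          rw [Fin.val_rev]
          omega
        by_cases hn : n ≤ (r : ℕ) <;> simp [rowSign, e3, e4, hty, hcn, hrn, hn, -Fin.val_rev]
      · simp [rowSign, e3, e4, hty]
    · have e3 : ¬ (c = b ∧ r = a) := fun h => e2 ⟨h.2, h.1⟩
      have e4 : ¬ (r = b.rev ∧ c = a.rev) := by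
        rintro ⟨rfl, rfl⟩
        exact e1 ⟨by rw [Fin.rev_rev], by rw [Fin.rev_rev]⟩
      simp [e1, e2, e3, e4]

theorem mem_nilRoots_iff {K : Type*} [Field K] {P : BlockSizes n} {γ : Weight n} :
    γ ∈ nilRoots K ty P ↔ γ ∈ posRoots ty n ∧
      P.blockNumber ty (γ.entry ty).1 < P.blockNumber ty (γ.entry ty).2 := by
  constructor
  · rintro ⟨h1, -, h2⟩
    refine ⟨h1, ?_⟩
    by_contra hcon
    have := h2 (γ.entry ty).2.rev (γ.entry ty).1.rev (by
      rw [P.blockNumber_rev, P.blockNumber_rev]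
      omega)
    rw [rootVector_apply K h1] at this
    simp at this
  · rintro ⟨h1, h2⟩
    refine ⟨h1, rootVector_mem_lieAlg K h1, fun i j hij => ?_⟩
    rw [rootVector_apply K h1, if_neg, if_neg]
    · intro h
      rw [h] at h2
      exact absurd h2 (not_lt.2 hij)
    · rintro ⟨rfl, rfl⟩
      rw [P.blockNumber_rev, P.blockNumber_rev] at hij
      omega

section Coordinates

variable {K : Type*} [Field K] {P : BlockSizes n} {A : Type*} [CommRing A]

theorem matrixOf_apply (v : nilRoots K ty P → A) (r c : Idx ty n) :
    matrixOf K ty P v r c = ∑ γ, v γ * γ.1.rootVector A ty r c := by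
  classical
  simp only [matrixOf, Matrix.of_apply]
  refine Finset.sum_congr ?_ fun γ _ => ?_
  · ext
    simp
  rw [rootVector_apply A (mem_nilRoots_iff.1 γ.2).1]
  split_ifs <;> simp

theorem matrixOf_mem (v : nilRoots K ty P → A) : matrixOf K ty P v ∈ nilradical A ty P := by
  refine ⟨?_, fun i j hij => ?_⟩
  · rw [mem_lieAlg_iff]
    intro a b
    rw [matrixOf_apply, matrixOf_apply, Finset.mul_sum, Finset.mul_sum, ← Finset.sum_add_distrib]
    refine Finset.sum_eq_zero fun γ _ => ?_
    have := (mem_lieAlg_iff _).1 (rootVector_mem_lieAlg A (mem_nilRoots_iff.1 γ.2).1) a b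
    linear_combination (v γ) * this
  · rw [matrixOf_apply]
    refine Finset.sum_eq_zero fun γ _ => ?_
    obtain ⟨h1, h2⟩ := mem_nilRoots_iff.1 γ.2
    rw [rootVector_apply A h1, if_neg, if_neg, mul_zero]
    · intro h
      rw [h] at h2
      exact absurd h2 (not_lt.2 hij)
    · rintro ⟨rfl, rfl⟩
      rw [P.blockNumber_rev, P.blockNumber_rev] at hij
      omega

theorem coordinate_matrixOf (v : nilRoots K ty P → A) (γ : nilRoots K ty P) :
    coordinate ty γ.1 (matrixOf K ty P v) = v γ := by
  rw [coordinate, matrixOf_apply, Finset.sum_eq_single γ]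
  · rw [rootVector_apply A (mem_nilRoots_iff.1 γ.2).1]
    simp
  · intro δ _ hδ
    have hδ1 := (mem_nilRoots_iff.1 δ.2).1
    have hγ1 := (mem_nilRoots_iff.1 γ.2).1
    have hne : δ.1.entry ty ≠ γ.1.entry ty := fun h => hδ (Subtype.ext (entry_injective hδ1 hγ1 h))
    rw [rootVector_apply A hδ1, if_neg, if_neg, mul_zero]
    · intro h
      apply hne
      obtain ⟨-, h1, -⟩ := entry_spec hδ1
      obtain ⟨-, h2, -⟩ := entry_spec hγ1
      rw [h] at h1 ⊢
      simp only [Fin.rev_rev] at h1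
      have h3 : (γ.1.entry ty).1 = (γ.1.entry ty).2.rev := Fin.ext (le_antisymm h1 h2)
      ext
      · simp [h3]
      · simp [h3]
    · rintro ⟨h1, h2⟩
      exact hne (Prod.ext (Fin.rev_inj.1 h2) (Fin.rev_inj.1 h1))
  · simp

theorem matrixOf_coordinate (h2 : IsUnit (2 : A)) {y : Matrix (Idx ty n) (Idx ty n) A}
    (hy : y ∈ nilradical A ty P) :
    matrixOf K ty P (fun γ => coordinate ty γ.1 y) = y := by
  obtain ⟨hm1, hm2⟩ := matrixOf_mem (K := K) (P := P) fun γ => coordinate ty γ.1 y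
  obtain ⟨hy1, hy2⟩ := hy
  rw [mem_lieAlg_iff] at hm1 hy1
  have hsgn : ∀ a : Idx ty n, IsUnit (rowSign A ty a) := by
    intro a
    unfold rowSign
    split_ifs <;> simp
  -- positions on or above the antidiagonal
  have upper : ∀ i j : Idx ty n, i ≤ j.rev →
      matrixOf K ty P (fun γ => coordinate ty γ.1 y) i j = y i j := by
    intro i j hij
    by_cases hb : P.blockNumber ty j ≤ P.blockNumber ty i
    · rw [hm2 i j hb, hy2 i j hb]
    have hlt : i < j := by
      by_contra h
      exact hb (P.blockNumber_mono (not_lt.1 h))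
    by_cases hanti : i = j.rev ∧ ty ≠ .symplectic
    · obtain ⟨rfl, hty⟩ := hanti
      have e1 := hm1 j.rev j
      have e2 := hy1 j.rev j
      simp only [rowSign, hty, false_and, if_false, one_mul, Fin.rev_rev, ← two_mul] at e1 e2
      rw [h2.mul_right_eq_zero] at e1 e2
      rw [e1, e2]
    · obtain ⟨γ, hγ, he⟩ := exists_entry (ty := ty) (n := n) (r := j.rev) (c := i.rev)
        (Fin.rev_lt_rev.2 hlt) (by rwa [Fin.rev_rev]) (by
          rw [Fin.rev_rev]
          intro h
          by_contra hty
          exact hanti ⟨h, hty⟩)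
      have hmem : γ ∈ nilRoots K ty P := by
        rw [mem_nilRoots_iff, he]
        refine ⟨hγ, ?_⟩
        show P.blockNumber ty j.rev < P.blockNumber ty i.rev
        rw [P.blockNumber_rev, P.blockNumber_rev]
        omega
      have := coordinate_matrixOf (fun γ : nilRoots K ty P => coordinate ty γ.1 y) ⟨γ, hmem⟩
      simpa [coordinate, he] using this
  ext i j
  rcases le_total i j.rev with hij | hij
  · exact upper i j hij
  · have e1 := hm1 i j
    have e2 := hy1 i j
    rw [upper j.rev i.rev (by rwa [Fin.rev_rev])] at e1
    exact (hsgn i).mul_left_cancel (by linear_combination e1 - e2)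

theorem map_matrixOf {A' : Type*} [CommRing A'] (f : A →+* A') (v : nilRoots K ty P → A) :
    (matrixOf K ty P v).map f = matrixOf K ty P fun γ => f (v γ) := by
  ext r c
  simp only [matrixOf, Matrix.map_apply, Matrix.of_apply, map_sum]
  refine Finset.sum_congr rfl fun γ _ => ?_
  split_ifs <;> simp

theorem conj_mem {g h y : Matrix (Idx ty n) (Idx ty n) A}
    (hgu : ∀ i j, j < i → g i j = 0) (hhu : ∀ i j, j < i → h i j = 0) (hgh : g * h = 1)
    (hh : h.transpose * form A ty n * h = form A ty n) (hy : y ∈ nilradical A ty P) :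
    g * y * h ∈ nilradical A ty P := by
  obtain ⟨hy1, hy2⟩ := hy
  have hy1 : y.transpose * form A ty n + form A ty n * y = 0 := hy1
  have hhg : h * g = 1 := mul_eq_one_comm.1 hgh
  refine ⟨?_, fun i j hij => ?_⟩
  · show (g * y * h).transpose * form A ty n + form A ty n * (g * y * h) = 0
    have e1 : form A ty n * g = h.transpose * form A ty n := by
      calc _ = (h.transpose * form A ty n * h) * g := by rw [hh]
        _ = h.transpose * form A ty n * (h * g) := by simp only [Matrix.mul_assoc]
        _ = _ := by rw [hhg, Matrix.mul_one]
    have e2 : g.transpose * form A ty n = form A ty n * h := by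
      calc _ = g.transpose * (h.transpose * form A ty n * h) := by rw [hh]
        _ = (h * g).transpose * (form A ty n * h) := by
            rw [Matrix.transpose_mul]
            simp only [Matrix.mul_assoc]
        _ = _ := by rw [hhg, Matrix.transpose_one, Matrix.one_mul]
    calc _ = h.transpose * y.transpose * (g.transpose * form A ty n) +
          (form A ty n * g) * y * h := by
            simp only [Matrix.transpose_mul, Matrix.mul_assoc]
      _ = h.transpose * (y.transpose * form A ty n + form A ty n * y) * h := by
            rw [e1, e2]
            simp only [Matrix.mul_assoc, Matrix.mul_add, Matrix.add_mul]
      _ = 0 := by rw [hy1, Matrix.mul_zero, Matrix.zero_mul]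
  · rw [Matrix.mul_apply]
    refine Finset.sum_eq_zero fun l _ => ?_
    rcases lt_or_ge j l with hl | hl
    · rw [hhu _ _ hl, mul_zero]
    rw [Matrix.mul_apply, Finset.sum_eq_zero, zero_mul]
    intro k _
    rcases lt_or_ge k i with hk | hk
    · rw [hgu _ _ hk, zero_mul]
    rw [hy2 k l, mul_zero]
    exact (P.blockNumber_mono hl).trans (hij.trans (P.blockNumber_mono hk))

end Coordinates

section Action

variable {K : Type*} [Field K] [CharZero K] {P : BlockSizes n}

/-- Applying `Ad_g` to the entries of the generic matrix gives `g⁻¹ 𝕏 g`. -/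
theorem map_adPoly_formalMatrix {g : GL (Idx ty n) K} (hg : g ∈ unipotentRadical K ty n) :
    (formalMatrix K ty P).map (adPoly K ty P g) =
      (g⁻¹).val.map (algebraMap K (CoordRing K ty P)) * formalMatrix K ty P *
        g.val.map (algebraMap K (CoordRing K ty P)) := by
  have h2 : IsUnit (2 : CoordRing K ty P) := by
    have : IsUnit (algebraMap K (CoordRing K ty P) 2) :=
      (IsUnit.mk0 (2 : K) two_ne_zero).map _
    rwa [map_ofNat] at this
  have hform : (form K ty n).map (algebraMap K (CoordRing K ty P)) = form _ ty n := by
    ext i j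
    simp only [form, Matrix.map_apply, Matrix.of_apply]
    split_ifs <;> simp
  have hu := hg.2.1
  have hu' := inv_upper g hu
  have hgG : g.val.transpose * form K ty n * g.val = form K ty n := hg.1
  have hmem := conj_mem (P := P) (A := CoordRing K ty P)
    (g := (g⁻¹).val.map (algebraMap K (CoordRing K ty P)))
    (h := g.val.map (algebraMap K (CoordRing K ty P))) (y := formalMatrix K ty P)
    (fun i j h => by rw [Matrix.map_apply, hu' i j h, map_zero])
    (fun i j h => by rw [Matrix.map_apply, hu i j h, map_zero])
    (by rw [← Matrix.map_mul, ← Units.val_mul, inv_mul_cancel, Units.val_one, Matrix.map_one _ (map_zero _) (map_one _)])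
    (by rw [← hform, ← Matrix.transpose_map, ← Matrix.map_mul, ← Matrix.map_mul, hgG])
    (matrixOf_mem _)
  rw [← matrixOf_coordinate (K := K) h2 hmem]
  have := map_matrixOf (adPoly K ty P g : CoordRing K ty P →+* CoordRing K ty P)
    (fun γ : nilRoots K ty P => (X γ : CoordRing K ty P))
  refine this.trans ?_
  congr 1
  ext1 γ
  simp [adPoly]

theorem adPoly_inv_adPoly {g : GL (Idx ty n) K} (hg : g ∈ unipotentRadical K ty n)
    (f : CoordRing K ty P) : adPoly K ty P g⁻¹ (adPoly K ty P g f) = f := by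
  suffices h : (adPoly K ty P g⁻¹).comp (adPoly K ty P g) = AlgHom.id K _ from
    DFunLike.congr_fun h f
  refine MvPolynomial.algHom_ext fun γ => ?_
  have hmap := map_adPoly_formalMatrix (P := P) (inv_mem hg)
  have hc : ∀ a : Matrix (Idx ty n) (Idx ty n) K,
      (a.map (algebraMap K (CoordRing K ty P))).map (adPoly K ty P g⁻¹) =
        a.map (algebraMap K (CoordRing K ty P)) := by
    intro a
    ext i j
    simp
  have h1 : (g⁻¹).val.map (algebraMap K (CoordRing K ty P)) *
      g.val.map (algebraMap K (CoordRing K ty P)) = 1 := by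
    rw [← Matrix.map_mul, ← Units.val_mul, inv_mul_cancel, Units.val_one,
      Matrix.map_one _ (map_zero _) (map_one _)]
  have key : ((g⁻¹).val.map (algebraMap K (CoordRing K ty P)) * formalMatrix K ty P *
      g.val.map (algebraMap K (CoordRing K ty P))).map (adPoly K ty P g⁻¹) =
        formalMatrix K ty P := by
    rw [Matrix.map_mul, Matrix.map_mul, hc, hc, hmap, inv_inv]
    calc _ = ((g⁻¹).val.map (algebraMap K (CoordRing K ty P)) *
          g.val.map (algebraMap K (CoordRing K ty P))) * formalMatrix K ty P *
          ((g⁻¹).val.map (algebraMap K (CoordRing K ty P)) *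
          g.val.map (algebraMap K (CoordRing K ty P))) := by
            simp only [Matrix.mul_assoc]
      _ = _ := by rw [h1, Matrix.one_mul, Matrix.mul_one]
  have hco := coordinate_matrixOf (fun γ : nilRoots K ty P => (X γ : CoordRing K ty P)) γ
  have hx : adPoly K ty P g (X γ) = coordinate ty γ.1
      ((g⁻¹).val.map (algebraMap K (CoordRing K ty P)) * formalMatrix K ty P *
        g.val.map (algebraMap K (CoordRing K ty P))) := by
    rw [adPoly, aeval_X]
  rw [AlgHom.comp_apply, AlgHom.id_apply, hx]
  exact (congrArg (coordinate ty γ.1) key).trans hco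

theorem adPoly_injective {g : GL (Idx ty n) K} (hg : g ∈ unipotentRadical K ty n) :
    Function.Injective (adPoly K ty P g) :=
  Function.LeftInverse.injective (adPoly_inv_adPoly hg)

end Action

end Field

section RationalFunctions

variable (K : Type*) [Field K] [CharZero K] (ty : ClassicalType) {n : ℕ} (P : BlockSizes n)

/-- The field `K(𝔪)` of rational functions. -/
abbrev FunctionField : Type _ := FractionRing (CoordRing K ty P)

/-- The action of `g ∈ N` on `K(𝔪)`, extending that on `K[𝔪]`. -/
noncomputable def adField (g : unipotentRadical K ty n) :
    FunctionField K ty P →ₐ[K] FunctionField K ty P :=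
  IsFractionRing.liftAlgHom (A := CoordRing K ty P)
    (g := (IsScalarTower.toAlgHom K (CoordRing K ty P) (FunctionField K ty P)).comp
      (adPoly K ty P g.1))
    ((IsFractionRing.injective (CoordRing K ty P) (FunctionField K ty P)).comp
      (adPoly_injective g.2))

/-- The field of invariants `K(𝔪)^N`. -/
noncomputable def invariantField : IntermediateField K (FunctionField K ty P) where
  carrier := {f | ∀ g, adField K ty P g f = f}
  mul_mem' := fun ha hb g => by rw [map_mul, ha g, hb g]
  add_mem' := fun ha hb g => by rw [map_add, ha g, hb g]
  algebraMap_mem' := fun r g => by simp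
  inv_mem' := fun a ha g => by rw [map_inv₀, ha g]

end RationalFunctions

end ParabolicInvariants

/-! The proof replaces roots by matrix positions. A positive root occupies its entry and the
reflection of that entry in the antidiagonal (`Occupies`). The weight at the position `(r, c)` is
the difference of the weights of the labels `r` and `c`, so adding roots becomes composing positions
`(r, s)`, `(s, c)`. The positions of the base form a set `F` with at most one element in each row
and column, stable under the reflection. Every other position above the block diagonal has an
element of `F` to its left or below it, except possibly on the antidiagonal in the orthogonal case
(`symmetricRook_basePositions`).

The key estimate is `rank_corner_le`: for a matrix in the nilradical, the south-west corner cut out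
by the rows from `u` on and the columns before `v` has rank at most the number of elements of `F` in
it. This is a covering by rows and columns. The undominated antidiagonal positions of the orthogonal
case are paid for by the singularity of skew matrices of odd size.

Each `M_γ` is a pivot minor: its rows and columns are those of one position and of the elements of
`F` strictly south-west of it. If `g X' = X g` with `g` upper unitriangular, multiplication by `g`
adds lower rows to upper ones and left columns to right ones. The rank estimate makes almost all of
these additions invisible to the minor. For `(x, y)` in `F` the pivot minors at `(x, t)`, with `t`
in a window starting at `y`, therefore transform as a row vector under `g` (`pivotMinor_transform`).
At `t = y` this is the invariance of `M_ξ`. By reflection, the pivot minors at `(t, w)`, with `(z,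
w)` in `F`, transform as a column vector under the inverse of `g`. Hence the sum over `t` from `y`
to `z` of the products of the two is invariant (`sum_pivotMinor_invariant`). An admissible pair
gives exactly such a chain `(x, y)`, `(y, z)`, `(z, w)` with the root `α_q` in the middle, and `L_φ`
is this sum up to a sign (`IsChain.polyL_eq_sum`).

Independence is the Jacobian criterion at the point with coordinates `1` on the base and `0`
elsewhere, where the generic matrix is nonzero exactly on `F`. Derivatives are read off from values
in the dual numbers. There `L_φ` has derivative `0` in the directions of the base and of the other
roots of `Φ`, and a nonzero one in the direction `φ`. The `M_ξ` form a triangular system in the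
directions of the base, ordered by the distance of the position from the diagonal. The bound for the
transcendence degree follows, since an algebraically independent family of invariant polynomials
stays independent in the invariant field. -/

namespace ParabolicInvariants

/-! ### Ranks, and determinants under row changes controlled by a flag. -/

section LinearAlgebra

variable {L : Type*} [Field L]

theorem rank_add_le {p q : Type*} [Fintype p] [Fintype q] (A B : Matrix p q L) :
    (A + B).rank ≤ A.rank + B.rank := by
  classical
  rw [Matrix.rank, Matrix.rank, Matrix.rank, Matrix.mulVecLin_add]
  exact (Submodule.finrank_mono (LinearMap.range_add_le _ _)).trans
    (Submodule.finrank_add_le_finrank_add_finrank _ _)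

/-- A matrix whose nonzero columns lie in a set `T` on which there is a nontrivial linear relation
between the columns has rank less than the cardinality of `T`. -/
theorem rank_lt_card_of_relation {p q : Type*} [Fintype p] [Fintype q] [DecidableEq q]
    (A : Matrix p q L) (T : Finset q) (hT : ∀ i, ∀ j ∉ T, A i j = 0) (v : q → L)
    (j₀ : q) (hj₀ : j₀ ∈ T) (hv : v j₀ ≠ 0) (h : ∀ i, ∑ j ∈ T, A i j * v j = 0) :
    A.rank < T.card := by
  -- Right multiplication by `B` recovers the column `j₀` from the other columns of `T` through the
  -- relation, so the rank of `A` is bounded by the number of nonzero rows of `B`, which lie in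
  -- `T.erase j₀`.
  let B : Matrix q q L := Matrix.of fun l j =>
    if l ∈ T.erase j₀ then (if j = l then 1 else if j = j₀ then - v l / v j₀ else 0) else 0
  have hAB : A = A * B := by
    ext i j
    rw [Matrix.mul_apply]
    by_cases hj : j = j₀
    · subst hj
      have h1 := h i
      rw [← Finset.add_sum_erase _ _ hj₀] at h1
      have h2 : ∀ l, A i l * B l j = if l ∈ T.erase j then - (A i l * v l) / v j else 0 := by
        intro l
        by_cases hl : l ∈ T.erase j
        · have : j ≠ l := (Finset.ne_of_mem_erase hl).symm
          simp only [B, Matrix.of_apply, hl, if_true, this, if_false]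
          ring
        · simp only [B, Matrix.of_apply, hl, if_false, mul_zero]
      simp only [h2]
      rw [Finset.sum_ite_mem, Finset.univ_inter, ← Finset.sum_div, Finset.sum_neg_distrib,
        eq_div_iff hv]
      linear_combination h1
    · by_cases hjT : j ∈ T
      · rw [Finset.sum_eq_single j]
        · simp [B, hj, hjT]
        · intro l _ hl
          simp [B, hl.symm, hj]
        · simp
      · rw [hT i j hjT, Finset.sum_eq_zero]
        intro l _
        by_cases hl : l ∈ T.erase j₀
        · have : j ≠ l := by
            rintro rfl
            exact hjT (Finset.mem_of_mem_erase hl)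
          simp [B, this, hj]
        · simp only [B, Matrix.of_apply, hl, if_false, mul_zero]
  have hB : B.rank ≤ (T.erase j₀).card := by
    refine Matrix.rank_le_card_of_support_subset B _ fun l hl => ?_
    by_contra hcon
    apply hl
    ext j
    have : l ∉ T.erase j₀ := hcon
    simp only [B, Matrix.row, Matrix.of_apply, this, if_false, Pi.zero_apply]
  calc A.rank ≤ B.rank := by
        conv_lhs => rw [hAB]
        exact Matrix.rank_mul_le_right _ _
    _ ≤ (T.erase j₀).card := hB
    _ < T.card := Finset.card_erase_lt_of_mem hj₀

theorem rank_le_card_of_columns {p q : Type*} [Fintype p] [Fintype q]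
    (A : Matrix p q L) (T : Finset q) (hT : ∀ i, ∀ j ∉ T, A i j = 0) : A.rank ≤ T.card := by
  rw [← Matrix.rank_transpose]
  refine Matrix.rank_le_card_of_support_subset _ _ fun l hl => ?_
  by_contra hcon
  exact hl (funext fun i => hT i l hcon)

/-- A determinant does not change if vectors are added to its rows in such a way that the vector
added to the row `i` and all the later rows lie in a subspace of dimension at most the number of
the later rows. -/
theorem det_eq_of_flag {ι : Type*} [Fintype ι] [DecidableEq ι] (rk : ι → ℕ)
    (hrk : Function.Injective rk) (N N' : Matrix ι ι L)
    (h : ∀ i, N' i = N i ∨ ∃ W : Submodule L (ι → L),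
      Module.finrank L W ≤ (Finset.univ.filter fun j => rk i < rk j).card ∧
      N' i - N i ∈ W ∧ ∀ j, rk i < rk j → N j ∈ W) : N'.det = N.det := by
  -- Rows are replaced in order of nondecreasing `rk`, so when the row `a` is changed all rows after
  -- it are still those of `N`.
  have key : ∀ T : Finset ι, (Matrix.of fun i => if i ∈ T then N' i else N i).det = N.det := by
    intro T
    induction T using Finset.induction_on_max_value rk with
    | empty => rfl
    | insert a T haT ha ih =>
      rw [← ih]
      set C : Matrix ι ι L := Matrix.of fun i => if i ∈ T then N' i else N i with hC
      have hCa : C a = N a := by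
        funext j
        simp [hC, haT]
      have e1 : (Matrix.of fun i => if i ∈ insert a T then N' i else N i) =
          C.updateRow a (N a + (N' a - N a)) := by
        ext i j
        by_cases hi : i = a
        · subst hi
          simp
        · simp [hC, hi, Matrix.updateRow_ne]
      rw [e1, Matrix.det_updateRow_add, ← hCa, Matrix.updateRow_eq_self, hCa, add_eq_left]
      rcases h a with h1 | ⟨W, hW, h1, h2⟩
      · rw [h1, sub_self]
        exact Matrix.det_eq_zero_of_row_eq_zero a (fun j => by simp)
      -- If the determinant with the difference in row `a` were nonzero, that row and the later ones
      -- would be independent vectors of `W`, one more than its dimension allows.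
      · by_contra hdet
        have hunit : IsUnit (C.updateRow a (N' a - N a)) :=
          (Matrix.isUnit_iff_isUnit_det _).2 (isUnit_iff_ne_zero.2 hdet)
        have hli := Matrix.linearIndependent_rows_iff_isUnit.2 hunit
        have hmem : ∀ i : {i // rk a ≤ rk i}, (C.updateRow a (N' a - N a)) i.1 ∈ W := by
          rintro ⟨i, hi⟩
          rcases hi.eq_or_lt with hi | hi
          · obtain rfl := hrk hi
            simpa using h1
          · have h3 : i ∉ T := fun h => absurd (ha i h) (not_le.2 hi)
            have : C i = N i := by
              ext j
              simp [hC, h3]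
            rw [Matrix.updateRow_ne (fun h => hi.ne' (congrArg rk h)), this]
            exact h2 i hi
        have hli2 : LinearIndependent L fun i : {i // rk a ≤ rk i} =>
            (⟨(C.updateRow a (N' a - N a)) i.1, hmem i⟩ : W) := by
          apply LinearIndependent.of_comp W.subtype
          exact hli.comp (fun i : {i // rk a ≤ rk i} => i.1) Subtype.val_injective
        have hcard := hli2.fintype_card_le_finrank
        rw [Fintype.card_subtype] at hcard
        have : (Finset.univ.filter fun j => rk a < rk j) ⊂ Finset.univ.filter fun j => rk a ≤ rk j := by
          refine Finset.ssubset_iff_subset_ne.2 ⟨fun j => by simpa using le_of_lt, fun h => ?_⟩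
          have : a ∈ Finset.univ.filter fun j => rk a < rk j := by rw [h]; simp
          simp at this
        have := Finset.card_lt_card this
        omega
  have := key Finset.univ
  simp only [Finset.mem_univ, if_true] at this
  exact this

end LinearAlgebra

/-! ### Symmetric rook placements and the rank of south-west corners. -/

section Rook

variable {m : ℕ}

/-- A symmetric maximal-from-the-south-west rook placement in the positions above a block
diagonal. The positions on the antidiagonal are used only if `anti` holds. -/
structure SymmetricRook (b : Fin m → ℤ) (anti : Prop) (F : Finset (Fin m × Fin m)) : Prop where
  mono : Monotone b
  rev : ∀ v, b v.rev = - b v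
  block_lt : ∀ {r c}, (r, c) ∈ F → b r < b c
  anti_of_mem : ∀ {r}, (r, r.rev) ∈ F → anti
  symm : ∀ {r c}, (r, c) ∈ F → (c.rev, r.rev) ∈ F
  row_unique : ∀ {r c c'}, (r, c) ∈ F → (r, c') ∈ F → c = c'
  dominated : ∀ {r c}, b r < b c → (c = r.rev → anti) → (r, c) ∉ F →
    (∃ c', c' < c ∧ (r, c') ∈ F) ∨ ∃ r', r < r' ∧ (r', c) ∈ F

/-- The strictly block upper triangular matrices, skew with respect to the antidiagonal unless
`anti` holds. -/
structure Staircase {A : Type*} [CommRing A] (b : Fin m → ℤ) (anti : Prop)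
    (X : Matrix (Fin m) (Fin m) A) : Prop where
  zero : ∀ i j, b j ≤ b i → X i j = 0
  skew : ¬ anti → ∀ i j, X j.rev i.rev = - X i j

theorem SymmetricRook.col_unique {b : Fin m → ℤ} {anti : Prop} {F : Finset (Fin m × Fin m)}
    (hF : SymmetricRook b anti F) {r r' c : Fin m} (h : (r, c) ∈ F) (h' : (r', c) ∈ F) :
    r = r' :=
  Fin.rev_inj.1 (hF.row_unique (hF.symm h) (hF.symm h'))

/-- The entries of `X` in the rows `≥ u` and the columns `< v`. -/
def corner {A : Type*} [Zero A] (u v : ℕ) (X : Matrix (Fin m) (Fin m) A) :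
    Matrix (Fin m) (Fin m) A :=
  Matrix.of fun r c => if u ≤ (r : ℕ) ∧ (c : ℕ) < v then X r c else 0

/-- The elements of `F` in the rows `≥ u` and the columns `< v`. -/
def cornerSet (F : Finset (Fin m × Fin m)) (u v : ℕ) : Finset (Fin m × Fin m) :=
  F.filter fun p => u ≤ (p.1 : ℕ) ∧ (p.2 : ℕ) < v

theorem mem_cornerSet {F : Finset (Fin m × Fin m)} {u v : ℕ} {r c : Fin m} :
    (r, c) ∈ cornerSet F u v ↔ (r, c) ∈ F ∧ u ≤ (r : ℕ) ∧ (c : ℕ) < v := by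
  simp [cornerSet]

variable {L : Type*} [Field L] {b : Fin m → ℤ} {anti : Prop} {F : Finset (Fin m × Fin m)}

/-- A row without elements of `F` in which a column of the antidiagonal has no element of `F`
below it: the matrix in the corner is skew of odd size. -/
theorem rank_corner_le_of_skew (h2 : (2 : L) ≠ 0) (hF : SymmetricRook b anti F)
    {X : Matrix (Fin m) (Fin m) L} (hX : Staircase b anti X) (hanti : ¬ anti) (r₁ : Fin m)
    (hcol : ∀ c, c < r₁.rev → b r₁ < b c → ∃ r, r₁ < r ∧ (r, c) ∈ F)
    (hbad : ∀ r, r₁ < r → (r, r₁.rev) ∉ F) (hb : b r₁ < b r₁.rev)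
    (hrow : ∀ c, c ≤ r₁.rev → (r₁, c) ∉ F) :
    (corner r₁ (r₁.rev + 1) X).rank ≤ (cornerSet F r₁ (r₁.rev + 1)).card := by
  set cs := r₁.rev with hcs
  let T : Finset (Fin m) := Finset.univ.filter fun c => c ≤ cs ∧ b r₁ < b c
  have hcsT : cs ∈ T := by simp [T, hb]
  -- `T` holds the columns of the corner that can be nonzero. Each of them except `cs` contains
  -- exactly one element of `G`, so `T` has one element more than `G`.
  set G := cornerSet F r₁ (cs + 1) with hG
  have hGmem : ∀ r c, (r, c) ∈ G ↔ (r, c) ∈ F ∧ r₁ < r ∧ c < cs := by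
    intro r c
    rw [hG, mem_cornerSet]
    refine ⟨fun ⟨h1, h3, h4⟩ => ?_, fun ⟨h1, h3, h4⟩ => ⟨h1, h3.le, by
      have : (c : ℕ) < cs := h4
      omega⟩⟩
    have h5 : r₁ ≤ r := h3
    have h6 : c ≤ cs := Nat.lt_succ_iff.1 h4
    have h7 : r₁ ≠ r := by
      rintro rfl
      exact hrow c h6 h1
    have h8 := lt_of_le_of_ne h5 h7
    refine ⟨h1, h8, lt_of_le_of_ne h6 ?_⟩
    rintro rfl
    exact hbad r h8 h1
  have himg : G.image Prod.snd = T.erase cs := by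
    ext c
    simp only [Finset.mem_image, Prod.exists, exists_eq_right, Finset.mem_erase, T,
      Finset.mem_filter, Finset.mem_univ, true_and]
    constructor
    · rintro ⟨r, h⟩
      obtain ⟨h1, h3, h4⟩ := (hGmem r c).1 h
      exact ⟨h4.ne, h4.le, (hF.mono h3.le).trans_lt (hF.block_lt h1)⟩
    · rintro ⟨h1, h3, h4⟩
      have h5 := lt_of_le_of_ne h3 h1
      obtain ⟨r, h6, h7⟩ := hcol c h5 h4
      exact ⟨r, (hGmem r c).2 ⟨h7, h6, h5⟩⟩
  have hcard : G.card = (T.erase cs).card := by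
    rw [← himg, Finset.card_image_of_injOn]
    rintro ⟨r, c⟩ h ⟨r', c'⟩ h' (rfl : c = c')
    rw [hF.col_unique ((hGmem _ _).1 h).1 ((hGmem _ _).1 h').1]
  -- Reflection in the antidiagonal is an involution of `G`. It has no fixed points because `anti`
  -- fails.
  have heven : Even G.card := by
    rw [← ZMod.natCast_eq_zero_iff_even]
    have : ∑ _x ∈ G, (1 : ZMod 2) = 0 := by
      refine Finset.sum_involution (fun p _ => (p.2.rev, p.1.rev)) ?_ ?_ ?_ ?_
      · intros
        decide
      · rintro ⟨r, c⟩ h _ h'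
        have h3 : r.rev = c := congrArg Prod.snd h'
        subst h3
        exact hanti (hF.anti_of_mem ((hGmem _ _).1 h).1)
      · rintro ⟨r, c⟩ h
        obtain ⟨h1, h3, h4⟩ := (hGmem _ _).1 h
        refine (hGmem _ _).2 ⟨hF.symm h1, ?_, ?_⟩
        · rw [← Fin.rev_lt_rev, Fin.rev_rev]
          exact h4
        · exact Fin.rev_lt_rev.2 h3
      · rintro ⟨r, c⟩ _
        simp
    simpa using this
  have hTcard : T.card = G.card + 1 := by
    rw [hcard, Finset.card_erase_add_one hcsT]
  -- With its rows reflected, the nonzero part of the corner becomes a skew matrix of the odd size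
  -- `T.card`. It is singular since `2 ≠ 0`, and a kernel vector is the relation that lowers the
  -- rank below `T.card`.
  let B : Matrix T T L := Matrix.of fun i j => X i.1.rev j.1
  have hB : B.transpose = -B := by
    ext i j
    have := hX.skew hanti i.1.rev j.1
    rw [Fin.rev_rev] at this
    simpa [B] using this
  have hdet : B.det = 0 := by
    have h3 := congrArg Matrix.det hB
    rw [Matrix.det_transpose, Matrix.det_neg, Fintype.card_coe, hTcard, pow_succ,
      heven.neg_one_pow, one_mul, neg_one_mul] at h3
    have h4 : 2 * B.det = 0 := by linear_combination h3
    exact (mul_eq_zero.1 h4).resolve_left h2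
  obtain ⟨v, hv0, hv⟩ := Matrix.exists_mulVec_eq_zero_iff.2 hdet
  obtain ⟨j₀, hj₀⟩ := Function.ne_iff.1 hv0
  have hlt := rank_lt_card_of_relation (corner r₁ (cs + 1) X) T (by
      intro i j hj
      simp only [corner, Matrix.of_apply]
      split_ifs with h
      · apply hX.zero
        by_contra hcon
        apply hj
        have h5 : r₁ ≤ i := h.1
        have h6 : j ≤ cs := Nat.lt_succ_iff.1 h.2
        simp only [T, Finset.mem_filter, Finset.mem_univ, true_and]
        exact ⟨h6, (hF.mono h5).trans_lt (not_le.1 hcon)⟩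
      · rfl) (fun j => if h : j ∈ T then v ⟨j, h⟩ else 0) j₀.1 j₀.2 (by simpa using hj₀) (by
      intro i
      by_cases hi : i.rev ∈ T
      · have h3 := congrFun hv ⟨i.rev, hi⟩
        rw [Matrix.mulVec, dotProduct] at h3
        rw [← Finset.sum_coe_sort, ← show _ = (0 : L) from h3]
        refine Finset.sum_congr rfl fun j _ => ?_
        have h5 : r₁ ≤ i := by
          have := (Finset.mem_filter.1 hi).2.1
          exact Fin.rev_le_rev.1 this
        have h6 : j.1 ≤ cs := (Finset.mem_filter.1 j.2).2.1
        have h7 : (r₁ : ℕ) ≤ i ∧ (j.1 : ℕ) < cs + 1 := ⟨h5, Nat.lt_succ_iff.2 h6⟩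
        simp only [corner, Matrix.of_apply, h7, and_self, if_true, B, Fin.rev_rev, j.2, dif_pos]
      · refine Finset.sum_eq_zero fun j hj => ?_
        simp only [corner, Matrix.of_apply]
        split_ifs with h
        · rw [hX.zero, zero_mul]
          have h5 : r₁ ≤ i := h.1
          have h6 : j ≤ cs := Nat.lt_succ_iff.1 h.2
          have h7 : ¬ (b r₁ < b i.rev) := fun h8 => hi (by
            simp only [T, Finset.mem_filter, Finset.mem_univ, true_and]
            exact ⟨Fin.rev_le_rev.2 h5, h8⟩)
          have h8 := hF.mono h6
          rw [hF.rev] at h7 h8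
          omega
        · rw [zero_mul])
  omega

/-- The rank of the corner of a matrix with rows `≥ u` and columns `< v` is at most the number of
elements of `F` in the corner. -/
theorem rank_corner_le (h2 : (2 : L) ≠ 0) (hF : SymmetricRook b anti F)
    {X : Matrix (Fin m) (Fin m) L} (hX : Staircase b anti X) (u v : ℕ) :
    (corner u v X).rank ≤ (cornerSet F u v).card := by
  classical
  -- The rows of the corner that contain no element of `F` inside the corner.
  let Z : Finset (Fin m) := Finset.univ.filter fun r => u ≤ (r : ℕ) ∧
    ∀ c : Fin m, (c : ℕ) < v → (r, c) ∉ F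
  -- rows that contain elements of `F`
  have hrows : ∀ R : Finset (Fin m), (∀ r ∈ R, u ≤ (r : ℕ) ∧ r ∉ Z) →
      ∀ u', (∀ r ∈ R, (r : ℕ) < u') → u ≤ u' →
        R.card + (cornerSet F u' v).card ≤ (cornerSet F u v).card := by
    intro R hR u' hu' huu'
    have hex : ∀ r ∈ R, ∃ c, (r, c) ∈ F ∧ (c : ℕ) < v := by
      intro r hr
      obtain ⟨h1, h3⟩ := hR r hr
      by_contra hcon
      apply h3
      simp only [Z, Finset.mem_filter, Finset.mem_univ, true_and]
      exact ⟨h1, fun c hc h => hcon ⟨c, h, hc⟩⟩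
    choose! c hc hcv using hex
    have hR' : R.card = (R.image fun r => (r, c r)).card := by
      rw [Finset.card_image_of_injective]
      intro a b h
      exact congrArg Prod.fst h
    rw [hR', ← Finset.card_union_of_disjoint]
    · refine Finset.card_le_card ?_
      rintro ⟨r, c'⟩ h
      rw [Finset.mem_union, Finset.mem_image] at h
      rcases h with ⟨r', hr', h⟩ | h
      · rw [← h]
        exact mem_cornerSet.2 ⟨hc _ hr', (hR _ hr').1, hcv _ hr'⟩
      · obtain ⟨h1, h3, h4⟩ := mem_cornerSet.1 h
        exact mem_cornerSet.2 ⟨h1, huu'.trans h3, h4⟩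
    · rw [Finset.disjoint_left]
      rintro ⟨r, c'⟩ h h'
      obtain ⟨r', hr', h⟩ := Finset.mem_image.1 h
      obtain rfl : r' = r := congrArg Prod.fst h
      have := hu' _ hr'
      have := (mem_cornerSet.1 h').2.1
      omega
  by_cases hZ : Z.Nonempty
  swap
  · rw [Finset.not_nonempty_iff_eq_empty] at hZ
    have h1 := hrows (Finset.univ.filter fun r => u ≤ (r : ℕ)) (by
      intro r hr
      rw [hZ]
      simpa using hr) (m + u) (fun r _ => by have := r.2; omega) (by omega)
    refine le_trans ?_ (le_trans (Nat.le_add_right _ _) h1)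
    refine Matrix.rank_le_card_of_support_subset _ _ fun r hr => ?_
    by_contra hcon
    apply hr
    ext c
    have : ¬ u ≤ (r : ℕ) := by simpa using hcon
    simp [corner, this]
  -- Above `r₁` every row of the corner contains its own element of `F`, which pays for the rank of
  -- that row. Only the rows from `r₁` on remain.
  set r₁ := Z.min' hZ with hr₁
  obtain ⟨hr₁u, hr₁F⟩ : u ≤ (r₁ : ℕ) ∧ ∀ c : Fin m, (c : ℕ) < v → (r₁, c) ∉ F := by
    have := Z.min'_mem hZ
    simpa [Z] using this
  let R : Finset (Fin m) := Finset.univ.filter fun r => u ≤ (r : ℕ) ∧ r < r₁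
  have hR := hrows R (by
    intro r hr
    simp only [R, Finset.mem_filter, Finset.mem_univ, true_and] at hr
    exact ⟨hr.1, fun h => absurd (Z.min'_le r h) (not_le.2 hr.2)⟩) r₁ (by
    intro r hr
    simp only [R, Finset.mem_filter, Finset.mem_univ, true_and] at hr
    exact hr.2) hr₁u
  have hsplit : corner u v X = (Matrix.of fun r c => if r ∈ R then corner u v X r c else 0) +
      corner r₁ v X := by
    ext r c
    simp only [corner, Matrix.add_apply, Matrix.of_apply, R, Finset.mem_filter, Finset.mem_univ,
      true_and, Fin.lt_def]
    by_cases h1 : (r₁ : ℕ) ≤ r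
    · have h3 : u ≤ (r : ℕ) := hr₁u.trans h1
      simp [h1, h3, not_lt.2 h1]
    · by_cases h3 : u ≤ (r : ℕ)
      · simp [h1, h3, not_le.1 h1]
      · simp [h1, h3]
  have hRrank : (Matrix.of fun r c => if r ∈ R then corner u v X r c else 0).rank ≤ R.card := by
    refine Matrix.rank_le_card_of_support_subset _ _ fun r hr => ?_
    by_contra hcon
    apply hr
    ext c
    have : r ∉ R := by simpa using hcon
    simp [this]
  suffices hmain : (corner r₁ v X).rank ≤ (cornerSet F r₁ v).card by
    have h1 := rank_add_le (Matrix.of fun r c => if r ∈ R then corner u v X r c else 0)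
      (corner r₁ v X)
    rw [← hsplit] at h1
    omega
  -- columns that contain elements of `F` below the row `r₁`
  have hcols : ∀ v' ≤ v, ∀ T : Finset (Fin m), (∀ c ∈ T, v' ≤ (c : ℕ) ∧ (c : ℕ) < v ∧
      ∃ r, r₁ < r ∧ (r, c) ∈ F) →
      T.card + (cornerSet F r₁ v').card ≤ (cornerSet F r₁ v).card := by
    intro v' hv' T hT
    have hex : ∀ c ∈ T, ∃ r, r₁ < r ∧ (r, c) ∈ F := fun c hc => (hT c hc).2.2
    choose! r hr hrF using hex
    have hT' : T.card = (T.image fun c => (r c, c)).card := by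
      rw [Finset.card_image_of_injective]
      intro a b h
      exact congrArg Prod.snd h
    rw [hT', ← Finset.card_union_of_disjoint]
    · refine Finset.card_le_card ?_
      rintro ⟨r', c⟩ h
      rw [Finset.mem_union, Finset.mem_image] at h
      rcases h with ⟨c', hc', h⟩ | h
      · rw [← h]
        exact mem_cornerSet.2 ⟨hrF _ hc', (hr _ hc').le, (hT _ hc').2.1⟩
      · obtain ⟨h1, h3, h4⟩ := mem_cornerSet.1 h
        exact mem_cornerSet.2 ⟨h1, h3, h4.trans_le hv'⟩
    · rw [Finset.disjoint_left]
      rintro ⟨r', c⟩ h h'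
      obtain ⟨c', hc', h⟩ := Finset.mem_image.1 h
      obtain rfl : c' = c := congrArg Prod.snd h
      have := (hT _ hc').1
      have := (mem_cornerSet.1 h').2.2
      omega
  -- The row `r₁` has no element of `F` left of `v`, so domination can only come from below. It
  -- follows that the columns in which the rows from `r₁` on can be nonzero have their own elements
  -- of `F`, with the antidiagonal column as the only possible exception.
  have hdom : ∀ c : Fin m, (c : ℕ) < v → b r₁ < b c → (c = r₁.rev → anti) →
      ∃ r, r₁ < r ∧ (r, c) ∈ F := by
    intro c hcv hbc hca
    rcases hF.dominated hbc hca (hr₁F c hcv) with ⟨c', h1, h3⟩ | h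
    · exact absurd h3 (hr₁F c' (lt_trans h1 hcv))
    · exact h
  let T : Finset (Fin m) := Finset.univ.filter fun c => (c : ℕ) < v ∧ b r₁ < b c
  have hTsupp : ∀ r c : Fin m, c ∉ T → corner r₁ v X r c = 0 := by
    intro r c hc
    simp only [corner, Matrix.of_apply]
    split_ifs with h
    · apply hX.zero
      by_contra hcon
      apply hc
      have h5 : r₁ ≤ r := h.1
      simp only [T, Finset.mem_filter, Finset.mem_univ, true_and]
      exact ⟨h.2, (hF.mono h5).trans_lt (not_le.1 hcon)⟩
    · rfl
  by_cases hgood : ∀ c ∈ T, ∃ r, r₁ < r ∧ (r, c) ∈ F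
  · have h1 := hcols 0 (Nat.zero_le _) T (fun c hc =>
      ⟨Nat.zero_le _, (Finset.mem_filter.1 hc).2.1, hgood c hc⟩)
    have := rank_le_card_of_columns _ T hTsupp
    omega
  -- The exceptional column is `r₁.rev`. The columns up to it are treated by skewness, and each
  -- column of `T` beyond it contributes one element of `F` as before.
  push Not at hgood
  obtain ⟨cs, hcsT, hcs⟩ := hgood
  obtain ⟨hcsv, hbcs⟩ := (Finset.mem_filter.1 hcsT).2
  have hnot : ¬ (cs = r₁.rev → anti) := by
    intro h
    obtain ⟨r, h1, h3⟩ := hdom cs hcsv hbcs h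
    exact hcs r h1 h3
  obtain ⟨rfl, hanti⟩ := Classical.not_imp.1 hnot
  have hsk := rank_corner_le_of_skew h2 hF hX hanti r₁
    (fun c hc hbc => hdom c (lt_trans hc hcsv) hbc fun h => absurd h hc.ne) hcs hbcs
    (fun c hc => hr₁F c (lt_of_le_of_lt hc hcsv))
  let T' := T.filter fun c => r₁.rev < c
  have hT' := hcols (r₁.rev + 1) hcsv T' (by
    intro c hc
    obtain ⟨h1, h3⟩ := Finset.mem_filter.1 hc
    obtain ⟨h4, h5⟩ := (Finset.mem_filter.1 h1).2
    exact ⟨h3, h4, hdom c h4 h5 fun h => absurd h h3.ne'⟩)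
  have hsplit' : corner r₁ v X = corner r₁ (r₁.rev + 1) X +
      (Matrix.of fun r c => if c ∈ T' then corner r₁ v X r c else 0) := by
    ext r c
    rw [Matrix.add_apply, Matrix.of_apply]
    by_cases hc : c ∈ T'
    · have h1 : ¬ (c : ℕ) < r₁.rev + 1 := by
        have : (r₁.rev : ℕ) < c := (Finset.mem_filter.1 hc).2
        omega
      have h3 : corner r₁ (r₁.rev + 1) X r c = 0 := by
        simp only [corner, Matrix.of_apply, h1, and_false, if_false]
      rw [if_pos hc, h3, zero_add]
    · rw [if_neg hc, add_zero]
      by_cases h1 : (c : ℕ) < r₁.rev + 1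
      · have h3 : (c : ℕ) < v := by
          have : (r₁.rev : ℕ) < v := hcsv
          omega
        simp only [corner, Matrix.of_apply, h1, h3]
      · rw [hTsupp]
        · simp only [corner, Matrix.of_apply, h1, and_false, if_false]
        · intro h
          refine hc (Finset.mem_filter.2 ⟨h, ?_⟩)
          rw [Fin.lt_def]
          omega
  have h1 := rank_add_le (corner r₁ (r₁.rev + 1) X)
      (Matrix.of fun r c => if c ∈ T' then corner r₁ v X r c else 0)
  rw [← hsplit'] at h1
  have h3 := rank_le_card_of_columns
    (Matrix.of fun r c => if c ∈ T' then corner r₁ v X r c else 0) T' (by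
      intro i j hj
      simp [hj])
  omega

end Rook

/-! ### Minors under multiplication by unitriangular matrices. -/

section Minors

variable {m : ℕ}

/-- The upper unitriangular matrices. -/
structure UpperUnitriangular {A : Type*} [CommRing A] (U : Matrix (Fin m) (Fin m) A) : Prop where
  zero : ∀ i j, j < i → U i j = 0
  one : ∀ i, U i i = 1

section Field

variable {L : Type*} [Field L]

/-- Multiplication by `U` changes the row `f i` by multiples of lower rows. Restricted to the chosen
columns these lie in the row space of a corner whose rank is at most the number of chosen rows after
`i`, which is the situation of `det_eq_of_flag`. -/
theorem det_mul_left_submatrix {k : ℕ} {U : Matrix (Fin m) (Fin m) L} (hU : UpperUnitriangular U)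
    (Y : Matrix (Fin m) (Fin m) L) {f G : Fin k → Fin m} (hf : StrictMono f) {v : ℕ}
    (hG : ∀ j, (G j : ℕ) < v)
    (hr : ∀ i, (corner (f i + 1) v Y).rank ≤ (Finset.univ.filter fun j => i < j).card) :
    ((U * Y).submatrix f G).det = (Y.submatrix f G).det := by
  refine det_eq_of_flag (fun i : Fin k => (i : ℕ)) Fin.val_injective _ _ fun i => Or.inr ?_
  have hmem : ∀ r, f i < r → (fun j => Y r (G j)) ∈
      (Submodule.span L (Set.range (corner (f i + 1) v Y).row)).map (LinearMap.funLeft L L G) := by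
    intro r hr
    refine ⟨(corner (f i + 1) v Y).row r, Submodule.subset_span ⟨r, rfl⟩, ?_⟩
    funext j
    have : (f i : ℕ) + 1 ≤ r ∧ (G j : ℕ) < v := ⟨hr, hG j⟩
    simp only [LinearMap.funLeft_apply, Matrix.row, corner, Matrix.of_apply, this, and_self,
      if_true]
  refine ⟨(Submodule.span L (Set.range (corner (f i + 1) v Y).row)).map (LinearMap.funLeft L L G),
    ?_, ?_, fun j hj => hmem _ (hf hj)⟩
  · refine (Submodule.finrank_map_le _ _).trans ?_
    rw [← Matrix.rank_eq_finrank_span_row]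
    exact hr i
  · have : (U * Y).submatrix f G i - Y.submatrix f G i =
        ∑ r ∈ Finset.univ.erase (f i), U (f i) r • fun j => Y r (G j) := by
      funext j
      simp only [Pi.sub_apply, Matrix.submatrix_apply, Matrix.mul_apply, Finset.sum_apply,
        Pi.smul_apply, smul_eq_mul]
      rw [← Finset.add_sum_erase _ _ (Finset.mem_univ (f i)), hU.one, one_mul, add_sub_cancel_left]
    rw [this]
    refine Submodule.sum_mem _ fun r hr => ?_
    rcases lt_or_gt_of_ne (Finset.ne_of_mem_erase hr) with h | h
    · rw [hU.zero _ _ h, zero_smul]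
      exact Submodule.zero_mem _
    · exact Submodule.smul_mem _ _ (hmem r h)

/-- The analogue for columns, which change by multiples of columns further left; the flag therefore
runs in the reverse order. The last column is an arbitrary vector `w`, kept apart because no rank
bound is available for it. -/
theorem det_mul_right_snoc {k : ℕ} {U : Matrix (Fin m) (Fin m) L} (hU : UpperUnitriangular U)
    (Y : Matrix (Fin m) (Fin m) L) {f : Fin (k + 1) → Fin m} {g : Fin k → Fin m}
    (hg : StrictMono g) {u : ℕ} (hf : ∀ i, u ≤ (f i : ℕ))
    (hr : ∀ j : Fin k, (corner u (g j) Y).rank ≤ j) (w : Fin (k + 1) → L) :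
    (Matrix.of fun i => (Fin.snoc (fun j => (Y * U) (f i) (g j)) (w i) : Fin (k + 1) → L)).det =
      (Matrix.of fun i => (Fin.snoc (fun j => Y (f i) (g j)) (w i) : Fin (k + 1) → L)).det := by
  have hmem : ∀ (j : Fin k) (c : Fin m), c < g j → (fun i => Y (f i) c) ∈
      (Submodule.span L (Set.range (corner u (g j) Y).col)).map (LinearMap.funLeft L L f) := by
    intro j c hc
    refine ⟨(corner u (g j) Y).col c, Submodule.subset_span ⟨c, rfl⟩, ?_⟩
    funext i
    have : u ≤ (f i : ℕ) ∧ (c : ℕ) < g j := ⟨hf i, hc⟩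
    simp only [LinearMap.funLeft_apply, Matrix.col, Matrix.transpose_apply, corner,
      Matrix.of_apply, this, and_self, if_true]
  rw [← Matrix.det_transpose, ← Matrix.det_transpose (Matrix.of _)]
  refine det_eq_of_flag (fun i => (i.rev : ℕ)) (Fin.val_injective.comp Fin.rev_injective) _ _
    fun i => ?_
  induction i using Fin.lastCases with
  | last =>
    left
    funext i
    simp
  | cast j =>
    right
    refine ⟨(Submodule.span L (Set.range (corner u (g j) Y).col)).map (LinearMap.funLeft L L f),
      ?_, ?_, ?_⟩
    · refine (Submodule.finrank_map_le _ _).trans ?_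
      rw [← Matrix.rank_eq_finrank_span_cols]
      refine (hr j).trans (le_of_eq ?_)
      have : (Finset.univ.filter fun i : Fin (k + 1) =>
          (j.castSucc.rev : ℕ) < (i.rev : ℕ)) = Finset.Iio j.castSucc := by
        ext i
        simp [Fin.lt_def]
        omega
      rw [this]
      simp
    · have : (fun i => (Y * U) (f i) (g j)) - (fun i => Y (f i) (g j)) =
          ∑ c ∈ Finset.univ.erase (g j), U c (g j) • fun i => Y (f i) c := by
        funext i
        simp only [Pi.sub_apply, Matrix.mul_apply, Finset.sum_apply, Pi.smul_apply, smul_eq_mul]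
        rw [← Finset.add_sum_erase _ _ (Finset.mem_univ (g j)), hU.one, mul_one,
          add_sub_cancel_left]
        exact Finset.sum_congr rfl fun c _ => mul_comm _ _
      have h2 : (fun i => (Y * U) (f i) (g j)) - (fun i => Y (f i) (g j)) ∈
          (Submodule.span L (Set.range (corner u (g j) Y).col)).map (LinearMap.funLeft L L f) := by
        rw [this]
        refine Submodule.sum_mem _ fun c hc => ?_
        rcases lt_or_gt_of_ne (Finset.ne_of_mem_erase hc) with h | h
        · exact Submodule.smul_mem _ _ (hmem j c h)
        · rw [hU.zero _ _ h, zero_smul]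
          exact Submodule.zero_mem _
      convert h2 using 1
      funext i
      simp
    · intro i hi
      replace hi : i < j.castSucc := Fin.rev_lt_rev.1 hi
      obtain ⟨i, rfl⟩ : ∃ i' : Fin k, i = i'.castSucc :=
        ⟨i.castLT (by have : (i : ℕ) < j := hi; omega), rfl⟩
      convert hmem j (g i) (hg (by simpa using hi)) using 1
      funext i
      simp

variable {b : Fin m → ℤ} {anti : Prop} {F : Finset (Fin m × Fin m)}

/-- The transformation of the minors with rows `f` and columns `g, t`. -/
theorem det_snoc_transform (h2 : (2 : L) ≠ 0) (hF : SymmetricRook b anti F)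
    {X X' g : Matrix (Fin m) (Fin m) L} (hX : Staircase b anti X) (hX' : Staircase b anti X')
    (hg : UpperUnitriangular g) (hgX : g * X' = X * g) {k : ℕ} {f : Fin (k + 1) → Fin m}
    {g₀ : Fin k → Fin m} (hf : StrictMono f) (hg₀ : StrictMono g₀) {x y t : Fin m}
    (hfx : ∀ i, x ≤ f i) (hgy : ∀ j, g₀ j < y) (hyt : y ≤ t)
    (hrow : ∀ r c, (r, c) ∈ F → x < r → c ≤ t → ∃ i, f i = r)
    (hcol : ∀ r c, (r, c) ∈ F → x ≤ r → c < y → ∃ j, g₀ j = c) :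
    (X'.submatrix f (Fin.snoc g₀ t)).det =
      ∑ s, g s t * (X.submatrix f (Fin.snoc g₀ s)).det := by
  -- The minor of `X'` equals that of `g X' = X g`. The rank condition holds because every element
  -- of `F` in the corner below the row `f i` has its row among the later chosen rows.
  rw [← det_mul_left_submatrix hg X' hf (v := t + 1), hgX]
  rotate_left
  · intro j
    induction j using Fin.lastCases with
    | last => simp
    | cast j =>
      rw [Fin.snoc_castSucc]
      have : (g₀ j : ℕ) < t := (hgy j).trans_le hyt
      omega
  · intro i
    refine (rank_corner_le h2 hF hX' _ _).trans ?_
    have hex : ∀ p ∈ cornerSet F (f i + 1) (t + 1), ∃ j, f j = p.1 := by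
      rintro ⟨r, c⟩ h
      obtain ⟨h1, h3, h4⟩ := mem_cornerSet.1 h
      have h5 : f i < r := h3
      exact hrow r c h1 ((hfx i).trans_lt h5) (Nat.lt_succ_iff.1 h4)
    choose! j hj using hex
    refine Finset.card_le_card_of_injOn j ?_ ?_
    · rintro ⟨r, c⟩ h
      have h5 : f i < f (j (r, c)) := by
        rw [hj _ h]
        exact (mem_cornerSet.1 h).2.1
      simpa using hf.lt_iff_lt.1 h5
    · rintro ⟨r, c⟩ h ⟨r', c'⟩ h' heq
      have h5 : r = r' := by
        rw [← show f (j (r, c)) = r from hj _ h, ← show f (j (r', c')) = r' from hj _ h', heq]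
      subst h5
      rw [hF.row_unique (mem_cornerSet.1 h).1 (mem_cornerSet.1 h').1]
  have hsnoc : ∀ (Y : Matrix (Fin m) (Fin m) L) s, Y.submatrix f (Fin.snoc g₀ s) =
      Matrix.of fun i => (Fin.snoc (fun j => Y (f i) (g₀ j)) (Y (f i) s) : Fin (k + 1) → L) := by
    intro Y s
    ext i j
    induction j using Fin.lastCases <;> simp
  have hr : ∀ j : Fin k, (corner x (g₀ j) X).rank ≤ j := by
    intro j
    refine (rank_corner_le h2 hF hX _ _).trans ?_
    have hex : ∀ p ∈ cornerSet F x (g₀ j), ∃ i, g₀ i = p.2 := by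
      rintro ⟨r, c⟩ h
      obtain ⟨h1, h3, h4⟩ := mem_cornerSet.1 h
      exact hcol r c h1 h3 (lt_trans (b := g₀ j) h4 (hgy j))
    have : Nonempty (Fin k) := ⟨j⟩
    choose! i hi using hex
    refine (Finset.card_le_card_of_injOn (t := Finset.Iio j) i ?_ ?_).trans (by simp)
    · rintro ⟨r, c⟩ h
      have h5 : g₀ (i (r, c)) < g₀ j := by
        rw [hi _ h]
        exact (mem_cornerSet.1 h).2.2
      simpa using hg₀.lt_iff_lt.1 h5
    · rintro ⟨r, c⟩ h ⟨r', c'⟩ h' heq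
      have h5 : c = c' := by
        rw [← show g₀ (i (r, c)) = c from hi _ h, ← show g₀ (i (r', c')) = c' from hi _ h', heq]
      subst h5
      rw [hF.col_unique (mem_cornerSet.1 h).1 (mem_cornerSet.1 h').1]
  rw [hsnoc, det_mul_right_snoc hg X hg₀ (fun i => hfx i) hr]
  have hupd : ∀ w : Fin (k + 1) → L,
      (Matrix.of fun i => (Fin.snoc (fun j => X (f i) (g₀ j)) (w i) : Fin (k + 1) → L)) =
      ((Matrix.of fun i => (Fin.snoc (fun j => X (f i) (g₀ j)) 0 :
        Fin (k + 1) → L)).transpose.updateRow (Fin.last k) w).transpose := by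
    intro w
    ext i j
    induction j using Fin.lastCases with
    | last => simp [Matrix.updateRow_apply]
    | cast j => simp [Matrix.updateRow_apply, (Fin.castSucc_lt_last j).ne]
  -- Once the other columns are those of `X`, the last one is a combination of columns of `X` with
  -- coefficients `g s t`, and the determinant is expanded linearly in it.
  have hw : (fun i => (X * g) (f i) t) = ∑ s, g s t • fun i => X (f i) s := by
    funext i
    simp only [Matrix.mul_apply, Finset.sum_apply, Pi.smul_apply, smul_eq_mul]
    exact Finset.sum_congr rfl fun c _ => mul_comm _ _
  simp only [hsnoc]
  rw [hupd, Matrix.det_transpose, hw]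
  have hsum : ∀ (M : Matrix (Fin (k + 1)) (Fin (k + 1)) L) (v : Fin m → Fin (k + 1) → L),
      (M.updateRow (Fin.last k) (∑ s, v s)).det = ∑ s, (M.updateRow (Fin.last k) (v s)).det :=
    fun M v => MultilinearMap.map_update_sum (Matrix.detRowAlternating.toMultilinearMap) _ _ _ _
  rw [hsum]
  refine Finset.sum_congr rfl fun s _ => ?_
  rw [hupd (fun i => X (f i) s), Matrix.det_transpose, Matrix.det_updateRow_smul]

/-- All `k + 1` columns lie left of `y`, in a corner whose elements of `F` have their columns among
the `k` values of `g₀`. Its rank is therefore at most `k`. -/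
theorem det_snoc_eq_zero (h2 : (2 : L) ≠ 0) (hF : SymmetricRook b anti F)
    {X : Matrix (Fin m) (Fin m) L} (hX : Staircase b anti X) {k : ℕ} {f : Fin (k + 1) → Fin m}
    {g₀ : Fin k → Fin m} {x y s : Fin m} (hfx : ∀ i, x ≤ f i)
    (hgy : ∀ j, g₀ j < y) (hsy : s < y)
    (hcol : ∀ r c, (r, c) ∈ F → x ≤ r → c < y → ∃ j, g₀ j = c) :
    (X.submatrix f (Fin.snoc g₀ s)).det = 0 := by
  by_contra hdet
  have hunit : IsUnit (X.submatrix f (Fin.snoc g₀ s)) :=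
    (Matrix.isUnit_iff_isUnit_det _).2 (isUnit_iff_ne_zero.2 hdet)
  have h1 := Matrix.rank_of_isUnit _ hunit
  have h3 : X.submatrix f (Fin.snoc g₀ s) = (corner x y X).submatrix f (Fin.snoc g₀ s) := by
    ext i j
    have h4 : (x : ℕ) ≤ f i ∧ ((Fin.snoc g₀ s : Fin (k + 1) → Fin m) j : ℕ) < y := by
      refine ⟨hfx i, ?_⟩
      induction j using Fin.lastCases with
      | last => simpa using hsy
      | cast j => simpa using hgy j
    simp only [Matrix.submatrix_apply, corner, Matrix.of_apply, h4, and_self, if_true]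
  have h4 : (corner x y X).rank ≤ k := by
    refine (rank_corner_le h2 hF hX _ _).trans ?_
    have hex : ∀ p ∈ cornerSet F x y, ∃ i, g₀ i = p.2 := by
      rintro ⟨r, c⟩ h
      obtain ⟨h1, h3, h4⟩ := mem_cornerSet.1 h
      exact hcol r c h1 h3 h4
    have hinj : Set.InjOn Prod.snd (cornerSet F x y : Set (Fin m × Fin m)) := by
      rintro ⟨r, c⟩ h ⟨r', c'⟩ h' (rfl : c = c')
      rw [hF.col_unique (mem_cornerSet.1 h).1 (mem_cornerSet.1 h').1]
    rw [← Finset.card_image_of_injOn hinj]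
    refine (Finset.card_le_card (t := Finset.univ.image g₀) ?_).trans
      (Finset.card_image_le.trans (by simp))
    intro c hc
    obtain ⟨p, hp, rfl⟩ := Finset.mem_image.1 hc
    obtain ⟨i, hi⟩ := hex p hp
    exact Finset.mem_image.2 ⟨i, Finset.mem_univ _, hi⟩
  have h5 : ((corner x y X).submatrix f (Fin.snoc g₀ s)).rank ≤ (corner x y X).rank :=
    Matrix.rank_submatrix_le _ _ _
  rw [← h3, h1, Fintype.card_fin] at h5
  omega

end Field

end Minors

/-! ### Pivot minors and reflection in the antidiagonal. -/

section SortedMinors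

variable {m : ℕ} {A : Type*} [CommRing A]

/-- The minor of a matrix with rows `I` and columns `J`, both in increasing order (`0` if the
cardinalities differ). -/
noncomputable def sortedMinor (X : Matrix (Fin m) (Fin m) A) (I J : Finset (Fin m)) : A :=
  if h : J.card = I.card then
    (X.submatrix (I.orderEmbOfFin rfl) (J.orderEmbOfFin h)).det
  else 0

theorem sortedMinor_eq (X : Matrix (Fin m) (Fin m) A) {I J : Finset (Fin m)} {k : ℕ}
    {f g : Fin k → Fin m} (hf : StrictMono f) (hg : StrictMono g)
    (hI : ∀ r, r ∈ I ↔ ∃ i, f i = r) (hJ : ∀ c, c ∈ J ↔ ∃ j, g j = c) :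
    sortedMinor X I J = (X.submatrix f g).det := by
  have hI' : I.card = k := by
    have : I = Finset.univ.image f := by
      ext r
      simp [hI]
    rw [this, Finset.card_image_of_injective _ hf.injective, Finset.card_univ, Fintype.card_fin]
  have hJ' : J.card = I.card := by
    have : J = Finset.univ.image g := by
      ext r
      simp [hJ]
    rw [hI', this, Finset.card_image_of_injective _ hg.injective, Finset.card_univ,
      Fintype.card_fin]
  subst hI'
  rw [sortedMinor, dif_pos hJ', ← Finset.orderEmbOfFin_unique rfl (fun i => (hI _).2 ⟨i, rfl⟩) hf,
    ← Finset.orderEmbOfFin_unique hJ' (fun i => (hJ _).2 ⟨i, rfl⟩) hg]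

/-- The reflection of a matrix in the antidiagonal. -/
def antiTranspose (X : Matrix (Fin m) (Fin m) A) : Matrix (Fin m) (Fin m) A :=
  Matrix.of fun i j => X j.rev i.rev

theorem antiTranspose_mul (X Y : Matrix (Fin m) (Fin m) A) :
    antiTranspose (X * Y) = antiTranspose Y * antiTranspose X := by
  ext i j
  simp only [antiTranspose, Matrix.of_apply, Matrix.mul_apply]
  rw [← Equiv.sum_comp Fin.revPerm]
  exact Finset.sum_congr rfl fun _ _ => mul_comm _ _

theorem det_submatrix_reflect {k : ℕ} (X : Matrix (Fin m) (Fin m) A) (f g : Fin k → Fin m) :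
    ((antiTranspose X).submatrix (fun i : Fin k => (g i.rev).rev) fun i : Fin k => (f i.rev).rev).det =
      (X.submatrix f g).det := by
  rw [← Matrix.det_transpose (X.submatrix f g), ← Matrix.det_submatrix_equiv_self Fin.revPerm]
  congr 1
  ext i j
  simp [antiTranspose]

theorem strictMono_reflect {k : ℕ} {f : Fin k → Fin m} (hf : StrictMono f) :
    StrictMono fun i : Fin k => (f i.rev).rev := fun _ _ h =>
  Fin.rev_lt_rev.2 (hf (Fin.rev_lt_rev.2 h))

theorem exists_strictMono (I : Finset (Fin m)) {k : ℕ} (h : I.card = k) :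
    ∃ f : Fin k → Fin m, StrictMono f ∧ ∀ r, r ∈ I ↔ ∃ i, f i = r := by
  refine ⟨I.orderEmbOfFin h, (I.orderEmbOfFin h).strictMono, fun r => ?_⟩
  rw [← Set.mem_range, Finset.range_orderEmbOfFin]
  simp

theorem sortedMinor_reflect (X : Matrix (Fin m) (Fin m) A) (I J : Finset (Fin m)) :
    sortedMinor (antiTranspose X) (J.image Fin.rev) (I.image Fin.rev) = sortedMinor X I J := by
  by_cases h : J.card = I.card
  · obtain ⟨f, hf, hI⟩ := exists_strictMono I rfl
    obtain ⟨g, hg, hJ⟩ := exists_strictMono J h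
    have hmem : ∀ (T : Finset (Fin m)) (f : Fin I.card → Fin m), (∀ r, r ∈ T ↔ ∃ i, f i = r) →
        ∀ r, r ∈ T.image Fin.rev ↔ ∃ i : Fin I.card, (f i.rev).rev = r := by
      intro T f hT r
      rw [Finset.mem_image]
      constructor
      · rintro ⟨s, hs, rfl⟩
        obtain ⟨i, rfl⟩ := (hT s).1 hs
        exact ⟨i.rev, by rw [Fin.rev_rev]⟩
      · rintro ⟨i, rfl⟩
        exact ⟨f i.rev, (hT _).2 ⟨_, rfl⟩, rfl⟩
    rw [sortedMinor_eq X hf hg hI hJ, sortedMinor_eq (antiTranspose X) (strictMono_reflect hg)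
      (strictMono_reflect hf) (hmem J g hJ) (hmem I f hI)]
    exact det_submatrix_reflect X f g
  · rw [sortedMinor, sortedMinor, dif_neg h, dif_neg]
    rw [Finset.card_image_of_injective _ Fin.rev_injective,
      Finset.card_image_of_injective _ Fin.rev_injective]
    exact fun h' => h h'.symm

theorem map_sortedMinor {B : Type*} [CommRing B] (φ : A →+* B) (X : Matrix (Fin m) (Fin m) A)
    (I J : Finset (Fin m)) : φ (sortedMinor X I J) = sortedMinor (X.map φ) I J := by
  unfold sortedMinor
  split_ifs with h
  · rw [RingHom.map_det]
    rfl
  · exact map_zero φ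

/-- The elements of `F` strictly to the south-west of `(x, y)`. -/
def southWest (F : Finset (Fin m × Fin m)) (x y : Fin m) : Finset (Fin m × Fin m) :=
  F.filter fun p => x < p.1 ∧ p.2 < y

theorem mem_southWest {F : Finset (Fin m × Fin m)} {x y r c : Fin m} :
    (r, c) ∈ southWest F x y ↔ (r, c) ∈ F ∧ x < r ∧ c < y := by
  simp [southWest]

/-- The minor whose rows and columns are those of `(x, y)` and of the elements of `F` to the
south-west of it. -/
noncomputable def pivotMinor (F : Finset (Fin m × Fin m)) (X : Matrix (Fin m) (Fin m) A)
    (x y : Fin m) : A :=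
  sortedMinor X (insert x ((southWest F x y).image Prod.fst))
    (insert y ((southWest F x y).image Prod.snd))

theorem map_pivotMinor {B : Type*} [CommRing B] (φ : A →+* B) (F : Finset (Fin m × Fin m))
    (X : Matrix (Fin m) (Fin m) A) (x y : Fin m) :
    φ (pivotMinor F X x y) = pivotMinor F (X.map φ) x y :=
  map_sortedMinor φ X _ _

variable {b : Fin m → ℤ} {anti : Prop} {F : Finset (Fin m × Fin m)}

theorem southWest_reflect (hF : SymmetricRook b anti F) (x y : Fin m) :
    southWest F y.rev x.rev = (southWest F x y).image fun p => (p.2.rev, p.1.rev) := by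
  ext ⟨r, c⟩
  rw [Finset.mem_image, mem_southWest]
  constructor
  · rintro ⟨h1, h2, h3⟩
    refine ⟨(c.rev, r.rev), mem_southWest.2 ⟨hF.symm h1, ?_, ?_⟩, by simp⟩
    · rwa [← Fin.rev_lt_rev, Fin.rev_rev]
    · rwa [← Fin.rev_lt_rev, Fin.rev_rev]
  · rintro ⟨⟨r', c'⟩, h, h'⟩
    obtain ⟨rfl, rfl⟩ := Prod.mk.inj h'
    obtain ⟨h1, h2, h3⟩ := mem_southWest.1 h
    exact ⟨hF.symm h1, Fin.rev_lt_rev.2 h3, Fin.rev_lt_rev.2 h2⟩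

/-- The symmetry of `F` makes the reflection carry one south-west set to the other. This derives
every statement about columns of pivot minors from the one about rows. -/
theorem pivotMinor_antiTranspose (hF : SymmetricRook b anti F) (X : Matrix (Fin m) (Fin m) A)
    (x y : Fin m) : pivotMinor F (antiTranspose X) y.rev x.rev = pivotMinor F X x y := by
  rw [pivotMinor, pivotMinor, southWest_reflect hF, ← sortedMinor_reflect X]
  simp only [Finset.image_image, Finset.image_insert]
  rfl

/-- Sorted rows and columns for the pivot minors. -/
theorem exists_pivot_index (hF : SymmetricRook b anti F) (x y : Fin m) :
    ∃ (k : ℕ) (f : Fin (k + 1) → Fin m) (g : Fin k → Fin m), StrictMono f ∧ StrictMono g ∧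
      (∀ r, r ∈ insert x ((southWest F x y).image Prod.fst) ↔ ∃ i, f i = r) ∧
      (∀ c, c ∈ (southWest F x y).image Prod.snd ↔ ∃ j, g j = c) := by
  have h1 : ((southWest F x y).image Prod.snd).card = (southWest F x y).card := by
    refine Finset.card_image_of_injOn ?_
    rintro ⟨r, c⟩ h ⟨r', c'⟩ h' (rfl : c = c')
    rw [hF.col_unique (mem_southWest.1 h).1 (mem_southWest.1 h').1]
  have h2 : ((southWest F x y).image Prod.fst).card = (southWest F x y).card := by
    refine Finset.card_image_of_injOn ?_
    rintro ⟨r, c⟩ h ⟨r', c'⟩ h' (rfl : r = r')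
    rw [hF.row_unique (mem_southWest.1 h).1 (mem_southWest.1 h').1]
  have h3 : (insert x ((southWest F x y).image Prod.fst)).card = (southWest F x y).card + 1 := by
    rw [Finset.card_insert_of_notMem, h2]
    intro h
    obtain ⟨⟨r, c⟩, h, rfl⟩ := Finset.mem_image.1 h
    exact lt_irrefl _ (mem_southWest.1 h).2.1
  obtain ⟨f, hf, hf'⟩ := exists_strictMono _ h3
  obtain ⟨g, hg, hg'⟩ := exists_strictMono _ h1
  exact ⟨_, f, g, hf, hg, hf', hg'⟩

theorem strictMono_snoc {k : ℕ} {g : Fin k → Fin m} (hg : StrictMono g) {t : Fin m}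
    (ht : ∀ j, g j < t) : StrictMono (Fin.snoc g t : Fin (k + 1) → Fin m) := by
  intro i j hij
  induction j using Fin.lastCases with
  | last =>
    obtain ⟨i, rfl⟩ : ∃ i' : Fin k, i = i'.castSucc := ⟨i.castLT hij, rfl⟩
    simpa using ht i
  | cast j =>
    obtain ⟨i, rfl⟩ : ∃ i' : Fin k, i = i'.castSucc :=
      ⟨i.castLT (by have : (i : ℕ) < j := hij; omega), rfl⟩
    simpa using hg (by simpa using hij)

/-- As long as the south-west set does not change along the row `x`, one choice of `f` and `g`
serves for all `t`, and the minors differ only in their last column. -/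
theorem pivotMinor_eq_det (X : Matrix (Fin m) (Fin m) A) {x y t : Fin m} {k : ℕ}
    {f : Fin (k + 1) → Fin m} {g : Fin k → Fin m} (hf : StrictMono f) (hg : StrictMono g)
    (hfI : ∀ r, r ∈ insert x ((southWest F x y).image Prod.fst) ↔ ∃ i, f i = r)
    (hgJ : ∀ c, c ∈ (southWest F x y).image Prod.snd ↔ ∃ j, g j = c)
    (hsw : southWest F x t = southWest F x y) :
    pivotMinor F X x t = (X.submatrix f (Fin.snoc g t)).det := by
  have ht : ∀ j, g j < t := by
    intro j
    obtain ⟨⟨r, c⟩, h, hc⟩ := Finset.mem_image.1 ((hgJ (g j)).2 ⟨j, rfl⟩)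
    rw [← hc]
    rw [← hsw] at h
    exact (mem_southWest.1 h).2.2
  rw [pivotMinor, hsw]
  refine sortedMinor_eq X hf (strictMono_snoc hg ht) hfI fun c => ?_
  rw [Finset.mem_insert, hgJ]
  constructor
  · rintro (rfl | ⟨j, rfl⟩)
    · exact ⟨Fin.last k, by simp⟩
    · exact ⟨j.castSucc, by simp⟩
  · rintro ⟨j, rfl⟩
    induction j using Fin.lastCases with
    | last => left; simp
    | cast j => right; exact ⟨j, by simp⟩

/-- The column `y` is already taken by `(x, y)`, and `hclear` excludes elements of `F` below the row
`x` in the columns after `y` up to `z`. So nothing enters the south-west set as `t` moves through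
the window. -/
theorem southWest_eq_of_clear (hF : SymmetricRook b anti F) {x y z t : Fin m} (hxy : (x, y) ∈ F)
    (hclear : ∀ r c, (r, c) ∈ F → x < r → y < c → c ≤ z → False) (hyt : y ≤ t) (htz : t ≤ z) :
    southWest F x t = southWest F x y := by
  ext ⟨r, c⟩
  simp only [mem_southWest]
  refine ⟨fun ⟨h1, h2, h3⟩ => ⟨h1, h2, ?_⟩, fun ⟨h1, h2, h3⟩ => ⟨h1, h2, h3.trans_le hyt⟩⟩
  by_contra hcon
  rcases (not_lt.1 hcon).eq_or_lt with rfl | h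
  · exact h2.ne (hF.col_unique hxy h1)
  · exact hclear r c h1 h2 h (h3.le.trans htz)

end SortedMinors

/-! ### Transformation law of the pivot minors and the two kinds of invariants. -/

section Transform

variable {m : ℕ} {L : Type*} [Field L] {b : Fin m → ℤ} {anti : Prop} {F : Finset (Fin m × Fin m)}

theorem Staircase.antiTranspose {A : Type*} [CommRing A] (hF : SymmetricRook b anti F)
    {X : Matrix (Fin m) (Fin m) A} (hX : Staircase b anti X) :
    Staircase b anti (antiTranspose X) where
  zero i j h := hX.zero _ _ (by rw [hF.rev, hF.rev]; omega)
  skew h i j := by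
    have := hX.skew h j.rev i.rev
    simpa [ParabolicInvariants.antiTranspose] using this

theorem UpperUnitriangular.antiTranspose {A : Type*} [CommRing A]
    {U : Matrix (Fin m) (Fin m) A} (hU : UpperUnitriangular U) :
    UpperUnitriangular (antiTranspose U) where
  zero _ _ h := hU.zero _ _ (Fin.rev_lt_rev.2 h)
  one _ := hU.one _

/-- The transformation of the pivot minors in the row of an element of `F`. -/
theorem pivotMinor_transform (h2 : (2 : L) ≠ 0) (hF : SymmetricRook b anti F)
    {X X' g : Matrix (Fin m) (Fin m) L} (hX : Staircase b anti X) (hX' : Staircase b anti X')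
    (hg : UpperUnitriangular g) (hgX : g * X' = X * g) {x y z t : Fin m} (hxy : (x, y) ∈ F)
    (hclear : ∀ r c, (r, c) ∈ F → x < r → y < c → c ≤ z → False) (hyt : y ≤ t) (htz : t ≤ z) :
    pivotMinor F X' x t = ∑ s ∈ Finset.Icc y z, g s t * pivotMinor F X x s := by
  obtain ⟨k, f, g₀, hf, hg₀, hfI, hgJ⟩ := exists_pivot_index hF x y
  have hdet : ∀ (Y : Matrix (Fin m) (Fin m) L) s, y ≤ s → s ≤ z →
      pivotMinor F Y x s = (Y.submatrix f (Fin.snoc g₀ s)).det := fun Y s h1 h3 =>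
    pivotMinor_eq_det Y hf hg₀ hfI hgJ (southWest_eq_of_clear hF hxy hclear h1 h3)
  have hfx : ∀ i, x ≤ f i := by
    intro i
    rcases Finset.mem_insert.1 ((hfI (f i)).2 ⟨i, rfl⟩) with h | h
    · exact h.ge
    · obtain ⟨⟨r, c⟩, h, hr⟩ := Finset.mem_image.1 h
      rw [← hr]
      exact (mem_southWest.1 h).2.1.le
  have hgy : ∀ j, g₀ j < y := by
    intro j
    obtain ⟨⟨r, c⟩, h, hc⟩ := Finset.mem_image.1 ((hgJ (g₀ j)).2 ⟨j, rfl⟩)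
    rw [← hc]
    exact (mem_southWest.1 h).2.2
  have hcol : ∀ r c, (r, c) ∈ F → x ≤ r → c < y → ∃ j, g₀ j = c := by
    intro r c h1 h3 h4
    refine (hgJ c).1 (Finset.mem_image.2 ⟨(r, c), mem_southWest.2 ⟨h1, ?_, h4⟩, rfl⟩)
    refine lt_of_le_of_ne h3 ?_
    rintro rfl
    exact h4.ne (hF.row_unique h1 hxy)
  have hrow : ∀ r c, (r, c) ∈ F → x < r → c ≤ t → ∃ i, f i = r := by
    intro r c h1 h3 h4
    refine (hfI r).1 (Finset.mem_insert_of_mem (Finset.mem_image.2 ⟨(r, c),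
      mem_southWest.2 ⟨h1, h3, ?_⟩, rfl⟩))
    by_contra hcon
    rcases (not_lt.1 hcon).eq_or_lt with rfl | h
    · exact h3.ne (hF.col_unique hxy h1)
    · exact hclear r c h1 h3 h (h4.trans htz)
  rw [hdet X' t hyt htz, det_snoc_transform h2 hF hX hX' hg hgX hf hg₀ hfx hgy hyt hrow hcol]
  symm
  -- Terms with `s` left of `y` vanish by the rank bound. Those with `s` right of `z`, hence right
  -- of `t`, vanish because `g` is upper triangular.
  refine Finset.sum_subset_zero_on_sdiff (Finset.subset_univ _) ?_ ?_
  · intro s hs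
    rw [Finset.mem_sdiff, Finset.mem_Icc] at hs
    rcases lt_or_ge s y with h | h
    · rw [det_snoc_eq_zero h2 hF hX hfx hgy h hcol, mul_zero]
    · rw [hg.zero, zero_mul]
      exact htz.trans_lt (not_le.1 fun h' => hs.2 ⟨h, h'⟩)
  · intro s hs
    rw [Finset.mem_Icc] at hs
    rw [hdet X s hs.1 hs.2]

/-- The pivot minors at the elements of `F` are invariant. -/
theorem pivotMinor_invariant (h2 : (2 : L) ≠ 0) (hF : SymmetricRook b anti F)
    {X X' g : Matrix (Fin m) (Fin m) L} (hX : Staircase b anti X) (hX' : Staircase b anti X')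
    (hg : UpperUnitriangular g) (hgX : g * X' = X * g) {x y : Fin m} (hxy : (x, y) ∈ F) :
    pivotMinor F X' x y = pivotMinor F X x y := by
  rw [pivotMinor_transform h2 hF hX hX' hg hgX hxy (z := y)
    (fun r c _ _ h h' => absurd h (not_lt.2 h')) le_rfl le_rfl]
  simp [hg.one]

/-- On the window from `y` to `z` the minors in the row `x` form a row vector multiplied by `g`, and
those in the column `w` form a column vector multiplied by `h`. The pairing of the two is preserved
since `g h = 1`. -/
theorem sum_pivotMinor_invariant (h2 : (2 : L) ≠ 0) (hF : SymmetricRook b anti F)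
    {X X' g h : Matrix (Fin m) (Fin m) L} (hX : Staircase b anti X) (hX' : Staircase b anti X')
    (hg : UpperUnitriangular g) (hh : UpperUnitriangular h) (hgh : g * h = 1)
    (hgX : g * X' = X * g) {x y z w : Fin m} (hxy : (x, y) ∈ F) (hzw : (z, w) ∈ F)
    (hclear : ∀ r c, (r, c) ∈ F → x < r → y < c → c ≤ z → False)
    (hclear' : ∀ r c, (r, c) ∈ F → c < w → y ≤ r → r < z → False) :
    ∑ t ∈ Finset.Icc y z, pivotMinor F X' x t * pivotMinor F X' t w =
      ∑ t ∈ Finset.Icc y z, pivotMinor F X x t * pivotMinor F X t w := by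
  have hhg : h * g = 1 := mul_eq_one_comm.1 hgh
  have hhX : X' * h = h * X := by
    calc X' * h = (h * g) * X' * h := by rw [hhg, one_mul]
      _ = h * (g * X') * h := by simp only [mul_assoc]
      _ = h * X * (g * h) := by rw [hgX]; simp only [mul_assoc]
      _ = h * X := by rw [hgh, mul_one]
  have hu : ∀ t ∈ Finset.Icc y z,
      pivotMinor F X' x t = ∑ s ∈ Finset.Icc y z, g s t * pivotMinor F X x s := by
    intro t ht
    rw [Finset.mem_Icc] at ht
    exact pivotMinor_transform h2 hF hX hX' hg hgX hxy hclear ht.1 ht.2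
  have hw : ∀ t ∈ Finset.Icc y z,
      pivotMinor F X' t w = ∑ s ∈ Finset.Icc y z, h t s * pivotMinor F X s w := by
    intro t ht
    rw [Finset.mem_Icc] at ht
    -- After reflection the column `w` becomes a row with pivot `(w.rev, z.rev)`, and the relation
    -- `X' h = h X` takes the place of `g X' = X g`.
    rw [← pivotMinor_antiTranspose hF, pivotMinor_transform h2 hF (hX.antiTranspose hF)
      (hX'.antiTranspose hF) hh.antiTranspose (by
        rw [← antiTranspose_mul, ← antiTranspose_mul, hhX]) (hF.symm hzw) (z := y.rev) (by
        intro r c h1 h3 h4 h5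
        refine hclear' c.rev r.rev (hF.symm h1) ?_ ?_ ?_
        · rwa [← Fin.rev_lt_rev, Fin.rev_rev]
        · rwa [← Fin.rev_le_rev, Fin.rev_rev]
        · rwa [← Fin.rev_lt_rev, Fin.rev_rev])
      (Fin.rev_le_rev.2 ht.2) (Fin.rev_le_rev.2 ht.1)]
    refine Finset.sum_nbij' Fin.rev Fin.rev ?_ ?_ ?_ ?_ ?_
    · intro s hs
      rw [Finset.mem_Icc] at hs ⊢
      exact ⟨by rw [← Fin.rev_le_rev, Fin.rev_rev]; exact hs.2,
        by rw [← Fin.rev_le_rev, Fin.rev_rev]; exact hs.1⟩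
    · intro s hs
      rw [Finset.mem_Icc] at hs ⊢
      exact ⟨Fin.rev_le_rev.2 hs.2, Fin.rev_le_rev.2 hs.1⟩
    · simp
    · simp
    · intro s _
      rw [← pivotMinor_antiTranspose hF X s.rev w, Fin.rev_rev]
      simp [antiTranspose]
  calc _ = ∑ t ∈ Finset.Icc y z, ∑ s ∈ Finset.Icc y z, ∑ s' ∈ Finset.Icc y z,
        (g s t * h t s') * (pivotMinor F X x s * pivotMinor F X s' w) := by
        refine Finset.sum_congr rfl fun t ht => ?_
        rw [hu t ht, hw t ht, Finset.sum_mul_sum]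
        refine Finset.sum_congr rfl fun s _ => Finset.sum_congr rfl fun s' _ => ?_
        ring
    _ = ∑ s ∈ Finset.Icc y z, ∑ s' ∈ Finset.Icc y z, ∑ t ∈ Finset.Icc y z,
        (g s t * h t s') * (pivotMinor F X x s * pivotMinor F X s' w) := by
        rw [Finset.sum_comm]
        exact Finset.sum_congr rfl fun s _ => Finset.sum_comm
    _ = ∑ s ∈ Finset.Icc y z, ∑ s' ∈ Finset.Icc y z,
        if s = s' then pivotMinor F X x s * pivotMinor F X s' w else 0 := by
        refine Finset.sum_congr rfl fun s hs => Finset.sum_congr rfl fun s' hs' => ?_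
        rw [Finset.mem_Icc] at hs hs'
        -- Because `g` and `h` are upper triangular, the sum over the window is already the full
        -- matrix product; their window blocks are mutually inverse.
        have hsum : ∑ t ∈ Finset.Icc y z, g s t * h t s' = if s = s' then 1 else 0 := by
          rw [← Matrix.one_apply, ← hgh, Matrix.mul_apply]
          refine Finset.sum_subset (Finset.subset_univ _) fun t _ ht => ?_
          rcases lt_or_ge t y with h' | h'
          · rw [hg.zero _ _ (h'.trans_le hs.1), zero_mul]
          · rw [hh.zero _ _ (hs'.2.trans_lt (not_le.1 fun h'' =>
              ht (Finset.mem_Icc.2 ⟨h', h''⟩))), mul_zero]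
        rw [← Finset.sum_mul, hsum, ite_mul, one_mul, zero_mul]
    _ = _ := by
        refine Finset.sum_congr rfl fun s hs => ?_
        rw [Finset.sum_ite_eq, if_pos hs]

end Transform

/-! ### Weights of labels, and roots as pairs of matrix positions. -/

section Labels

variable {ty : ClassicalType} {n : ℕ}

/-- The weight of a label: `ε_i` for the label `i`, `-ε_i` for the label `-i`, and `0` for the
label `0`. -/
def labelWeight (v : Idx ty n) : Fin n → ℤ := fun l =>
  (if v = posIdx ty l then 1 else 0) - (if v = negIdx ty l then 1 else 0)

theorem labelWeight_rev (v : Idx ty n) : labelWeight v.rev = - labelWeight v := by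
  funext l
  have h1 : v.rev = posIdx ty l ↔ v = negIdx ty l := by
    rw [negIdx, ← Fin.rev_inj, Fin.rev_rev]
  have h2 : v.rev = negIdx ty l ↔ v = posIdx ty l := by
    rw [negIdx, Fin.rev_inj]
  simp only [labelWeight, Pi.neg_apply, h1, h2]
  ring

theorem posIdx_injective : Function.Injective (posIdx ty : Fin n → Idx ty n) := by
  intro i j h
  have : ((posIdx ty i : Idx ty n) : ℕ) = (posIdx ty j : Idx ty n) := congrArg Fin.val h
  exact Fin.ext this

theorem posIdx_ne_negIdx (i j : Fin n) : posIdx ty i ≠ negIdx ty j := by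
  have hd := two_mul_le_dim ty n
  intro h
  have := congrArg Fin.val h
  simp only [negIdx, posIdx, Fin.val_rev] at this
  omega

theorem labelWeight_posIdx (i : Fin n) : labelWeight (posIdx ty i) = Pi.single i 1 := by
  funext l
  simp only [labelWeight, posIdx_ne_negIdx, if_false, sub_zero, Pi.single_apply,
    posIdx_injective.eq_iff, eq_comm (a := i)]

theorem labelWeight_negIdx (i : Fin n) : labelWeight (negIdx ty i) = - Pi.single i 1 := by
  rw [negIdx, labelWeight_rev, labelWeight_posIdx]

theorem label_cases (v : Idx ty n) :
    (∃ i, v = posIdx ty i) ∨ (∃ i, v = negIdx ty i) ∨ v.rev = v := by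
  have hd : dim ty n = 2 * n ∨ dim ty n = 2 * n + 1 := by cases ty <;> simp [dim]
  have hv := v.2
  by_cases h1 : (v : ℕ) < n
  · exact Or.inl ⟨⟨v, h1⟩, rfl⟩
  by_cases h2 : dim ty n - (v + 1) < n
  · refine Or.inr (Or.inl ⟨⟨dim ty n - (v + 1), h2⟩, ?_⟩)
    ext
    simp only [negIdx, posIdx, Fin.val_rev]
    omega
  · refine Or.inr (Or.inr ?_)
    ext
    rw [Fin.val_rev]
    omega

theorem eq_of_rev_eq_self {v w : Idx ty n} (hv : v.rev = v) (hw : w.rev = w) : v = w := by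
  have h1 := congrArg Fin.val hv
  have h2 := congrArg Fin.val hw
  rw [Fin.val_rev] at h1 h2
  ext
  omega

theorem labelWeight_eq_zero {v : Idx ty n} (hv : v.rev = v) : labelWeight v = 0 := by
  have h := labelWeight_rev v
  rw [hv] at h
  funext l
  have := congrFun h l
  simp only [Pi.neg_apply] at this
  simp only [Pi.zero_apply]
  omega

theorem sum_labelWeight_emod {v : Idx ty n} (hv : v.rev ≠ v) :
    (∑ l, labelWeight v l) % 2 = 1 := by
  rcases label_cases v with ⟨i, rfl⟩ | ⟨i, rfl⟩ | h
  · rw [labelWeight_posIdx]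
    simp
  · rw [labelWeight_negIdx]
    simp
  · exact absurd h hv

/-- In a vanishing sum of an even number of weights of labels, the terms cancel in pairs. -/
theorem rev_mem_of_sum_eq_zero {x : Idx ty n} {l : List (Idx ty n)} (hl : l.length % 2 = 1)
    (h : labelWeight x + (l.map labelWeight).sum = 0) : x.rev ∈ l := by
  by_contra hx
  have heval : ∀ (l : List (Idx ty n)) (i : Fin n),
      (l.map labelWeight).sum i = (l.map fun y => labelWeight y i).sum := by
    intro l i
    induction l with
    | nil => rfl
    | cons y l ih => simp [ih]
  rcases label_cases x with ⟨i, rfl⟩ | ⟨i, rfl⟩ | hx0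
  · have h1 := congrFun h i
    rw [Pi.add_apply, heval, labelWeight_posIdx] at h1
    have h2 : 0 ≤ (l.map fun y => labelWeight y i).sum := by
      refine List.sum_nonneg ?_
      intro a ha
      obtain ⟨y, hy, rfl⟩ := List.mem_map.1 ha
      have : y ≠ negIdx ty i := by
        rintro rfl
        exact hx hy
      simp only [labelWeight, this, if_false]
      split_ifs <;> simp
    simp at h1
    omega
  · have h1 := congrFun h i
    rw [Pi.add_apply, heval, labelWeight_negIdx] at h1
    have h2 : (l.map fun y => labelWeight y i).sum ≤ 0 := by
      refine (List.sum_le_card_nsmul _ 0 ?_).trans (by simp)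
      intro a ha
      obtain ⟨y, hy, rfl⟩ := List.mem_map.1 ha
      have : y ≠ posIdx ty i := by
        rintro rfl
        rw [negIdx, Fin.rev_rev] at hx
        exact hx hy
      simp only [labelWeight, this, if_false]
      split_ifs <;> simp
    simp at h1
    omega
  -- The label `0` has weight zero and cannot be seen in any coordinate. Parity detects it: every
  -- other label has odd coordinate sum, and an odd number of such labels cannot have sum zero.
  · rw [labelWeight_eq_zero hx0, zero_add] at h
    have hne : ∀ y ∈ l, y.rev ≠ y := by
      intro y hy hy0
      rw [hx0, eq_of_rev_eq_self hx0 hy0] at hx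
      exact hx hy
    have hpar : ∀ l : List (Idx ty n), (∀ y ∈ l, y.rev ≠ y) →
        (∑ i, (l.map labelWeight).sum i) % 2 = (l.length : ℤ) % 2 := by
      intro l
      induction l with
      | nil => simp
      | cons y l ih =>
        intro hl
        have h1 := ih fun z hz => hl z (List.mem_cons_of_mem _ hz)
        have h2 := sum_labelWeight_emod (hl y List.mem_cons_self)
        simp only [List.map_cons, List.sum_cons, Pi.add_apply, Finset.sum_add_distrib,
          List.length_cons, Nat.cast_add, Nat.cast_one]
        omega
    have := hpar l hne
    rw [h] at this
    simp only [Pi.zero_apply, Finset.sum_const_zero] at this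
    omega

theorem eq_of_sum₂ {a b : Idx ty n} (h : labelWeight a = labelWeight b) : a = b := by
  have := rev_mem_of_sum_eq_zero (x := a) (l := [b.rev]) (by simp) (by
    simp [labelWeight_rev, h])
  simpa using this

/-- Moving everything to one side, `a` must cancel against one of the other three terms, and the
remaining two terms then cancel against each other. -/
theorem cases_of_sum₄ {a b c d : Idx ty n}
    (h : labelWeight a + labelWeight b = labelWeight c + labelWeight d) :
    (a = c ∧ b = d) ∨ (a = d ∧ b = c) ∨ (a = b.rev ∧ c = d.rev) := by
  have h1 := rev_mem_of_sum_eq_zero (x := a) (l := [b, c.rev, d.rev]) (by simp) (by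
    simp only [List.map_cons, List.map_nil, List.sum_cons, List.sum_nil, labelWeight_rev]
    linear_combination h)
  simp only [List.mem_cons, List.not_mem_nil, or_false, Fin.rev_inj] at h1
  rcases h1 with h1 | rfl | rfl
  · refine Or.inr (Or.inr ⟨by rw [← h1, Fin.rev_rev], ?_⟩)
    subst h1
    apply eq_of_sum₂
    rw [labelWeight_rev] at h ⊢
    linear_combination -h
  · exact Or.inl ⟨rfl, eq_of_sum₂ (add_left_cancel h)⟩
  · exact Or.inr (Or.inl ⟨rfl, eq_of_sum₂ (by linear_combination h)⟩)

theorem cases_of_sum₆ {a b c d p q : Idx ty n}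
    (h : labelWeight a + labelWeight b + labelWeight c =
      labelWeight d + labelWeight p + labelWeight q) :
    (a = d ∧ labelWeight b + labelWeight c = labelWeight p + labelWeight q) ∨
    (a = p ∧ labelWeight b + labelWeight c = labelWeight d + labelWeight q) ∨
    (a = q ∧ labelWeight b + labelWeight c = labelWeight d + labelWeight p) ∨
    (a = b.rev ∧ labelWeight c = labelWeight d + labelWeight p + labelWeight q) ∨
    (a = c.rev ∧ labelWeight b = labelWeight d + labelWeight p + labelWeight q) := by
  have h1 := rev_mem_of_sum_eq_zero (x := a) (l := [b, c, d.rev, p.rev, q.rev]) (by simp) (by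
    simp only [List.map_cons, List.map_nil, List.sum_cons, List.sum_nil, labelWeight_rev]
    linear_combination h)
  simp only [List.mem_cons, List.not_mem_nil, or_false, Fin.rev_inj] at h1
  rcases h1 with h1 | h1 | rfl | rfl | rfl
  · refine Or.inr (Or.inr (Or.inr (Or.inl ⟨by rw [← h1, Fin.rev_rev], ?_⟩)))
    rw [← h1, labelWeight_rev] at h
    linear_combination h
  · refine Or.inr (Or.inr (Or.inr (Or.inr ⟨by rw [← h1, Fin.rev_rev], ?_⟩)))
    rw [← h1, labelWeight_rev] at h
    linear_combination h
  · exact Or.inl ⟨rfl, by linear_combination h⟩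
  · exact Or.inr (Or.inl ⟨rfl, by linear_combination h⟩)
  · exact Or.inr (Or.inr (Or.inl ⟨rfl, by linear_combination h⟩))

/-- The matrix position `(r, c)` is one of the two positions of the root vector of `γ`. -/
def Occupies (γ : Weight n) (r c : Idx ty n) : Prop :=
  γ.entry ty = (r, c) ∨ γ.entry ty = (c.rev, r.rev)

theorem Occupies.reflect {γ : Weight n} {r c : Idx ty n} (h : Occupies γ r c) :
    Occupies γ c.rev r.rev := by
  rcases h with h | h
  · right
    rw [h, Fin.rev_rev, Fin.rev_rev]
  · exact Or.inl h

theorem occupies_entry (γ : Weight n) : Occupies γ (γ.entry ty).1 (γ.entry ty).2 := Or.inl rfl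

theorem rev_zeroIdx (i : Fin n) (h : ty = .oddOrthogonal) : (zeroIdx ty i).rev = zeroIdx ty i := by
  subst h
  simp only [zeroIdx, Fin.ext_iff, Fin.val_rev, dim]
  omega

/-- The dictionary between roots and positions: relations among roots become relations among label
weights, which can be solved by cancellation. The weights `2 ε_i` are included for all groups
because the relation `Succ` and the set `D` use them in the orthogonal case too. -/
theorem vec_eq_entry {γ : Weight n} (hγ : γ ∈ posRoots ty n ∨ ∃ i, γ = .double i) :
    γ.vec = labelWeight (γ.entry ty).1 - labelWeight (γ.entry ty).2 := by
  cases γ with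
  | diff i j h =>
    simp only [Weight.entry, Weight.vec, labelWeight_negIdx]
    abel
  | sum i j h =>
    simp only [Weight.entry, Weight.vec, labelWeight_negIdx, labelWeight_posIdx]
    abel
  | double i =>
    simp only [Weight.entry, Weight.vec, labelWeight_negIdx, labelWeight_posIdx]
    rw [sub_neg_eq_add, ← Pi.single_add]
    rfl
  | single i =>
    have hty : ty = .oddOrthogonal := by
      rcases hγ with h | ⟨j, h⟩
      · exact h
      · exact absurd h (by simp)
    simp only [Weight.entry, Weight.vec, labelWeight_negIdx,
      labelWeight_eq_zero (rev_zeroIdx i hty)]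
    abel

theorem entry_lt {γ : Weight n} (hγ : γ ∈ posRoots ty n ∨ ∃ i, γ = .double i) :
    (γ.entry ty).1 < (γ.entry ty).2 := by
  have hd := two_mul_le_dim ty n
  rw [Fin.lt_def]
  cases γ with
  | diff i j h =>
    have h' : (i : ℕ) < j := h
    have := j.2
    simp only [Weight.entry, negIdx, posIdx, Fin.val_rev]
    omega
  | sum i j h =>
    have h' : (i : ℕ) < j := h
    have := j.2
    simp only [Weight.entry, negIdx, posIdx, Fin.val_rev]
    omega
  | double i =>
    have := i.2
    simp only [Weight.entry, negIdx, posIdx, Fin.val_rev]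
    omega
  | single i =>
    have hty : ty = .oddOrthogonal := by
      rcases hγ with h | ⟨j, h⟩
      · exact h
      · exact absurd h (by simp)
    subst hty
    have := i.2
    simp only [Weight.entry, negIdx, posIdx, zeroIdx, Fin.val_rev, dim]
    omega

theorem Occupies.vec_eq {γ : Weight n} (hγ : γ ∈ posRoots ty n ∨ ∃ i, γ = .double i)
    {r c : Idx ty n} (h : Occupies γ r c) : γ.vec = labelWeight r - labelWeight c := by
  rw [vec_eq_entry hγ]
  rcases h with h | h
  · rw [h]
  · rw [h, labelWeight_rev, labelWeight_rev]
    ring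

theorem Occupies.lt {γ : Weight n} (hγ : γ ∈ posRoots ty n ∨ ∃ i, γ = .double i)
    {r c : Idx ty n} (h : Occupies γ r c) : r < c := by
  have := entry_lt hγ
  rcases h with h | h
  · rwa [h] at this
  · rw [h] at this
    exact Fin.rev_lt_rev.1 this

/-- By cancellation of label weights a root determines its position up to reflection. The other
pairing would give an entry on the diagonal. -/
theorem occupies_of_vec_eq {γ : Weight n} (hγ : γ ∈ posRoots ty n ∨ ∃ i, γ = .double i)
    {r c : Idx ty n} (h : γ.vec = labelWeight r - labelWeight c) :
    Occupies γ r c := by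
  have hlt := entry_lt hγ
  rw [vec_eq_entry hγ] at h
  have h' : labelWeight (γ.entry ty).1 + labelWeight c =
      labelWeight r + labelWeight (γ.entry ty).2 := by linear_combination h
  rcases cases_of_sum₄ h' with ⟨h1, h2⟩ | ⟨h1, -⟩ | ⟨h1, h2⟩
  · exact Or.inl (Prod.ext h1 h2.symm)
  · exact absurd h1 hlt.ne
  · exact Or.inr (Prod.ext h1 (by rw [h2, Fin.rev_rev]))

theorem exists_occupies {r c : Idx ty n} (hrc : r < c) (hanti : c = r.rev → ty = .symplectic) :
    ∃ γ ∈ posRoots ty n, Occupies γ r c := by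
  rcases le_total c.rev r with h | h
  · obtain ⟨γ, hγ, he⟩ := exists_entry hrc h fun h' => hanti (by rw [← h', Fin.rev_rev])
    exact ⟨γ, hγ, Or.inl he⟩
  · obtain ⟨γ, hγ, he⟩ := exists_entry (Fin.rev_lt_rev.2 hrc) (by rwa [Fin.rev_rev])
      fun h' => hanti (by rw [Fin.rev_rev] at h'; rw [h', Fin.rev_rev])
    exact ⟨γ, hγ, Or.inr he⟩

/-- The positions on the antidiagonal of the orthogonal groups carry no root. There the weight is `2
ε_i`, which is why `Succ` admits these differences. -/
theorem exists_weight {r c : Idx ty n} (hrc : r < c) :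
    ∃ γ : Weight n, (γ ∈ posRoots ty n ∨ ∃ i, γ = .double i) ∧ Occupies γ r c := by
  by_cases h : c = r.rev → ty = .symplectic
  · obtain ⟨γ, hγ, ho⟩ := exists_occupies hrc h
    exact ⟨γ, Or.inl hγ, ho⟩
  · obtain ⟨rfl, -⟩ := Classical.not_imp.1 h
    rcases label_cases r with ⟨i, rfl⟩ | ⟨i, rfl⟩ | h0
    · exact ⟨.double i, Or.inr ⟨i, rfl⟩, Or.inl rfl⟩
    · exfalso
      rw [Fin.lt_def] at hrc
      have := two_mul_le_dim ty n
      have := i.2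
      simp only [negIdx, posIdx, Fin.rev_rev, Fin.val_rev] at hrc
      omega
    · exact absurd hrc (by rw [h0]; exact lt_irrefl _)

theorem Occupies.eq_or_eq {γ : Weight n} {r c r' c' : Idx ty n} (h : Occupies γ r c)
    (h' : Occupies γ r' c') : (r' = r ∧ c' = c) ∨ (r' = c.rev ∧ c' = r.rev) := by
  rcases h with h | h <;> rcases h' with h' | h' <;> rw [h] at h' <;>
    obtain ⟨h1, h2⟩ := Prod.mk.inj h'
  · exact Or.inl ⟨h1.symm, h2.symm⟩
  · right
    rw [h1, h2]
    simp
  · exact Or.inr ⟨h1.symm, h2.symm⟩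
  · left
    exact ⟨(Fin.rev_inj.1 h2).symm, (Fin.rev_inj.1 h1).symm⟩

/-- Entries lie on or below the antidiagonal, so if two of them are reflections of each other they
coincide. -/
theorem Occupies.unique {γ γ' : Weight n} (hγ : γ ∈ posRoots ty n) (hγ' : γ' ∈ posRoots ty n)
    {r c : Idx ty n} (h : Occupies γ r c) (h' : Occupies γ' r c) : γ = γ' := by
  apply entry_injective hγ hγ'
  have h1 := (entry_spec hγ).2.1
  have h2 := (entry_spec hγ').2.1
  rcases h with h | h <;> rcases h' with h' | h' <;> rw [h, h']
  · rw [h] at h1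
    rw [h', Fin.rev_rev] at h2
    obtain rfl : c.rev = r := Fin.ext (le_antisymm h1 h2)
    rw [Fin.rev_rev]
  · rw [h, Fin.rev_rev] at h1
    rw [h'] at h2
    obtain rfl : c.rev = r := Fin.ext (le_antisymm h2 h1)
    rw [Fin.rev_rev]

/-- Comparable roots have positions in a common row or column. -/
theorem comparable_positions {r c r' c' s s' : Idx ty n} (hrc : r < c) (hrc' : r' < c')
    (hs : s < s') (h : labelWeight r - labelWeight c - (labelWeight r' - labelWeight c') =
      labelWeight s - labelWeight s') :
    (r = r' ∧ c' < c) ∨ (r = c'.rev ∧ r'.rev < c) ∨ (c = c' ∧ r < r') ∨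
      (c = r'.rev ∧ r < c'.rev) := by
  -- With three labels on each side, `r` is matched with one of the other five. The match `r = c` is
  -- impossible, and each of the remaining ones leads to a common row or column with `(r', c')` or
  -- with its reflection.
  have h' : labelWeight r + labelWeight c' + labelWeight s' =
      labelWeight r' + labelWeight c + labelWeight s := by linear_combination h
  rcases cases_of_sum₆ h' with ⟨h1, h2⟩ | ⟨h1, -⟩ | ⟨h1, h2⟩ | ⟨h1, h2⟩ | ⟨h1, h2⟩
  · left
    refine ⟨h1, ?_⟩
    rcases cases_of_sum₄ h2 with ⟨h3, h4⟩ | ⟨h3, h4⟩ | ⟨h3, h4⟩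
    · exact absurd h4 hs.ne'
    · rw [h3, ← h4]
      exact hs
    · rw [h3, h4]
      exact Fin.rev_lt_rev.2 hs
  · exact absurd h1 hrc.ne
  · rcases cases_of_sum₄ h2 with ⟨h3, h4⟩ | ⟨h3, h4⟩ | ⟨h3, h4⟩
    · exact absurd h3 hrc'.ne'
    · refine Or.inr (Or.inr (Or.inl ⟨h3.symm, ?_⟩))
      rw [h1, ← h4]
      exact hs
    · refine Or.inr (Or.inr (Or.inr ⟨by rw [h4, Fin.rev_rev], ?_⟩))
      rw [h1, h3, Fin.rev_rev]
      exact hs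
  · refine Or.inr (Or.inl ⟨h1, ?_⟩)
    have h3 : labelWeight s' + labelWeight r'.rev = labelWeight c + labelWeight s := by
      rw [labelWeight_rev]
      linear_combination h2
    rcases cases_of_sum₄ h3 with ⟨h4, h5⟩ | ⟨h4, -⟩ | ⟨h4, h5⟩
    · rw [h5, ← h4]
      exact hs
    · exact absurd h4 hs.ne'
    · rw [Fin.rev_rev] at h4
      rw [h5, ← h4]
      exact Fin.rev_lt_rev.2 hs
  · have h3 : labelWeight c' + labelWeight r'.rev = labelWeight c + labelWeight s := by
      rw [labelWeight_rev]
      linear_combination h2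
    rcases cases_of_sum₄ h3 with ⟨h4, h5⟩ | ⟨h4, h5⟩ | ⟨h4, -⟩
    · refine Or.inr (Or.inr (Or.inl ⟨h4.symm, ?_⟩))
      have : r' = s.rev := by rw [← h5, Fin.rev_rev]
      rw [h1, this]
      exact Fin.rev_lt_rev.2 hs
    · refine Or.inr (Or.inr (Or.inr ⟨h5.symm, ?_⟩))
      rw [h1, h4]
      exact Fin.rev_lt_rev.2 hs
    · rw [Fin.rev_rev] at h4
      exact absurd h4 hrc'.ne'

end Labels

/-! ### The positions of the base form a symmetric rook placement. -/

section BaseRook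

variable {K : Type*} [Field K] {ty : ClassicalType} {n : ℕ} {P : BlockSizes n}

theorem Occupies.mem_nilRoots_iff {γ : Weight n} {r c : Idx ty n} (h : Occupies γ r c) :
    γ ∈ nilRoots K ty P ↔ γ ∈ posRoots ty n ∧ P.blockNumber ty r < P.blockNumber ty c := by
  rw [ParabolicInvariants.mem_nilRoots_iff]
  rcases h with h | h
  · rw [h]
  · rw [h, P.blockNumber_rev, P.blockNumber_rev, neg_lt_neg_iff]

theorem mem_leviRoots_iff {γ : Weight n} :
    γ ∈ leviRoots K ty P ↔ γ ∈ posRoots ty n ∧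
      P.blockNumber ty (γ.entry ty).1 = P.blockNumber ty (γ.entry ty).2 := by
  constructor
  · rintro ⟨h1, -, h2⟩
    refine ⟨h1, ?_⟩
    by_contra hcon
    have := h2 (γ.entry ty).2.rev (γ.entry ty).1.rev (by
      rw [P.blockNumber_rev, P.blockNumber_rev]
      omega)
    rw [rootVector_apply K h1] at this
    simp at this
  · rintro ⟨h1, h2⟩
    refine ⟨h1, rootVector_mem_lieAlg K h1, fun i j hij => ?_⟩
    rw [rootVector_apply K h1, if_neg, if_neg]
    · intro h
      rw [h] at h2
      exact hij h2
    · rintro ⟨rfl, rfl⟩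
      rw [P.blockNumber_rev, P.blockNumber_rev] at hij
      omega

variable (K ty P) in
open Classical in
/-- The positions of the roots of the base. -/
noncomputable def basePositions : Finset (Idx ty n × Idx ty n) :=
  Finset.univ.filter fun p => ∃ ξ ∈ base K ty P, Occupies ξ p.1 p.2

theorem mem_basePositions {r c : Idx ty n} :
    (r, c) ∈ basePositions K ty P ↔ ∃ ξ ∈ base K ty P, Occupies ξ r c := by
  simp [basePositions]

theorem base_subset : base K ty P ⊆ nilRoots K ty P := (base_isBase K ty P).1

theorem base_posRoots {ξ : Weight n} (h : ξ ∈ base K ty P) : ξ ∈ posRoots ty n :=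
  (base_subset h).1

/-- Two roots with positions `(r, c)` and `(r, c')` in one row differ by the weight at `(c, c')`.
They would be comparable, which the base forbids. -/
theorem base_row_unique {ξ ξ' : Weight n} (hξ : ξ ∈ base K ty P) (hξ' : ξ' ∈ base K ty P)
    {r c c' : Idx ty n} (h : Occupies ξ r c) (h' : Occupies ξ' r c') : ¬ c < c' := by
  intro hlt
  obtain ⟨δ, hδ, ho⟩ := exists_weight hlt
  refine (base_isBase K ty P).2.1 ξ hξ ξ' hξ' ⟨δ, hδ, ?_⟩
  rw [ho.vec_eq hδ, h.vec_eq (Or.inl (base_posRoots hξ)), h'.vec_eq (Or.inl (base_posRoots hξ'))]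
  ring

/-- This extracts from the base all that the rank estimate needs. Incomparability gives uniqueness
in rows, and maximality gives domination, because comparable roots share a row or a column after a
possible reflection. -/
theorem symmetricRook_basePositions :
    SymmetricRook (P.blockNumber ty) (ty = .symplectic) (basePositions K ty P) where
  mono _ _ h := P.blockNumber_mono h
  rev := P.blockNumber_rev
  block_lt h := by
    obtain ⟨ξ, hξ, ho⟩ := mem_basePositions.1 h
    exact (ho.mem_nilRoots_iff.1 (base_subset hξ)).2
  anti_of_mem {r} h := by
    obtain ⟨ξ, hξ, ho⟩ := mem_basePositions.1 h
    have h3 := (entry_spec (base_posRoots hξ)).2.2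
    have ho : ξ.entry ty = (r, r.rev) := by
      rcases ho with ho | ho
      · exact ho
      · simpa using ho
    rw [ho] at h3
    exact h3 (by simp)
  symm h := by
    obtain ⟨ξ, hξ, ho⟩ := mem_basePositions.1 h
    exact mem_basePositions.2 ⟨ξ, hξ, ho.reflect⟩
  row_unique h h' := by
    obtain ⟨ξ, hξ, ho⟩ := mem_basePositions.1 h
    obtain ⟨ξ', hξ', ho'⟩ := mem_basePositions.1 h'
    exact le_antisymm (not_lt.1 (base_row_unique hξ' hξ ho' ho))
      (not_lt.1 (base_row_unique hξ hξ' ho ho'))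
  dominated {r c} hb hanti hF := by
    have hrc : r < c := by
      by_contra h
      exact absurd (P.blockNumber_mono (ty := ty) (not_lt.1 h)) (not_le.2 hb)
    obtain ⟨γ, hγ, ho⟩ := exists_occupies hrc hanti
    have hmem : γ ∈ nilRoots K ty P := ho.mem_nilRoots_iff.2 ⟨hγ, hb⟩
    obtain ⟨ξ, hξ, δ, hδ, hvec⟩ := (base_isBase K ty P).2.2 γ
      ⟨hmem, fun h => hF (mem_basePositions.2 ⟨γ, h, ho⟩)⟩
    have hξr := Or.inl (b := ∃ i, ξ = .double i) (base_posRoots hξ)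
    rw [ho.vec_eq (Or.inl hγ), (occupies_entry ξ).vec_eq hξr, vec_eq_entry hδ] at hvec
    have he := occupies_entry (ty := ty) ξ
    rcases comparable_positions hrc (entry_lt hξr) (entry_lt hδ) hvec with
      ⟨h1, h2⟩ | ⟨h1, h2⟩ | ⟨h1, h2⟩ | ⟨h1, h2⟩
    · exact Or.inl ⟨_, h2, mem_basePositions.2 ⟨ξ, hξ, h1 ▸ he⟩⟩
    · exact Or.inl ⟨_, h2, mem_basePositions.2 ⟨ξ, hξ, h1 ▸ he.reflect⟩⟩
    · exact Or.inr ⟨_, h2, mem_basePositions.2 ⟨ξ, hξ, h1 ▸ he⟩⟩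
    · exact Or.inr ⟨_, h2, mem_basePositions.2 ⟨ξ, hξ, h1 ▸ he.reflect⟩⟩

end BaseRook

/-! ### When no element of the placement enters the window. -/

section Clear

variable {m : ℕ} {b : Fin m → ℤ} {anti : Prop} {F : Finset (Fin m × Fin m)}

/-- Suppose `(r, c)` were such an element. Then `(r, y)` lies above the block diagonal and outside
`F`. Nothing dominates it: row `r` has only `(r, c)`, further right, and column `y` only `(x, y)`,
higher up. So `(r, y)` lies on the antidiagonal with `anti` false, and reflecting `(r, c)` gives
`x.rev = c`, which `h` excludes. -/
theorem SymmetricRook.clear_columns (hF : SymmetricRook b anti F) {x y z : Fin m}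
    (hxy : (x, y) ∈ F) (hyz : b y = b z) (h : ¬ (y < x.rev ∧ b x.rev = b y)) :
    ∀ r c, (r, c) ∈ F → x < r → y < c → c ≤ z → False := by
  intro r c hrc hxr hyc hcz
  have hbc : b c = b y := le_antisymm ((hF.mono hcz).trans hyz.ge) (hF.mono hyc.le)
  have hb : b r < b y := hbc ▸ hF.block_lt hrc
  have hnot : (r, y) ∉ F := fun h' => hxr.ne (hF.col_unique hxy h')
  by_cases ha : y = r.rev → anti
  · rcases hF.dominated hb ha hnot with ⟨c', h1, h2⟩ | ⟨r', h1, h2⟩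
    · exact (h1.trans hyc).ne (hF.row_unique h2 hrc)
    · exact (hxr.trans h1).ne (hF.col_unique hxy h2)
  · obtain ⟨rfl, -⟩ := Classical.not_imp.1 ha
    have hx : x = c.rev := hF.col_unique hxy (hF.symm hrc)
    apply h
    rw [hx, Fin.rev_rev]
    exact ⟨hyc, hbc⟩

theorem SymmetricRook.clear_rows (hF : SymmetricRook b anti F) {y z w : Fin m}
    (hzw : (z, w) ∈ F) (hyz : b y = b z) (h : ¬ (w.rev < z ∧ b w.rev = b z)) :
    ∀ r c, (r, c) ∈ F → c < w → y ≤ r → r < z → False := by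
  intro r c hrc hcw hyr hrz
  refine hF.clear_columns (hF.symm hzw) (z := y.rev) (by rw [hF.rev, hF.rev, hyz]) ?_ c.rev r.rev
    (hF.symm hrc) (Fin.rev_lt_rev.2 hcw) (Fin.rev_lt_rev.2 hrz) (Fin.rev_le_rev.2 hyr)
  rintro ⟨h1, h2⟩
  rw [Fin.rev_rev] at h1 h2
  rw [hF.rev] at h2
  refine h ⟨by rwa [← Fin.rev_lt_rev, Fin.rev_rev], ?_⟩
  rw [hF.rev]
  omega

end Clear

/-! ### Signs relating pivot minors at reflected positions. -/

section Signs

variable {m : ℕ} {A : Type*} [CommRing A]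

theorem sortedMinor_scale (X : Matrix (Fin m) (Fin m) A) (d e : Fin m → A)
    (I J : Finset (Fin m)) : sortedMinor (Matrix.of fun i j => d i * e j * X i j) I J =
      (∏ i ∈ I, d i) * (∏ j ∈ J, e j) * sortedMinor X I J := by
  by_cases h : J.card = I.card
  · obtain ⟨f, hf, hI⟩ := exists_strictMono I rfl
    obtain ⟨g, hg, hJ⟩ := exists_strictMono J h
    have hprod : ∀ (T : Finset (Fin m)) (f : Fin I.card → Fin m) (d : Fin m → A), StrictMono f →
        (∀ r, r ∈ T ↔ ∃ i, f i = r) → ∏ i ∈ T, d i = ∏ i, d (f i) := by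
      intro T f d hf hT
      have : T = Finset.univ.image f := by
        ext r
        simp [hT]
      rw [this, Finset.prod_image fun i _ j _ h => hf.injective h]
    rw [sortedMinor_eq _ hf hg hI hJ, sortedMinor_eq _ hf hg hI hJ, hprod I f d hf hI,
      hprod J g e hg hJ, mul_assoc, ← Matrix.det_mul_row, ← Matrix.det_mul_column]
    congr 1
    ext i j
    simp [mul_assoc]
  · rw [sortedMinor, sortedMinor, dif_neg h, dif_neg h, mul_zero]

variable {ty : ClassicalType} {n : ℕ}

theorem rowSign_mul_self (i : Idx ty n) : rowSign A ty i * rowSign A ty i = 1 := by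
  unfold rowSign
  split_ifs <;> simp

/-- Membership in the Lie algebra says that reflection only rescales rows and columns by signs, so
minors at reflected positions agree up to sign. -/
theorem antiTranspose_eq {X : Matrix (Idx ty n) (Idx ty n) A} (hX : X ∈ lieAlg A ty n) :
    antiTranspose X = Matrix.of fun i j => (-rowSign A ty i) * rowSign A ty j * X i j := by
  rw [mem_lieAlg_iff] at hX
  ext i j
  simp only [antiTranspose, Matrix.of_apply]
  have h1 := hX i j
  linear_combination (rowSign A ty j) * h1 - X j.rev i.rev * rowSign_mul_self (A := A) j

/-- The sign that relates the pivot minors at `(x, t)` and at the reflected position. -/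
def reflectSign (F : Finset (Idx ty n × Idx ty n)) (x t : Idx ty n) : ℤ :=
  (∏ i ∈ insert t.rev ((southWest F t.rev x.rev).image Prod.fst), -rowSign ℤ ty i) *
    ∏ j ∈ insert x.rev ((southWest F t.rev x.rev).image Prod.snd), rowSign ℤ ty j

theorem reflectSign_mul_self (F : Finset (Idx ty n × Idx ty n)) (x t : Idx ty n) :
    reflectSign F x t * reflectSign F x t = 1 := by
  rw [reflectSign, mul_mul_mul_comm, ← Finset.prod_mul_distrib, ← Finset.prod_mul_distrib]
  simp [rowSign_mul_self]

theorem cast_rowSign (i : Idx ty n) : ((rowSign ℤ ty i : ℤ) : A) = rowSign A ty i := by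
  unfold rowSign
  split_ifs <;> simp

/-- Needed because `M_γ` is read at the reflection of the entry of `γ`, whereas the transformation
law requires all minors in one row `x`. -/
theorem pivotMinor_reflect {b : Idx ty n → ℤ} {anti : Prop} {F : Finset (Idx ty n × Idx ty n)}
    (hF : SymmetricRook b anti F) {X : Matrix (Idx ty n) (Idx ty n) A} (hX : X ∈ lieAlg A ty n)
    (x t : Idx ty n) :
    pivotMinor F X x t = (reflectSign F x t : A) * pivotMinor F X t.rev x.rev := by
  rw [← pivotMinor_antiTranspose hF, antiTranspose_eq hX, pivotMinor, sortedMinor_scale,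
    reflectSign, pivotMinor]
  push_cast
  simp only [cast_rowSign]

/-- The sign does not depend on the position inside the row if the signs of the form do not. -/
theorem reflectSign_eq {F : Finset (Idx ty n × Idx ty n)} {x t y : Idx ty n}
    (hsw : southWest F t.rev x.rev = southWest F y.rev x.rev) (ht : n ≤ (t : ℕ))
    (hy : n ≤ (y : ℕ)) : reflectSign F x t = reflectSign F x y := by
  have hd : dim ty n ≤ 2 * n ∨ ty ≠ .symplectic := by cases ty <;> simp [dim]
  -- The reflection of a label in the lower half lies in the upper half, where the form of the
  -- symplectic group has sign `1`; the orthogonal forms have no signs at all.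
  have hsign : ∀ v : Idx ty n, n ≤ (v : ℕ) → rowSign ℤ ty v.rev = 1 := by
    intro v hv
    rw [rowSign, if_neg]
    rintro ⟨h1, h2⟩
    rw [Fin.val_rev] at h2
    have h3 := v.2
    rcases hd with hd | hd
    · omega
    · exact hd h1
  have hnot : ∀ v : Idx ty n, v.rev ∉ (southWest F v.rev x.rev).image Prod.fst := by
    intro v h
    obtain ⟨⟨r, c⟩, h, rfl⟩ := Finset.mem_image.1 h
    exact lt_irrefl _ (mem_southWest.1 h).2.1
  have hnot' := hnot t
  rw [hsw] at hnot'
  rw [reflectSign, reflectSign, hsw, Finset.prod_insert (hnot y), Finset.prod_insert hnot',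
    hsign t ht, hsign y hy]

end Signs

/-! ### The minors of roots as pivot minors, and admissible pairs as chains of positions. -/

section Chains

variable {K : Type*} [Field K] {ty : ClassicalType} {n : ℕ} {P : BlockSizes n}

/-- An element of the placement south-west of the reflected entry is either the reflection of an
entry, which gives the elements of `S_γ`, or an entry itself. The latter lies far enough left
exactly when `b_i ≻ a`, which accounts for the extra rows `a_i` and columns `-b_i`. -/
theorem southWest_entry_rev {γ : Weight n} (hγ : γ ∈ posRoots ty n) :
    southWest (basePositions K ty P) (γ.entry ty).2.rev (γ.entry ty).1.rev =
      (baseBelow K ty P γ).image (fun ξ => ((ξ.entry ty).2.rev, (ξ.entry ty).1.rev)) ∪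
        (baseBelowLarge K ty P γ).image (fun ξ => ξ.entry ty) := by
  have h1 := (entry_spec hγ).2.1
  rw [← Fin.le_def] at h1
  ext ⟨r, c⟩
  simp only [mem_southWest, mem_basePositions, Finset.mem_union, Finset.mem_image, baseBelowLarge,
    baseBelow, Finset.mem_filter, Finset.mem_univ, true_and, Prod.mk.injEq]
  constructor
  · rintro ⟨⟨ξ, hξ, ho⟩, h2, h3⟩
    rcases ho with ho | ho
    · right
      have h4 : (ξ.entry ty).2.rev ≤ (ξ.entry ty).1 := (entry_spec (base_posRoots hξ)).2.1
      rw [ho] at h4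
      have h5 : (γ.entry ty).1 < c.rev := by rwa [← Fin.rev_lt_rev, Fin.rev_rev]
      refine ⟨ξ, ⟨⟨hξ, ?_, ?_⟩, ?_⟩, ho⟩ <;> rw [ho]
      · exact h5.trans_le h4
      · exact Fin.rev_lt_rev.1 (h1.trans_lt h5)
      · exact h5
    · left
      refine ⟨ξ, ⟨hξ, ?_, ?_⟩, ?_, ?_⟩ <;> rw [ho]
      · rwa [← Fin.rev_lt_rev, Fin.rev_rev]
      · rwa [← Fin.rev_lt_rev, Fin.rev_rev]
      · simp
      · simp
  · rintro (⟨ξ, ⟨hξ, h2, h3⟩, rfl, rfl⟩ | ⟨ξ, ⟨⟨hξ, h2, h3⟩, h4⟩, h5⟩)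
    · exact ⟨⟨ξ, hξ, (occupies_entry ξ).reflect⟩, Fin.rev_lt_rev.2 h3, Fin.rev_lt_rev.2 h2⟩
    · rw [h5] at h2 h4
      exact ⟨⟨ξ, hξ, Or.inl h5⟩, h1.trans_lt h2, by rwa [← Fin.rev_lt_rev, Fin.rev_rev]⟩

theorem rowSet_eq {γ : Weight n} (hγ : γ ∈ posRoots ty n) :
    rowSet K ty P γ = insert (γ.entry ty).2.rev
      ((southWest (basePositions K ty P) (γ.entry ty).2.rev (γ.entry ty).1.rev).image
        Prod.fst) := by
  rw [southWest_entry_rev hγ, Finset.image_union, Finset.image_image, Finset.image_image]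
  ext r
  simp only [rowSet, Finset.mem_union, Finset.mem_insert, Finset.mem_singleton]
  tauto

theorem colSet_eq {γ : Weight n} (hγ : γ ∈ posRoots ty n) :
    colSet K ty P γ = insert (γ.entry ty).1.rev
      ((southWest (basePositions K ty P) (γ.entry ty).2.rev (γ.entry ty).1.rev).image
        Prod.snd) := by
  rw [southWest_entry_rev hγ, Finset.image_union, Finset.image_image, Finset.image_image]
  ext r
  simp only [colSet, Finset.mem_union, Finset.mem_insert, Finset.mem_singleton]
  tauto

/-- `M_γ` belongs to the position of `γ` on or above the antidiagonal, and `M̄_γ` to the entry on or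
below it. -/
theorem minorM_eq {γ : Weight n} (hγ : γ ∈ posRoots ty n) :
    minorM K ty P γ = pivotMinor (basePositions K ty P) (formalMatrix K ty P)
      (γ.entry ty).2.rev (γ.entry ty).1.rev := by
  rw [pivotMinor, ← rowSet_eq hγ, ← colSet_eq hγ]
  rfl

theorem minorMBar_eq {γ : Weight n} (hγ : γ ∈ posRoots ty n) :
    minorMBar K ty P γ = pivotMinor (basePositions K ty P) (formalMatrix K ty P)
      (γ.entry ty).1 (γ.entry ty).2 := by
  have h := southWest_reflect (symmetricRook_basePositions (K := K) (ty := ty) (P := P))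
    (γ.entry ty).2.rev (γ.entry ty).1.rev
  rw [Fin.rev_rev, Fin.rev_rev] at h
  rw [pivotMinor, h, minorMBar, rowSet_eq hγ, colSet_eq hγ]
  simp only [Finset.image_insert, Finset.image_image, Fin.rev_rev]
  rfl

theorem blockNumber_eq_zero {v : Idx ty n} (h1 : P.R ≤ (v : ℕ)) (h2 : (v : ℕ) < dim ty n - P.R) :
    P.blockNumber ty v = 0 := by
  have hcount : ∀ a : ℕ, P.R ≤ a → P.count a = P.blocks.length := by
    intro a ha
    rw [BlockSizes.count, Finset.filter_true_of_mem, Finset.card_range]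
    intro t _
    refine le_trans ?_ ha
    exact (List.take_sublist _ _).sum_le_sum fun _ _ => Nat.zero_le _
  rw [BlockSizes.blockNumber, hcount _ h1, hcount _ (by rw [Fin.val_rev]; omega), sub_self]

theorem entry_snd_rev_lt (γ : Weight n) : ((γ.entry ty).2.rev : ℕ) < n := by
  cases γ <;> simp only [Weight.entry, negIdx, Fin.rev_rev, posIdx] <;> exact Fin.is_lt _

theorem blockNumber_nonneg {v : Idx ty n} (h : (v.rev : ℕ) < n) : 0 ≤ P.blockNumber ty v := by
  have hd := two_mul_le_dim ty n
  have h1 : v.rev ≤ v := by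
    rw [Fin.le_def]
    have := h
    rw [Fin.val_rev] at this
    omega
  have := P.blockNumber_mono h1
  rw [P.blockNumber_rev] at this
  omega

/-- If `ε_k + ε_{k+1}` lies in `M`, the label `k` lies before the central block: otherwise the block
numbers of `k` and `k + 1` would be nonnegative, and the entry of the root would not be above the
block diagonal. -/
theorem double_mem_tailDoubles {i : Fin n} (h : P.blockNumber ty (posIdx ty i) = 0) :
    .double i ∈ tailDoubles K ty P := by
  refine ⟨i, rfl, fun k l hkl _ hmem => ?_⟩
  by_contra hik
  have h1 : posIdx ty i ≤ posIdx ty k := not_lt.1 hik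
  have h2 : posIdx ty k ≤ posIdx ty l := hkl.le
  have h3 := (mem_nilRoots_iff.1 hmem).2
  have h4 := P.blockNumber_mono h1
  have h5 := P.blockNumber_mono h2
  simp only [Weight.entry, negIdx, P.blockNumber_rev] at h3
  omega

/-- A pair of labels in the same diagonal block is a position of a weight of the set over which
the sum `L_φ` extends. -/
theorem exists_mem_summationSet {r c : Idx ty n} (hrc : r < c)
    (hb : P.blockNumber ty r = P.blockNumber ty c) :
    ∃ γ ∈ summationSet K ty P, (γ ∈ posRoots ty n ∨ ∃ i, γ = .double i) ∧ Occupies γ r c := by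
  by_cases h : c = r.rev → ty = .symplectic
  · obtain ⟨γ, hγ, ho⟩ := exists_occupies hrc h
    have hmem : γ ∈ leviRoots K ty P := by
      rw [mem_leviRoots_iff]
      refine ⟨hγ, ?_⟩
      rcases ho with ho | ho
      · rw [ho]
        exact hb
      · rw [ho, P.blockNumber_rev, P.blockNumber_rev, hb]
    refine ⟨γ, ?_, Or.inl hγ, ho⟩
    unfold summationSet gammaSet
    split_ifs
    · exact hmem
    · exact Or.inl hmem
  -- A position on the antidiagonal inside a diagonal block lies in the central one. Its weight `2
  -- ε_i` is not a root of the orthogonal group, but `D` supplies it.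
  · obtain ⟨rfl, hty⟩ := Classical.not_imp.1 h
    rw [P.blockNumber_rev] at hb
    obtain ⟨γ, hγ, ho⟩ := exists_weight hrc
    rcases label_cases r with ⟨i, rfl⟩ | ⟨i, rfl⟩ | h0
    · refine ⟨.double i, ?_, Or.inr ⟨i, rfl⟩, Or.inl rfl⟩
      unfold summationSet gammaSet
      rw [if_neg hty, if_neg hty]
      exact Or.inr (double_mem_tailDoubles (by omega))
    · exfalso
      rw [Fin.lt_def] at hrc
      have := two_mul_le_dim ty n
      have := i.2
      simp only [negIdx, posIdx, Fin.rev_rev, Fin.val_rev] at hrc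
      omega
    · exact absurd hrc (by rw [h0]; exact lt_irrefl _)

theorem isRoot_of_mem_summationSet {γ : Weight n} (h : γ ∈ summationSet K ty P) :
    γ ∈ posRoots ty n ∨ ∃ i, γ = .double i := by
  unfold summationSet gammaSet at h
  split_ifs at h
  · exact Or.inl h.1
  · rcases h with h | ⟨i, h, -⟩
    · exact Or.inl h.1
    · exact Or.inr ⟨i, h⟩

/-- The positions `(x, y)`, `(y, z)`, `(z, w)` of `ξ`, `α_q`, `ξ'` for an admissible pair
`q = (ξ, ξ')`. -/
structure IsChain (q : AdmissiblePair K ty P) (x y z w : Idx ty n) : Prop where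
  occ : Occupies q.ξ x y
  entry' : q.ξ'.entry ty = (z, w)
  root : q.α ∈ posRoots ty n ∨ ∃ i, q.α = .double i
  occ_root : q.α.entry ty = (y, z)
  block_eq : P.blockNumber ty y = P.blockNumber ty z
  clear : ¬ (y < x.rev ∧ P.blockNumber ty x.rev = P.blockNumber ty y)
  clear' : ¬ (w.rev < z ∧ P.blockNumber ty w.rev = P.blockNumber ty z)
  shape : (q.ξ.entry ty = (x, y) ∧ n ≤ (y : ℕ)) ∨
    (q.ξ.entry ty = (y.rev, x.rev) ∧ P.blockNumber ty y = 0 ∧ (z = y.rev → ty ≠ .symplectic))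

/-- In the first kind of admissible pair the chain starts at the entry of `ξ`. In the second it
starts at the reflected position, whose column `-a` is the row of the entry of `α_q`. The conditions
that make the windows clear hold because entries lie on or below the antidiagonal, or by comparing
block numbers. -/
theorem exists_isChain (q : AdmissiblePair K ty P) : ∃ x y z w, IsChain q x y z w := by
  have hd := two_mul_le_dim ty n
  have hξ' := (mem_nilRoots_iff.1 (base_subset q.ξ'_mem)).2
  have hξ := (mem_nilRoots_iff.1 (base_subset q.ξ_mem)).2
  have hclear' : ∀ z, (z.rev : ℕ) < n → (q.ξ'.entry ty).1 = z →
      ¬ ((q.ξ'.entry ty).2.rev < z ∧ P.blockNumber ty (q.ξ'.entry ty).2.rev =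
        P.blockNumber ty z) := by
    rintro z hz rfl ⟨-, h⟩
    have := blockNumber_nonneg (P := P) hz
    rw [P.blockNumber_rev] at h
    omega
  rcases q.admissible with ⟨-, h1, h2, h3⟩ | ⟨h1, h2, h3, h4⟩
  · have hα := mem_leviRoots_iff.1 h1
    refine ⟨(q.ξ.entry ty).1, (q.ξ.entry ty).2, (q.ξ'.entry ty).1, (q.ξ'.entry ty).2,
      occupies_entry _, rfl, Or.inl hα.1, ?_, ?_, ?_, ?_, Or.inl ⟨rfl, ?_⟩⟩
    · rw [h2, ← h3]
    · rw [h2, ← h3]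
      exact hα.2
    · rintro ⟨h4, -⟩
      have h5 : (q.ξ.entry ty).2.rev ≤ (q.ξ.entry ty).1 :=
        (entry_spec (base_posRoots q.ξ_mem)).2.1
      rw [← Fin.rev_le_rev, Fin.rev_rev] at h5
      exact absurd h4 (not_lt.2 h5)
    · exact hclear' _ (by rw [← h3]; exact entry_snd_rev_lt _) rfl
    · have := entry_snd_rev_lt (ty := ty) q.ξ
      rw [Fin.val_rev] at this
      omega
  · have hb := blockNumber_eq_zero h1.1 h1.2
    have hb' := blockNumber_eq_zero h2.1 h2.2
    have hα : q.α ∈ posRoots ty n ∨ ∃ i, q.α = .double i := by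
      unfold gammaSet at h3
      split_ifs at h3
      · exact Or.inl h3.1.1
      · rcases h3 with h3 | ⟨i, h3, -⟩
        · exact Or.inl h3.1
        · exact Or.inr ⟨i, h3⟩
    refine ⟨(q.ξ.entry ty).2.rev, (q.ξ.entry ty).1.rev, (q.ξ'.entry ty).1, (q.ξ'.entry ty).2,
      (occupies_entry _).reflect, rfl, hα, h4, ?_, ?_, ?_, Or.inr ⟨?_, ?_, ?_⟩⟩
    · rw [P.blockNumber_rev, hb, hb', neg_zero]
    · rintro ⟨-, h5⟩
      rw [Fin.rev_rev, P.blockNumber_rev] at h5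
      omega
    · refine hclear' _ ?_ rfl
      have := entry_snd_rev_lt (ty := ty) q.α
      rwa [h4] at this
    · rw [Fin.rev_rev, Fin.rev_rev]
    · rw [P.blockNumber_rev, hb, neg_zero]
    -- For the symplectic group the middle root would be some `2 ε_i` in the central block, and
    -- these are removed from `Γ`. Self-dual chains of this kind therefore occur only for orthogonal
    -- groups.
    · intro h5 hty
      rw [gammaSet, if_pos hty] at h3
      apply h3.2
      have hlt := entry_lt hα
      rw [h4, h5] at hlt
      simp only at hlt
      rcases label_cases (q.ξ.entry ty).1.rev with ⟨i, hi⟩ | ⟨i, hi⟩ | h0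
      · have : q.α = .double i := by
          refine Occupies.unique h3.1.1 (show _ ∈ posRoots ty n from hty)
            (r := (q.ξ.entry ty).1.rev) (c := (q.ξ.entry ty).1.rev.rev) (Or.inl ?_) (Or.inl ?_)
          · rw [h4, h5]
          · rw [hi]
            rfl
        rw [this]
        refine double_mem_tailDoubles ?_
        rw [← hi, P.blockNumber_rev, hb, neg_zero]
      · exfalso
        rw [hi, Fin.lt_def] at hlt
        have := i.2
        simp only [negIdx, posIdx, Fin.rev_rev, Fin.val_rev] at hlt
        omega
      · rw [h0] at hlt
        exact absurd hlt (lt_irrefl _)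

namespace IsChain

variable {q : AdmissiblePair K ty P} {x y z w : Idx ty n}

theorem mem (c : IsChain q x y z w) : (x, y) ∈ basePositions K ty P :=
  mem_basePositions.2 ⟨q.ξ, q.ξ_mem, c.occ⟩

theorem mem' (c : IsChain q x y z w) : (z, w) ∈ basePositions K ty P :=
  mem_basePositions.2 ⟨q.ξ', q.ξ'_mem, Or.inl c.entry'⟩

theorem block_lt (c : IsChain q x y z w) : P.blockNumber ty x < P.blockNumber ty y :=
  symmetricRook_basePositions.block_lt c.mem

theorem block_lt' (c : IsChain q x y z w) : P.blockNumber ty z < P.blockNumber ty w :=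
  symmetricRook_basePositions.block_lt c.mem'

theorem lt_of_block_lt {r s : Idx ty n} (h : P.blockNumber ty r < P.blockNumber ty s) : r < s := by
  by_contra hcon
  exact absurd (P.blockNumber_mono (not_lt.1 hcon)) (not_le.2 h)

theorem yz (c : IsChain q x y z w) : y < z := by
  have := entry_lt c.root
  rwa [c.occ_root] at this

theorem block_of_mem (c : IsChain q x y z w) {t : Idx ty n} (hyt : y ≤ t) (htz : t ≤ z) :
    P.blockNumber ty t = P.blockNumber ty y :=
  le_antisymm ((P.blockNumber_mono htz).trans c.block_eq.ge) (P.blockNumber_mono hyt)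

theorem clear_columns (c : IsChain q x y z w) :
    ∀ r s, (r, s) ∈ basePositions K ty P → x < r → y < s → s ≤ z → False :=
  symmetricRook_basePositions.clear_columns c.mem c.block_eq c.clear

theorem clear_rows (c : IsChain q x y z w) :
    ∀ r s, (r, s) ∈ basePositions K ty P → s < w → y ≤ r → r < z → False :=
  symmetricRook_basePositions.clear_rows c.mem' c.block_eq c.clear'

/-- The entries of the sum `L_φ` are the pairs of positions `(x, t)`, `(t, w)`. -/
theorem condition_iff (c : IsChain q x y z w) {γ γ' : Weight n} (hγ : γ ∈ nilRoots K ty P)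
    (hγ' : γ' ∈ nilRoots K ty P) :
    (∃ α₁ ∈ insert 0 (Weight.vec '' summationSet K ty P),
        ∃ α₂ ∈ insert 0 (Weight.vec '' summationSet K ty P),
          α₁ + α₂ = q.α.vec ∧ γ.vec = q.ξ.vec + α₁ ∧ γ'.vec = α₂ + q.ξ'.vec) ↔
      ∃ t ∈ Finset.Icc y z, Occupies γ x t ∧ Occupies γ' t w := by
  have hvξ := c.occ.vec_eq (Or.inl (base_posRoots q.ξ_mem))
  have hvξ' : q.ξ'.vec = labelWeight z - labelWeight w := by
    rw [vec_eq_entry (Or.inl (base_posRoots q.ξ'_mem)), c.entry']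
  have hvα : q.α.vec = labelWeight y - labelWeight z := by
    rw [vec_eq_entry c.root, c.occ_root]
  have hxy := lt_of_block_lt c.block_lt
  have hzw := lt_of_block_lt c.block_lt'
  have hyz := c.yz
  have hr := Or.inl (b := ∃ i, γ = .double i) hγ.1
  have hr' := Or.inl (b := ∃ i, γ' = .double i) hγ'.1
  rw [hvξ, hvξ', hvα]
  constructor
  · have hΛ : ∀ α ∈ insert 0 (Weight.vec '' summationSet K ty P), α = 0 ∨
        ∃ s s' : Idx ty n, s < s' ∧ α = labelWeight s - labelWeight s' := by
      rintro α (h | ⟨δ, hδ, rfl⟩)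
      · exact Or.inl h
      · have := isRoot_of_mem_summationSet hδ
        exact Or.inr ⟨_, _, entry_lt this, vec_eq_entry this⟩
    rintro ⟨α₁, h₁, α₂, h₂, hsum, hv, hv'⟩
    -- It suffices to write `α₁` as the weight at `(y, t)` with `t` in the window; the positions of
    -- both factors are then forced.
    have finish : ∀ t, y ≤ t → t ≤ z → α₁ = labelWeight y - labelWeight t →
        ∃ t ∈ Finset.Icc y z, Occupies γ x t ∧ Occupies γ' t w := by
      intro t h3 h4 h5
      refine ⟨t, Finset.mem_Icc.2 ⟨h3, h4⟩, occupies_of_vec_eq hr (hv.trans ?_),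
        occupies_of_vec_eq hr' (hv'.trans ?_)⟩
      · rw [h5]
        ring
      · rw [h5] at hsum
        linear_combination hsum
    rcases hΛ α₁ h₁ with rfl | ⟨s, s', hs, e₁⟩
    · exact finish y le_rfl hyz.le (by ring)
    rcases hΛ α₂ h₂ with rfl | ⟨p, p', hp, e₂⟩
    · exact finish z hyz.le le_rfl (by rw [← hsum]; ring)
    -- the second term contains the label `y`
    have second : ∀ τ, y < τ → τ < z → α₁ = labelWeight τ - labelWeight z →
        ∃ t ∈ Finset.Icc y z, Occupies γ x t ∧ Occupies γ' t w := by
      intro τ h3 h4 h5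
      -- Here `α₁` sits at the end `(τ, z)` of the window, and `ξ + α₁` must still be a weight with
      -- only two labels. Since `x` cannot cancel `τ` by `c.clear`, the labels `y` and `z` must
      -- cancel. So `(y, z)` is on the antidiagonal, and reflecting `(τ, z)` gives `(y, τ.rev)`.
      have key : ∀ g₁ g₂ : Idx ty n, g₁ < g₂ → γ.vec = labelWeight g₁ - labelWeight g₂ →
          x = g₁ → z = y.rev := by
        rintro g₁ g₂ - h7 rfl
        have h8 : labelWeight y + labelWeight z = labelWeight τ + labelWeight g₂ := by
          rw [h5] at hv
          linear_combination hv - h7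
        rcases cases_of_sum₄ h8 with ⟨h9, -⟩ | ⟨h9, h10⟩ | ⟨h9, -⟩
        · exact absurd h9 h3.ne
        · exact absurd h10 h4.ne'
        · rw [h9, Fin.rev_rev]
      have hzy : z = y.rev := by
        have h6 : labelWeight x + labelWeight τ + labelWeight (γ.entry ty).2 =
            labelWeight y + labelWeight z + labelWeight (γ.entry ty).1 := by
          rw [vec_eq_entry hr, h5] at hv
          linear_combination -hv
        rcases cases_of_sum₆ h6 with ⟨h7, -⟩ | ⟨h7, -⟩ | ⟨h7, -⟩ | ⟨h7, -⟩ | ⟨h7, -⟩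
        · exact absurd h7 hxy.ne
        · exact absurd h7 (hxy.trans hyz).ne
        · exact key _ _ (entry_lt hr) (vec_eq_entry hr) h7
        · exfalso
          refine c.clear ⟨?_, ?_⟩
          · rw [h7, Fin.rev_rev]
            exact h3
          · rw [h7, Fin.rev_rev]
            exact c.block_of_mem h3.le h4.le
        · exact key _ _ (Fin.rev_lt_rev.2 (entry_lt hr))
            ((occupies_entry γ).reflect.vec_eq hr) h7
      refine finish τ.rev ?_ ?_ ?_
      · rw [← Fin.rev_le_rev, Fin.rev_rev, ← hzy]
        exact h4.le
      · rw [hzy]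
        exact Fin.rev_le_rev.2 h3.le
      · rw [h5, hzy, labelWeight_rev, labelWeight_rev]
        ring
    -- The label `y` of `α_q` comes from `α₁` or from `α₂`, directly or through a reflected
    -- position. If it comes from `α₁` the split is already in the right order, and otherwise
    -- `second` applies.
    rw [e₁, e₂] at hsum
    have h6 : labelWeight y + labelWeight s' + labelWeight p' =
        labelWeight s + labelWeight p + labelWeight z := by linear_combination -hsum
    rcases cases_of_sum₆ h6 with ⟨h7, h8⟩ | ⟨h7, h8⟩ | ⟨h7, -⟩ | ⟨h7, h8⟩ | ⟨h7, h8⟩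
    · subst h7
      rcases cases_of_sum₄ h8 with ⟨h9, h10⟩ | ⟨h9, h10⟩ | ⟨h9, h10⟩
      · refine finish s' hs.le ?_ e₁
        rw [h9, ← h10]
        exact hp.le
      · exact absurd h10 hp.ne'
      · refine finish s' hs.le ?_ e₁
        rw [h9, ← Fin.rev_rev z, ← h10]
        exact Fin.rev_le_rev.2 hp.le
    · subst h7
      rcases cases_of_sum₄ h8 with ⟨h9, h10⟩ | ⟨h9, h10⟩ | ⟨h9, h10⟩
      · exact absurd h9 hs.ne'
      · refine second s ?_ ?_ (by rw [e₁, h9])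
        · rw [← h10]
          exact hp
        · rw [← h9]
          exact hs
      · refine second s'.rev ?_ ?_ (by rw [e₁, h10, labelWeight_rev, labelWeight_rev]; ring)
        · rw [h9, Fin.rev_rev]
          exact hp
        · rw [← Fin.rev_lt_rev, Fin.rev_rev, ← h10]
          exact hs
    · exact absurd h7 hyz.ne
    · have h9 : labelWeight p' + labelWeight s.rev = labelWeight p + labelWeight z := by
        rw [labelWeight_rev]
        linear_combination h8
      have e₁' : α₁ = labelWeight y - labelWeight s.rev := by
        rw [e₁, h7, labelWeight_rev, labelWeight_rev]
        ring
      have hys : y ≤ s.rev := by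
        rw [h7]
        exact Fin.rev_le_rev.2 hs.le
      rcases cases_of_sum₄ h9 with ⟨h10, -⟩ | ⟨h10, h11⟩ | ⟨h10, h11⟩
      · exact absurd h10 hp.ne'
      · refine finish s.rev hys ?_ e₁'
        rw [h11, ← h10]
        exact hp.le
      · refine finish s.rev hys ?_ e₁'
        rw [Fin.rev_rev] at h10
        rw [← Fin.rev_rev z, ← h11, ← h10]
        exact Fin.rev_le_rev.2 hp.le
    · have h9 : labelWeight s' + labelWeight p.rev = labelWeight s + labelWeight z := by
        rw [labelWeight_rev]
        linear_combination h8
      have hyp : y < p.rev := by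
        rw [h7]
        exact Fin.rev_lt_rev.2 hp
      rcases cases_of_sum₄ h9 with ⟨h10, -⟩ | ⟨h10, h11⟩ | ⟨h10, h11⟩
      · exact absurd h10 hs.ne'
      · refine second s (h11 ▸ hyp) (h10 ▸ hs) ?_
        rw [e₁, h10]
      · rw [Fin.rev_rev] at h10
        refine second p.rev hyp ?_ ?_
        · rw [← h10, ← Fin.rev_rev z, ← h11]
          exact Fin.rev_lt_rev.2 hs
        · rw [e₁, h10, h11, labelWeight_rev, labelWeight_rev]
          ring
  · rintro ⟨t, ht, ho, ho'⟩
    rw [Finset.mem_Icc] at ht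
    have hmem : ∀ r s : Idx ty n, r ≤ s → P.blockNumber ty r = P.blockNumber ty s →
        labelWeight r - labelWeight s ∈ insert 0 (Weight.vec '' summationSet K ty P) := by
      intro r s hrs hb
      rcases hrs.eq_or_lt with rfl | hrs
      · exact Or.inl (sub_self _)
      · obtain ⟨δ, hδ, hδr, hδo⟩ := exists_mem_summationSet (K := K) (P := P) hrs hb
        exact Or.inr ⟨δ, hδ, hδo.vec_eq hδr⟩
    have hbt := c.block_of_mem ht.1 ht.2
    refine ⟨_, hmem y t ht.1 hbt.symm, _, hmem t z ht.2 (hbt.trans c.block_eq), by ring, ?_, ?_⟩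
    · rw [ho.vec_eq hr]
      ring
    · rw [ho'.vec_eq hr']
      ring

end IsChain

end Chains

/-! ### The polynomials of admissible pairs as sums over a window. -/

section Sums

variable {K : Type*} [Field K] {ty : ClassicalType} {n : ℕ} {P : BlockSizes n}

theorem Occupies.right_unique {γ : Weight n} {x t t' : Idx ty n} (h : Occupies γ x t)
    (h' : Occupies γ x t') : t' = t := by
  rcases h.eq_or_eq h' with ⟨-, h1⟩ | ⟨h1, h2⟩
  · exact h1
  · rw [h2, h1, Fin.rev_rev]

namespace IsChain

variable {q : AdmissiblePair K ty P} {x y z w : Idx ty n}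

/-- The only obstruction is an antidiagonal position for an orthogonal group. At `t = y` it
contradicts `(x, y)` being a position of the base, and at later `t` it contradicts `c.clear`. -/
theorem exists_left (c : IsChain q x y z w) {t : Idx ty n} (ht : t ∈ Finset.Icc y z) :
    ∃ γ ∈ nilRoots K ty P, Occupies γ x t := by
  rw [Finset.mem_Icc] at ht
  have hb := c.block_of_mem ht.1 ht.2
  have hlt : P.blockNumber ty x < P.blockNumber ty t := hb ▸ c.block_lt
  obtain ⟨γ, hγ, ho⟩ := exists_occupies (lt_of_block_lt hlt) (by
    rintro rfl
    rcases ht.1.eq_or_lt with h | h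
    · exact symmetricRook_basePositions.anti_of_mem (h ▸ c.mem)
    · exact absurd ⟨h, hb⟩ c.clear)
  exact ⟨γ, ho.mem_nilRoots_iff.2 ⟨hγ, hlt⟩, ho⟩

theorem exists_right (c : IsChain q x y z w) {t : Idx ty n} (ht : t ∈ Finset.Icc y z) :
    ∃ γ ∈ nilRoots K ty P, Occupies γ t w := by
  rw [Finset.mem_Icc] at ht
  have hb := (c.block_of_mem ht.1 ht.2).trans c.block_eq
  have hlt : P.blockNumber ty t < P.blockNumber ty w := hb ▸ c.block_lt'
  obtain ⟨γ, hγ, ho⟩ := exists_occupies (lt_of_block_lt hlt) (by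
    rintro h
    obtain rfl : w.rev = t := by rw [h, Fin.rev_rev]
    rcases ht.2.eq_or_lt with h' | h'
    · have := c.mem'
      rw [← h'] at this
      exact symmetricRook_basePositions.anti_of_mem (r := w.rev) (by rwa [Fin.rev_rev])
    · exact absurd ⟨h', hb⟩ c.clear')
  exact ⟨γ, ho.mem_nilRoots_iff.2 ⟨hγ, hlt⟩, ho⟩

/-- In both shapes of chain the entry of a root at `(t, w)` is `(t, w)` itself: the reflected
alternative would put `t` in the upper half, or force `w` not to lie beyond the central block. -/
theorem minorMBar_right (c : IsChain q x y z w) {t : Idx ty n} (ht : t ∈ Finset.Icc y z)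
    {γ : Weight n} (hγ : γ ∈ nilRoots K ty P) (ho : Occupies γ t w) :
    minorMBar K ty P γ =
      pivotMinor (basePositions K ty P) (formalMatrix K ty P) t w := by
  rw [Finset.mem_Icc] at ht
  have hb := c.block_of_mem ht.1 ht.2
  rw [minorMBar_eq hγ.1]
  rcases ho with ho | ho
  · rw [ho]
  · exfalso
    have h1 := (entry_spec hγ.1).2.1
    have h2 := entry_snd_rev_lt (ty := ty) γ
    rw [ho] at h1 h2
    rw [Fin.rev_rev] at h1 h2
    rcases c.shape with ⟨-, h3⟩ | ⟨-, h3, -⟩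
    · exact absurd (h3.trans (show (y : ℕ) ≤ t from ht.1)) (not_le.2 h2)
    · have h4 := P.blockNumber_mono (a := t) (b := w.rev) h1
      have h5 := c.block_lt'
      have h6 := c.block_eq
      rw [P.blockNumber_rev] at h4
      omega

/-- The point is that one sign serves the whole window. In the first shape `M_γ` is the minor at the
reflection of `(x, t)`; the sign is constant since the south-west set does not change and the labels
`t` all lie in the lower half. In the second shape `M_γ` is the minor at `(x, t)` itself. -/
theorem exists_sign (c : IsChain q x y z w) : ∃ σ : ℤ, σ * σ = 1 ∧
    ∀ t ∈ Finset.Icc y z, ∀ γ ∈ nilRoots K ty P, Occupies γ x t → minorM K ty P γ =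
      (σ : CoordRing K ty P) *
        pivotMinor (basePositions K ty P) (formalMatrix K ty P) x t := by
  have hF := symmetricRook_basePositions (K := K) (ty := ty) (P := P)
  rcases c.shape with ⟨h1, h2⟩ | ⟨h1, h2, -⟩
  · refine ⟨reflectSign (basePositions K ty P) x y, reflectSign_mul_self _ _ _, ?_⟩
    intro t ht γ hγ ho
    rw [Finset.mem_Icc] at ht
    have he : γ.entry ty = (x, t) := by
      rcases ho with ho | ho
      · exact ho
      · have h3 : γ.entry ty = (t.rev, x.rev) := ho
        have h4 : x.rev.rev ≤ t.rev := by
          have := (entry_spec hγ.1).2.1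
          rwa [h3] at this
        have h5 : y.rev ≤ x := by
          have := (entry_spec (base_posRoots q.ξ_mem)).2.1
          rwa [h1] at this
        rw [Fin.rev_rev] at h4
        have h6 : x = t.rev := le_antisymm h4 ((Fin.rev_le_rev.2 ht.1).trans h5)
        rw [h3, h6, Fin.rev_rev]
    have hsw : southWest (basePositions K ty P) t.rev x.rev =
        southWest (basePositions K ty P) y.rev x.rev := by
      rw [southWest_reflect hF, southWest_reflect hF,
        southWest_eq_of_clear hF c.mem c.clear_columns ht.1 ht.2]
    rw [minorM_eq hγ.1, he, pivotMinor_reflect hF (X := formalMatrix K ty P) (matrixOf_mem _).1 x t,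
      reflectSign_eq hsw (h2.trans (show (y : ℕ) ≤ t from ht.1)) h2, ← mul_assoc,
      ← Int.cast_mul, reflectSign_mul_self, Int.cast_one, one_mul]
  · refine ⟨1, one_mul _, ?_⟩
    intro t ht γ hγ ho
    rw [Finset.mem_Icc] at ht
    have he : γ.entry ty = (t.rev, x.rev) := by
      rcases ho with ho | ho
      · exfalso
        have h4 : t.rev ≤ x := by
          have := (entry_spec hγ.1).2.1
          rwa [ho] at this
        have h5 := P.blockNumber_mono h4
        have h6 := c.block_lt
        have h7 := c.block_of_mem ht.1 ht.2
        rw [P.blockNumber_rev] at h5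
        omega
      · exact ho
    rw [minorM_eq hγ.1, he, Fin.rev_rev, Fin.rev_rev, Int.cast_one, one_mul]

/-- Each label `t` of the window contributes exactly one pair of roots, since a position in the
nilradical is occupied by only one root. -/
theorem polyL_eq_sum (c : IsChain q x y z w) : ∃ σ : ℤ, σ * σ = 1 ∧ polyL K ty P q =
    (σ : CoordRing K ty P) * ∑ t ∈ Finset.Icc y z,
      pivotMinor (basePositions K ty P) (formalMatrix K ty P) x t *
        pivotMinor (basePositions K ty P) (formalMatrix K ty P) t w := by
  classical
  obtain ⟨σ, hσ, h⟩ := c.exists_sign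
  refine ⟨σ, hσ, ?_⟩
  have hterm : ∀ γ γ' : nilRoots K ty P,
      (if (∃ α₁ ∈ insert 0 (Weight.vec '' summationSet K ty P),
        ∃ α₂ ∈ insert 0 (Weight.vec '' summationSet K ty P),
          α₁ + α₂ = q.α.vec ∧ γ.1.vec = q.ξ.vec + α₁ ∧ γ'.1.vec = α₂ + q.ξ'.vec)
      then minorM K ty P γ.1 * minorMBar K ty P γ'.1 else 0) =
      ∑ t ∈ Finset.Icc y z, if Occupies γ.1 x t ∧ Occupies γ'.1 t w then
        minorM K ty P γ.1 * minorMBar K ty P γ'.1 else 0 := by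
    intro γ γ'
    rw [if_congr (c.condition_iff γ.2 γ'.2) rfl rfl]
    split_ifs with hc
    · obtain ⟨t, ht, ho⟩ := hc
      rw [Finset.sum_eq_single t, if_pos ho]
      · intro t' _ hne
        rw [if_neg]
        exact fun ho' => hne (ho.1.right_unique ho'.1)
      · exact fun h => absurd ht h
    · symm
      refine Finset.sum_eq_zero fun t ht => if_neg fun ho => hc ⟨t, ht, ho⟩
  have hstart : polyL K ty P q = ∑ γ : nilRoots K ty P, ∑ γ' : nilRoots K ty P,
      ∑ t ∈ Finset.Icc y z, if Occupies γ.1 x t ∧ Occupies γ'.1 t w then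
        minorM K ty P γ.1 * minorMBar K ty P γ'.1 else 0 := by
    unfold polyL
    refine Finset.sum_congr rfl fun γ _ => Finset.sum_congr rfl fun γ' _ => ?_
    rw [← hterm]
  rw [hstart, Finset.sum_congr rfl fun γ _ => Finset.sum_comm, Finset.sum_comm, Finset.mul_sum]
  refine Finset.sum_congr rfl fun t ht => ?_
  obtain ⟨γ, hγ, ho⟩ := c.exists_left ht
  obtain ⟨γ', hγ', ho'⟩ := c.exists_right ht
  rw [Finset.sum_eq_single (⟨γ, hγ⟩ : nilRoots K ty P),
    Finset.sum_eq_single (⟨γ', hγ'⟩ : nilRoots K ty P), if_pos ⟨ho, ho'⟩, h t ht γ hγ ho,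
    c.minorMBar_right ht hγ' ho', mul_assoc]
  · intro δ _ hδ
    exact if_neg fun h' => hδ (Subtype.ext (Occupies.unique δ.2.1 hγ'.1 h'.2 ho'))
  · simp
  · intro δ _ hδ
    exact Finset.sum_eq_zero fun _ _ =>
      if_neg fun h' => hδ (Subtype.ext (Occupies.unique δ.2.1 hγ.1 h'.1 ho))
  · simp

end IsChain

end Sums

/-! ### Invariance under `N`, checked over the function field. -/

section Invariance

variable {K : Type*} [Field K] {ty : ClassicalType} {n : ℕ} {P : BlockSizes n}

theorem staircase_of_mem {A : Type*} [CommRing A] {X : Matrix (Idx ty n) (Idx ty n) A}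
    (hX : X ∈ nilradical A ty P) : Staircase (P.blockNumber ty) (ty = .symplectic) X where
  zero := hX.2
  skew hty i j := by
    have := (mem_lieAlg_iff X).1 hX.1 i j
    simp only [rowSign, hty, false_and, if_false, one_mul] at this
    linear_combination this

theorem map_mem_nilradical {A B : Type*} [CommRing A] [CommRing B] (φ : A →+* B)
    {X : Matrix (Idx ty n) (Idx ty n) A} (hX : X ∈ nilradical A ty P) :
    X.map φ ∈ nilradical B ty P := by
  refine ⟨?_, fun i j h => by rw [Matrix.map_apply, hX.2 i j h, map_zero]⟩
  have h := hX.1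
  rw [mem_lieAlg_iff] at h ⊢
  intro a b
  have hs : ∀ v : Idx ty n, φ (rowSign A ty v) = rowSign B ty v := by
    intro v
    unfold rowSign
    split_ifs <;> simp
  rw [← hs, ← hs, Matrix.map_apply, Matrix.map_apply, ← map_mul, ← map_mul, ← map_add, h, map_zero]

variable [CharZero K]

/-- The rank arguments need a field, so the generic matrix and its transform are moved to the
function field. `G` and `H` are the scalar matrices of `g` and its inverse. -/
theorem generic_conjugation {g : GL (Idx ty n) K} (hg : g ∈ unipotentRadical K ty n) :
    ∃ (X' : Matrix (Idx ty n) (Idx ty n) (FunctionField K ty P))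
      (G H : Matrix (Idx ty n) (Idx ty n) (FunctionField K ty P)),
      X' = ((formalMatrix K ty P).map (adPoly K ty P g : CoordRing K ty P →+* CoordRing K ty P)).map
        (algebraMap (CoordRing K ty P) (FunctionField K ty P)) ∧
      Staircase (P.blockNumber ty) (ty = .symplectic) X' ∧ UpperUnitriangular G ∧
      UpperUnitriangular H ∧ G * H = 1 ∧ G * X' = (formalMatrix K ty P).map
        (algebraMap (CoordRing K ty P) (FunctionField K ty P)) * G := by
  have hu : ∀ a ∈ unipotentRadical K ty n, UpperUnitriangular
      ((a.val.map (algebraMap K (CoordRing K ty P))).map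
        (algebraMap (CoordRing K ty P) (FunctionField K ty P))) := by
    intro a ha
    constructor
    · intro i j h
      rw [Matrix.map_apply, Matrix.map_apply, ha.2.1 i j h, map_zero, map_zero]
    · intro i
      rw [Matrix.map_apply, Matrix.map_apply, ha.2.2 i, map_one, map_one]
  have hgh : g.val.map (algebraMap K (CoordRing K ty P)) *
      (g⁻¹).val.map (algebraMap K (CoordRing K ty P)) = 1 := by
    rw [← Matrix.map_mul, ← Units.val_mul, mul_inv_cancel, Units.val_one,
      Matrix.map_one _ (map_zero _) (map_one _)]
  refine ⟨_, _, _, rfl, staircase_of_mem (map_mem_nilradical _ (map_mem_nilradical _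
    (matrixOf_mem _))), hu g hg, hu g⁻¹ (inv_mem hg), ?_, ?_⟩
  · rw [← Matrix.map_mul, hgh, Matrix.map_one _ (map_zero _) (map_one _)]
  · rw [← Matrix.map_mul, ← Matrix.map_mul]
    congr 1
    have := map_adPoly_formalMatrix (P := P) hg
    refine (congrArg (g.val.map (algebraMap K (CoordRing K ty P)) * ·) this).trans ?_
    simp only [← Matrix.mul_assoc]
    rw [hgh, Matrix.one_mul]

theorem two_ne_zero_functionField : (2 : FunctionField K ty P) ≠ 0 := by
  have : algebraMap K (FunctionField K ty P) 2 ≠ 0 := by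
    rw [Ne, FaithfulSMul.algebraMap_eq_zero_iff]
    exact two_ne_zero
  rwa [map_ofNat] at this

/-- `Ad_g` is a ring homomorphism, so it carries a minor of the generic matrix to the same minor of
the transformed matrix. -/
theorem pivotMinor_mem_invariantRing {x y : Idx ty n} (hxy : (x, y) ∈ basePositions K ty P) :
    pivotMinor (basePositions K ty P) (formalMatrix K ty P) x y ∈ invariantRing K ty P := by
  intro g hg
  obtain ⟨X', G, H, hX', hs, hG, -, -, h⟩ := generic_conjugation (P := P) hg
  apply IsFractionRing.injective (CoordRing K ty P) (FunctionField K ty P)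
  have h1 := map_pivotMinor (adPoly K ty P g : CoordRing K ty P →+* CoordRing K ty P)
    (basePositions K ty P) (formalMatrix K ty P) x y
  rw [RingHom.coe_coe] at h1 hX'
  rw [h1, map_pivotMinor, map_pivotMinor, ← hX']
  exact pivotMinor_invariant two_ne_zero_functionField symmetricRook_basePositions
    (staircase_of_mem (map_mem_nilradical _ (matrixOf_mem _))) hs hG h hxy

theorem minorM_mem_invariantRing {ξ : Weight n} (hξ : ξ ∈ base K ty P) :
    minorM K ty P ξ ∈ invariantRing K ty P := by
  rw [minorM_eq (base_posRoots hξ)]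
  exact pivotMinor_mem_invariantRing (mem_basePositions.2 ⟨ξ, hξ, (occupies_entry ξ).reflect⟩)

theorem polyL_mem_invariantRing (q : AdmissiblePair K ty P) :
    polyL K ty P q ∈ invariantRing K ty P := by
  obtain ⟨x, y, z, w, c⟩ := exists_isChain q
  obtain ⟨σ, -, h⟩ := c.polyL_eq_sum
  rw [h]
  refine mul_mem (intCast_mem _ _) fun g hg => ?_
  obtain ⟨X', G, H, hX', hs, hG, hH, hGH, h⟩ := generic_conjugation (P := P) hg
  apply IsFractionRing.injective (CoordRing K ty P) (FunctionField K ty P)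
  have h1 := map_pivotMinor (adPoly K ty P g : CoordRing K ty P →+* CoordRing K ty P)
    (basePositions K ty P) (formalMatrix K ty P)
  simp only [RingHom.coe_coe] at h1
  simp only [map_sum, map_mul, h1, map_pivotMinor]
  simp only [RingHom.coe_coe] at hX'
  rw [← hX']
  exact sum_pivotMinor_invariant two_ne_zero_functionField symmetricRook_basePositions
    (staircase_of_mem (map_mem_nilradical _ (matrixOf_mem _))) hs hG hH hGH h c.mem c.mem'
    c.clear_columns c.clear_rows

end Invariance

/-! ### The Jacobian criterion, evaluated at one point through dual numbers. -/

section Jacobian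

variable {K : Type*} [Field K]

/-- A kernel vector vanishes coordinate by coordinate, by induction on `key`. The key need not be
injective, because entries between different indices with equal key are required to vanish. -/
theorem det_ne_zero_of_triangular {ι : Type*} [Fintype ι] [DecidableEq ι] {N : Matrix ι ι K}
    (key : ι → ℕ) (hdiag : ∀ i, N i i ≠ 0) (hoff : ∀ i j, i ≠ j → key i ≤ key j → N i j = 0) :
    N.det ≠ 0 := by
  intro hdet
  obtain ⟨v, hv, h⟩ := Matrix.exists_mulVec_eq_zero_iff.2 hdet
  apply hv
  suffices hk : ∀ k i, key i = k → v i = 0 from funext fun i => hk _ i rfl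
  intro k
  induction k using Nat.strong_induction_on with
  | _ k ih =>
  rintro i rfl
  have h1 := congrFun h i
  rw [Matrix.mulVec, dotProduct, Finset.sum_eq_single i] at h1
  · exact (mul_eq_zero.1 h1).resolve_left (hdiag i)
  · intro j _ hj
    rcases le_or_gt (key i) (key j) with h2 | h2
    · rw [hoff i j hj.symm h2, zero_mul]
    · rw [ih _ h2 j rfl, mul_zero]
  · simp

theorem pderiv_aeval {ι σ : Type*} [Fintype ι] (f : ι → MvPolynomial σ K) (v : σ)
    (p : MvPolynomial ι K) :
    pderiv v (aeval f p) = ∑ i, aeval f (pderiv i p) * pderiv v (f i) := by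
  classical
  induction p using MvPolynomial.induction_on with
  | C a => simp [MvPolynomial.algebraMap_eq]
  | add p q hp hq => simp only [map_add, hp, hq, add_mul, Finset.sum_add_distrib]
  | mul_X p i hp =>
    simp only [map_mul, aeval_X, pderiv_mul, hp, map_add, add_mul, Finset.sum_add_distrib,
      Finset.sum_mul]
    congr 1
    · exact Finset.sum_congr rfl fun _ _ => by ring
    · rw [Finset.sum_eq_single i]
      · simp
      · intro j _ hj
        simp [hj]
      · simp

/-- The Jacobian criterion for algebraic independence. -/
theorem algebraicIndependent_of_jacobian [CharZero K] {ι σ : Type*} [Fintype ι] [DecidableEq ι]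
    (f : ι → MvPolynomial σ K) (v : ι → σ)
    (h : (Matrix.of fun i j => pderiv (v j) (f i)).det ≠ 0) : AlgebraicIndependent K f := by
  rw [algebraicIndependent_iff]
  have hconst : ∀ p : MvPolynomial ι K, (∀ s, coeff s p ≠ 0 → s.degree ≤ 0) → aeval f p = 0 →
      p = 0 := by
    intro p hp h0
    have hC : p = C (coeff 0 p) := by
      ext s
      rw [coeff_C]
      split_ifs with hs
      · rw [hs]
      · by_contra h1
        exact hs ((Finsupp.degree_eq_zero_iff s).1 (Nat.le_zero.1 (hp s h1))).symm
    rw [hC, aeval_C, MvPolynomial.algebraMap_eq, C_eq_zero] at h0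
    rw [hC, h0, C_0]
  suffices hN : ∀ N : ℕ, ∀ p : MvPolynomial ι K, (∀ s, coeff s p ≠ 0 → s.degree ≤ N) →
      aeval f p = 0 → p = 0 from fun p hp => hN p.totalDegree p (fun s hs =>
        le_totalDegree (mem_support_iff.2 hs)) hp
  intro N
  induction N with
  | zero => exact hconst
  | succ N ih =>
    intro p hp h0
    -- Differentiating the relation shows that the partial derivatives of `p`, evaluated at `f`, are
    -- annihilated by the Jacobian matrix. They are themselves relations of lower degree, hence zero
    -- by induction.
    have hzero : ∀ i, pderiv i p = 0 := by
      intro i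
      refine ih _ (fun s hs => ?_) ?_
      · rw [coeff_pderiv] at hs
        have h1 := hp _ (left_ne_zero_of_mul hs)
        rw [map_add, Finsupp.degree_single] at h1
        omega
      · have h1 : Matrix.vecMul (fun i => aeval f (pderiv i p))
            (Matrix.of fun i j => pderiv (v j) (f i)) = 0 := by
          ext1 j
          rw [Matrix.vecMul, dotProduct]
          simp only [Matrix.of_apply]
          rw [← pderiv_aeval, h0, map_zero]
          rfl
        exact congrFun (Matrix.eq_zero_of_vecMul_eq_zero h h1) i
    refine hconst p (fun s hs => ?_) h0
    by_contra h1
    obtain ⟨i, hi⟩ : ∃ i, s i ≠ 0 := by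
      by_contra h2
      push Not at h2
      exact h1 (by rw [show s = 0 from Finsupp.ext h2, map_zero])
    -- In characteristic zero a monomial of positive degree survives in some partial derivative, so
    -- `p` is constant.
    have h2 := coeff_pderiv (i := i) p (s - Finsupp.single i 1)
    rw [hzero i, coeff_zero, tsub_add_cancel_of_le (Finsupp.single_le_iff.2 (by omega))] at h2
    have h3 : (((s - Finsupp.single i 1 : ι →₀ ℕ) i : K) + 1) ≠ 0 := by
      exact Nat.cast_add_one_ne_zero _
    exact mul_ne_zero hs h3 h2.symm

open Classical in
/-- Evaluation at `a + ε e_v`. -/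
noncomputable def dualEval {σ : Type*} (a : σ → K) (v : σ) : MvPolynomial σ K →ₐ[K] DualNumber K :=
  aeval fun s => TrivSqZeroExt.inl (a s) + if s = v then DualNumber.eps else 0

theorem fst_dualEval {σ : Type*} (a : σ → K) (v : σ) (f : MvPolynomial σ K) :
    (dualEval a v f).fst = eval a f := by
  induction f using MvPolynomial.induction_on with
  | C r => simp [dualEval, TrivSqZeroExt.algebraMap_eq_inl]
  | add p q hp hq => simp [hp, hq]
  | mul_X p i hp =>
    rw [map_mul, TrivSqZeroExt.fst_mul, hp, map_mul, eval_X, dualEval, aeval_X]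
    split_ifs <;> simp

theorem snd_dualEval {σ : Type*} (a : σ → K) (v : σ) (f : MvPolynomial σ K) :
    (dualEval a v f).snd = eval a (pderiv v f) := by
  classical
  induction f using MvPolynomial.induction_on with
  | C r => simp [dualEval, TrivSqZeroExt.algebraMap_eq_inl]
  | add p q hp hq => simp [hp, hq]
  | mul_X p i hp =>
    rw [map_mul, DualNumber.snd_mul, hp, fst_dualEval, pderiv_mul, map_add, map_mul, map_mul,
      eval_X]
    have h1 := fst_dualEval a v (X i)
    rw [eval_X] at h1
    rw [h1, dualEval, aeval_X, pderiv_X]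
    by_cases h : i = v
    · subst h
      simp
      ring
    · simp [h]

/-- A Jacobian determinant that is nonzero at a single point `a` is a nonzero polynomial, so
triangularity at `a` is enough. -/
theorem algebraicIndependent_of_dualEval [CharZero K] {ι σ : Type*} [Finite ι]
    (f : ι → MvPolynomial σ K) (v : ι → σ) (a : σ → K) (key : ι → ℕ)
    (hdiag : ∀ i, (dualEval a (v i) (f i)).snd ≠ 0)
    (hoff : ∀ i j, i ≠ j → key i ≤ key j → (dualEval a (v j) (f i)).snd = 0) :
    AlgebraicIndependent K f := by
  classical
  have := Fintype.ofFinite ι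
  refine algebraicIndependent_of_jacobian f v fun h => ?_
  have h1 := congrArg (eval a) h
  rw [RingHom.map_det, map_zero] at h1
  refine det_ne_zero_of_triangular key (fun i => ?_) (fun i j h2 h3 => ?_) h1
  · simpa [snd_dualEval] using hdiag i
  · simpa [snd_dualEval] using hoff i j h2 h3

end Jacobian

/-! ### Values and first-order parts of pivot minors at a point supported on the placement. -/

section DualDeterminants

variable {K : Type*} [Field K]

theorem fst_det {ι : Type*} [Fintype ι] [DecidableEq ι] (N : Matrix ι ι (DualNumber K)) :
    N.det.fst = (Matrix.of fun i j => (N i j).fst).det :=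
  RingHom.map_det (TrivSqZeroExt.fstHom K K K : DualNumber K →+* K) N

theorem snd_det_of_row {ι : Type*} [Fintype ι] [DecidableEq ι] {N : Matrix ι ι (DualNumber K)}
    {i : ι} (h : ∀ j, (N i j).fst = 0) : N.det.snd =
      ((Matrix.of fun i j => (N i j).fst).updateRow i fun j => (N i j).snd).det := by
  -- The row `i` is purely infinitesimal, so `ε` factors out of it, and only the values of the other
  -- entries matter after that.
  have h1 : N = N.updateRow i ((DualNumber.eps : DualNumber K) • fun j =>
      (TrivSqZeroExt.inl (N i j).snd : DualNumber K)) := by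
    refine Matrix.ext fun i' j => ?_
    by_cases hi : i' = i
    · subst hi
      rw [Matrix.updateRow_self]
      ext <;> simp [h]
    · rw [Matrix.updateRow_ne hi]
  conv_lhs => rw [h1]
  rw [Matrix.det_updateRow_smul, DualNumber.snd_mul, DualNumber.fst_eps, DualNumber.snd_eps,
    zero_mul, zero_add, one_mul, fst_det]
  congr 1
  ext i' j
  by_cases hi : i' = i
  · subst hi
    simp
  · simp [Matrix.updateRow_ne hi]

/-- The rows with a single nonzero entry kill every coordinate of a kernel vector except the one at
`j₀`, which the row `i₀` then kills. -/
theorem det_ne_zero_of_pivots {ι : Type*} [Fintype ι] [DecidableEq ι] {N : Matrix ι ι K}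
    {i₀ j₀ : ι} (h₀ : N i₀ j₀ ≠ 0)
    (h : ∀ j, j ≠ j₀ → ∃ i, N i j ≠ 0 ∧ ∀ j', j' ≠ j → N i j' = 0) : N.det ≠ 0 := by
  intro hdet
  obtain ⟨v, hv, hNv⟩ := Matrix.exists_mulVec_eq_zero_iff.2 hdet
  have h1 : ∀ j, j ≠ j₀ → v j = 0 := by
    intro j hj
    obtain ⟨i, h2, h3⟩ := h j hj
    have h4 := congrFun hNv i
    rw [Matrix.mulVec, dotProduct, Finset.sum_eq_single j (fun j' _ h' => by rw [h3 j' h', zero_mul])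
      (by simp)] at h4
    exact (mul_eq_zero.1 h4).resolve_left h2
  have h4 := congrFun hNv i₀
  rw [Matrix.mulVec, dotProduct, Finset.sum_eq_single j₀ (fun j' _ h' => by rw [h1 j' h', mul_zero])
    (by simp)] at h4
  refine hv (funext fun j => ?_)
  by_cases hj : j = j₀
  · rw [hj]
    exact (mul_eq_zero.1 h4).resolve_left h₀
  · exact h1 j hj

variable {m : ℕ} {b : Fin m → ℤ} {anti : Prop} {F : Finset (Fin m × Fin m)}
  {X : Matrix (Fin m) (Fin m) (DualNumber K)}

theorem southWest_pivot_row {x y : Fin m} {k : ℕ}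
    {f : Fin (k + 1) → Fin m} {g : Fin k → Fin m}
    (hfI : ∀ r, r ∈ insert x ((southWest F x y).image Prod.fst) ↔ ∃ i, f i = r)
    (hgJ : ∀ c, c ∈ (southWest F x y).image Prod.snd ↔ ∃ j, g j = c) (j : Fin k) :
    g j < y ∧ ∃ i, x < f i ∧ (f i, g j) ∈ F := by
  obtain ⟨⟨r, c⟩, h, hc⟩ := Finset.mem_image.1 ((hgJ (g j)).2 ⟨j, rfl⟩)
  obtain ⟨i, hi⟩ := (hfI r).1 (Finset.mem_insert_of_mem (Finset.mem_image.2 ⟨_, h, rfl⟩))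
  obtain ⟨h1, h2, h3⟩ := mem_southWest.1 h
  obtain rfl : c = g j := hc
  exact ⟨h3, i, hi ▸ h2, by rwa [hi]⟩

/-- With the entries supported exactly on `F`, the chosen submatrix is monomial. -/
theorem fst_pivotMinor_ne_zero (hF : SymmetricRook b anti F)
    (hX : ∀ r c, (X r c).fst ≠ 0 ↔ (r, c) ∈ F) {x y : Fin m} (hxy : (x, y) ∈ F) :
    (pivotMinor F X x y).fst ≠ 0 := by
  obtain ⟨k, f, g, hf, hg, hfI, hgJ⟩ := exists_pivot_index hF x y
  obtain ⟨i₀, hi₀⟩ := (hfI x).1 (Finset.mem_insert_self _ _)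
  have hsnoc := strictMono_snoc hg fun j => (southWest_pivot_row hfI hgJ j).1
  rw [pivotMinor_eq_det X hf hg hfI hgJ rfl, fst_det]
  refine det_ne_zero_of_pivots (i₀ := i₀) (j₀ := Fin.last k) ?_ ?_
  · simpa [hi₀, hX] using hxy
  · intro j hj
    induction j using Fin.lastCases with
    | last => exact absurd rfl hj
    | cast j =>
      obtain ⟨-, i, -, h⟩ := southWest_pivot_row hfI hgJ j
      refine ⟨i, by simpa [hX] using h, fun j' hj' => ?_⟩
      by_contra h1
      have h2 := hF.row_unique ((hX _ _).1 h1) h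
      exact hj' (hsnoc.injective (h2.trans (Fin.snoc_castSucc (α := fun _ => Fin m) _ _ _).symm))

/-- The only nonzero value in the row `x` stands in the column `y`, which the minor at `(x, t)`
omits. -/
theorem fst_pivotMinor_eq_zero (hF : SymmetricRook b anti F)
    (hX : ∀ r c, (X r c).fst ≠ 0 ↔ (r, c) ∈ F) {x y z t : Fin m} (hxy : (x, y) ∈ F)
    (hclear : ∀ r c, (r, c) ∈ F → x < r → y < c → c ≤ z → False) (hyt : y < t) (htz : t ≤ z) :
    (pivotMinor F X x t).fst = 0 := by
  obtain ⟨k, f, g, hf, hg, hfI, hgJ⟩ := exists_pivot_index hF x y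
  obtain ⟨i₀, hi₀⟩ := (hfI x).1 (Finset.mem_insert_self _ _)
  rw [pivotMinor_eq_det X hf hg hfI hgJ (southWest_eq_of_clear hF hxy hclear hyt.le htz), fst_det]
  refine Matrix.det_eq_zero_of_row_eq_zero i₀ fun j => ?_
  by_contra h1
  have h2 := hF.row_unique hxy (hi₀ ▸ (hX _ _).1 h1)
  induction j using Fin.lastCases with
  | last => exact hyt.ne (by simpa using h2)
  | cast j => exact (southWest_pivot_row hfI hgJ j).1.ne' (by simpa using h2)

/-- Under `hsnd` the minor is a matrix of constants with the row `x` multiplied by `1 + s ε`. The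
case `s = 1` differentiates in the direction of the pivot itself, and `s = 0` in a direction that
does not meet the corner. -/
theorem snd_pivotMinor_self (hF : SymmetricRook b anti F) {x y : Fin m} {s : K}
    (hsnd : ∀ r c, x ≤ r → c ≤ y → (X r c).snd = if r = x then s * (X r c).fst else 0) :
    (pivotMinor F X x y).snd = s * (pivotMinor F X x y).fst := by
  obtain ⟨k, f, g, hf, hg, hfI, hgJ⟩ := exists_pivot_index hF x y
  obtain ⟨i₀, hi₀⟩ := (hfI x).1 (Finset.mem_insert_self _ _)
  have hfx : ∀ i, x ≤ f i := by
    intro i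
    rcases Finset.mem_insert.1 ((hfI (f i)).2 ⟨i, rfl⟩) with h | h
    · exact h.ge
    · obtain ⟨⟨r, c⟩, h, hr⟩ := Finset.mem_image.1 h
      rw [← hr]
      exact (mem_southWest.1 h).2.1.le
  have hgy : ∀ j, (Fin.snoc g y : Fin (k + 1) → Fin m) j ≤ y := by
    intro j
    induction j using Fin.lastCases with
    | last => simp
    | cast j => simpa using (southWest_pivot_row hfI hgJ j).1.le
  rw [pivotMinor_eq_det X hf hg hfI hgJ rfl, fst_det]
  have h1 : X.submatrix f (Fin.snoc g y) = Matrix.of fun i j =>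
      (if i = i₀ then 1 + TrivSqZeroExt.inr s else 1 : DualNumber K) *
        (Matrix.of fun i j => ((X.submatrix f (Fin.snoc g y)) i j).fst).map
          (TrivSqZeroExt.inlHom K K : K →+* DualNumber K) i j := by
    refine Matrix.ext fun i j => ?_
    have h2 := hsnd (f i) _ (hfx i) (hgy j)
    have h3 : f i = x ↔ i = i₀ := by
      rw [← hi₀]
      exact hf.injective.eq_iff
    rw [if_congr h3 rfl rfl] at h2
    by_cases hi : i = i₀
    · rw [if_pos hi] at h2
      simp only [Matrix.of_apply, if_pos hi]
      ext
      · simp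
      · simp [h2]
    · rw [if_neg hi] at h2
      simp only [Matrix.of_apply, if_neg hi]
      ext
      · simp
      · simp [h2]
  conv_lhs => rw [h1]
  rw [Matrix.det_mul_column, Finset.prod_ite_eq' Finset.univ i₀, if_pos (Finset.mem_univ _),
    ← RingHom.mapMatrix_apply, ← RingHom.map_det, DualNumber.snd_mul]
  simp

/-- The row `x` has zero value in all chosen columns, so to first order it is replaced by its
infinitesimal part. The other rows are pivots for all columns but `z`, and `hclear` keeps `F` out of
the column `z` below `x`, so only the entry at `(x, z)` matters. -/
theorem snd_pivotMinor_ne_zero_iff (hF : SymmetricRook b anti F)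
    (hX : ∀ r c, (X r c).fst ≠ 0 ↔ (r, c) ∈ F) {x y z : Fin m} (hxy : (x, y) ∈ F)
    (hclear : ∀ r c, (r, c) ∈ F → x < r → y < c → c ≤ z → False) (hyz : y < z) :
    (pivotMinor F X x z).snd ≠ 0 ↔ (X x z).snd ≠ 0 := by
  obtain ⟨k, f, g, hf, hg, hfI, hgJ⟩ := exists_pivot_index hF x y
  obtain ⟨i₀, hi₀⟩ := (hfI x).1 (Finset.mem_insert_self _ _)
  have hsnoc := strictMono_snoc hg fun j => (southWest_pivot_row hfI hgJ j).1.trans hyz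
  rw [pivotMinor_eq_det X hf hg hfI hgJ (southWest_eq_of_clear hF hxy hclear hyz.le le_rfl),
    snd_det_of_row (i := i₀)]
  · constructor
    · contrapose!
      intro h0
      refine Matrix.det_eq_zero_of_column_eq_zero (Fin.last k) fun i => ?_
      by_cases hi : i = i₀
      · rw [hi, Matrix.updateRow_self]
        simpa [hi₀] using h0
      · rw [Matrix.updateRow_ne hi]
        by_contra h1
        simp only [Matrix.of_apply, Matrix.submatrix_apply, Fin.snoc_last, hX] at h1
        rcases Finset.mem_insert.1 ((hfI (f i)).2 ⟨i, rfl⟩) with h | h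
        · exact hi (hf.injective (h.trans hi₀.symm))
        · obtain ⟨⟨r, c⟩, h, hr⟩ := Finset.mem_image.1 h
          exact hclear _ _ h1 (by rw [← hr]; exact (mem_southWest.1 h).2.1) hyz le_rfl
    · intro h0
      refine det_ne_zero_of_pivots (i₀ := i₀) (j₀ := Fin.last k) ?_ ?_
      · simpa [hi₀] using h0
      · intro j hj
        induction j using Fin.lastCases with
        | last => exact absurd rfl hj
        | cast j =>
          obtain ⟨-, i, hxi, h⟩ := southWest_pivot_row hfI hgJ j
          have hi : i ≠ i₀ := by
            rintro rfl
            exact hxi.ne' hi₀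
          refine ⟨i, ?_, fun j' hj' => ?_⟩ <;> rw [Matrix.updateRow_ne hi]
          · simpa [hX] using h
          · by_contra h1
            have h2 := hF.row_unique ((hX _ _).1 h1) h
            exact hj' (hsnoc.injective
              (h2.trans (Fin.snoc_castSucc (α := fun _ => Fin m) _ _ _).symm))
  · intro j
    by_contra h1
    have h2 := hF.row_unique hxy (hi₀ ▸ (hX _ _).1 h1)
    induction j using Fin.lastCases with
    | last => exact hyz.ne (by simpa using h2)
    | cast j => exact (southWest_pivot_row hfI hgJ j).1.ne' (by simpa using h2)

end DualDeterminants

/-! ### First-order parts of the sums over a window. -/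

section DualSums

variable {K : Type*} [Field K] {m : ℕ} {b : Fin m → ℤ} {anti : Prop}
  {F : Finset (Fin m × Fin m)} {X : Matrix (Fin m) (Fin m) (DualNumber K)}

theorem fst_antiTranspose_ne_zero_iff (hF : SymmetricRook b anti F)
    (hX : ∀ r c, (X r c).fst ≠ 0 ↔ (r, c) ∈ F) (r c : Fin m) :
    (antiTranspose X r c).fst ≠ 0 ↔ (r, c) ∈ F := by
  refine (hX _ _).trans ⟨fun h => ?_, hF.symm⟩
  simpa using hF.symm h

theorem fst_pivotMinor_eq_zero_of_row (hF : SymmetricRook b anti F)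
    (hX : ∀ r c, (X r c).fst ≠ 0 ↔ (r, c) ∈ F) {y z w t : Fin m} (hzw : (z, w) ∈ F)
    (hclear : ∀ r c, (r, c) ∈ F → c < w → y ≤ r → r < z → False) (hyt : y ≤ t) (htz : t < z) :
    (pivotMinor F X t w).fst = 0 := by
  rw [← pivotMinor_antiTranspose hF]
  refine fst_pivotMinor_eq_zero hF (fst_antiTranspose_ne_zero_iff hF hX) (hF.symm hzw)
    (z := y.rev) (fun r c h h1 h2 h3 => hclear _ _ (hF.symm h) ?_ ?_ ?_)
    (Fin.rev_lt_rev.2 htz) (Fin.rev_le_rev.2 hyt)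
  · rwa [← Fin.rev_lt_rev, Fin.rev_rev]
  · rwa [← Fin.rev_le_rev, Fin.rev_rev]
  · rwa [← Fin.rev_lt_rev, Fin.rev_rev]

theorem snd_pivotMinor_ne_zero_iff_of_row (hF : SymmetricRook b anti F)
    (hX : ∀ r c, (X r c).fst ≠ 0 ↔ (r, c) ∈ F) {y z w : Fin m} (hzw : (z, w) ∈ F)
    (hclear : ∀ r c, (r, c) ∈ F → c < w → y ≤ r → r < z → False) (hyz : y < z) :
    (pivotMinor F X y w).snd ≠ 0 ↔ (X y w).snd ≠ 0 := by
  rw [← pivotMinor_antiTranspose hF, snd_pivotMinor_ne_zero_iff hF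
    (fst_antiTranspose_ne_zero_iff hF hX) (hF.symm hzw) _ (Fin.rev_lt_rev.2 hyz)]
  · simp [antiTranspose]
  · refine fun r c h h1 h2 h3 => hclear _ _ (hF.symm h) ?_ ?_ ?_
    · rwa [← Fin.rev_lt_rev, Fin.rev_rev]
    · rwa [← Fin.rev_le_rev, Fin.rev_rev]
    · rwa [← Fin.rev_lt_rev, Fin.rev_rev]

/-- In the Leibniz rule the value of the first factor vanishes unless `t = y`, and that of the
second vanishes unless `t = z`. -/
theorem snd_sum_pivotMinor (hF : SymmetricRook b anti F)
    (hX : ∀ r c, (X r c).fst ≠ 0 ↔ (r, c) ∈ F) {x y z w : Fin m} (hxy : (x, y) ∈ F)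
    (hzw : (z, w) ∈ F) (hclear : ∀ r c, (r, c) ∈ F → x < r → y < c → c ≤ z → False)
    (hclear' : ∀ r c, (r, c) ∈ F → c < w → y ≤ r → r < z → False) (hyz : y ≤ z) :
    (∑ t ∈ Finset.Icc y z, pivotMinor F X x t * pivotMinor F X t w).snd =
      (pivotMinor F X x y).fst * (pivotMinor F X y w).snd +
        (pivotMinor F X x z).snd * (pivotMinor F X z w).fst := by
  rw [TrivSqZeroExt.snd_sum]
  simp only [DualNumber.snd_mul]
  rw [Finset.sum_add_distrib, Finset.sum_eq_single y, Finset.sum_eq_single z]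
  · intro t ht hne
    rw [Finset.mem_Icc] at ht
    rw [fst_pivotMinor_eq_zero_of_row hF hX hzw hclear' ht.1 (lt_of_le_of_ne ht.2 hne), mul_zero]
  · exact fun h => absurd (Finset.mem_Icc.2 ⟨hyz, le_rfl⟩) h
  · intro t ht hne
    rw [Finset.mem_Icc] at ht
    rw [fst_pivotMinor_eq_zero hF hX hxy hclear (lt_of_le_of_ne ht.1 hne.symm) ht.2, zero_mul]
  · exact fun h => absurd (Finset.mem_Icc.2 ⟨le_rfl, hyz⟩) h

end DualSums

/-! ### The generic matrix at the base point, with a tangent direction given by a root. -/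

section TangentMatrix

variable {K : Type*} [Field K] {ty : ClassicalType} {n : ℕ} {P : BlockSizes n}

theorem matrixOf_of_occupies {A : Type*} [CommRing A] {γ : nilRoots K ty P} {r c : Idx ty n}
    (h : Occupies γ.1 r c) : ∃ s : ℤ, (s = 1 ∨ s = -1) ∧
      ∀ v : nilRoots K ty P → A, matrixOf K ty P v r c = s * v γ := by
  classical
  have hsum : ∀ v : nilRoots K ty P → A, matrixOf K ty P v r c =
      v γ * γ.1.rootVector A ty r c := by
    intro v
    rw [matrixOf_apply, Finset.sum_eq_single γ]
    · intro δ _ hδ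
      rw [rootVector_apply A δ.2.1, if_neg, if_neg, mul_zero]
      · exact fun h' => hδ (Subtype.ext (Occupies.unique δ.2.1 γ.2.1 (Or.inl h') h))
      · rintro ⟨h1, h2⟩
        refine hδ (Subtype.ext (Occupies.unique δ.2.1 γ.2.1 (Or.inr ?_) h))
        rw [← h1, ← h2, Fin.rev_rev, Fin.rev_rev]
    · simp
  refine ⟨γ.1.rootVector ℤ ty r c, ?_, fun v => ?_⟩
  · rw [rootVector_apply ℤ γ.2.1]
    rcases h with h | h
    · split_ifs <;> simp_all
    · left
      rw [if_pos]
      rw [h, Fin.rev_rev, Fin.rev_rev]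
      exact ⟨rfl, rfl⟩
  · rw [hsum, mul_comm, rootVector_apply A γ.2.1, rootVector_apply ℤ γ.2.1]
    split_ifs <;> simp

theorem matrixOf_of_not_occupies {A : Type*} [CommRing A] {r c : Idx ty n}
    (h : ∀ γ ∈ nilRoots K ty P, ¬ Occupies γ r c) (v : nilRoots K ty P → A) :
    matrixOf K ty P v r c = 0 := by
  classical
  rw [matrixOf_apply]
  refine Finset.sum_eq_zero fun δ _ => ?_
  rw [rootVector_apply A δ.2.1, if_neg, if_neg, mul_zero]
  · exact fun h' => h δ.1 δ.2 (Or.inl h')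
  · rintro ⟨h1, h2⟩
    refine h δ.1 δ.2 (Or.inr ?_)
    rw [← h1, ← h2, Fin.rev_rev, Fin.rev_rev]

variable (K ty P) in
open Classical in
/-- The point with coordinates `1` for the roots of the base and `0` for the others. -/
noncomputable def basePoint (γ : nilRoots K ty P) : K := if γ.1 ∈ base K ty P then 1 else 0

/-- The tangent vector at the base point in the direction of a root. -/
noncomputable def tangentMatrix (γ : nilRoots K ty P) :
    Matrix (Idx ty n) (Idx ty n) (DualNumber K) :=
  (formalMatrix K ty P).map
    (dualEval (basePoint K ty P) γ : CoordRing K ty P →+* DualNumber K)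

theorem tangentMatrix_mem (γ : nilRoots K ty P) :
    tangentMatrix γ ∈ nilradical (DualNumber K) ty P :=
  map_mem_nilradical _ (matrixOf_mem _)

theorem tangentMatrix_eq (γ : nilRoots K ty P) :
    tangentMatrix γ = matrixOf K ty P fun δ => dualEval (basePoint K ty P) γ (X δ) :=
  map_matrixOf _ _

theorem fst_tangentMatrix_ne_zero_iff (γ : nilRoots K ty P) (r c : Idx ty n) :
    (tangentMatrix γ r c).fst ≠ 0 ↔ (r, c) ∈ basePositions K ty P := by
  rw [tangentMatrix_eq, mem_basePositions]
  by_cases h : ∃ δ ∈ nilRoots K ty P, Occupies δ r c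
  · obtain ⟨δ, hδ, ho⟩ := h
    obtain ⟨s, hs, h⟩ := matrixOf_of_occupies (A := DualNumber K) (γ := ⟨δ, hδ⟩) ho
    have hs0 : (s : K) ≠ 0 := by rcases hs with rfl | rfl <;> simp
    rw [h, TrivSqZeroExt.fst_mul, fst_dualEval, eval_X, TrivSqZeroExt.fst_intCast, basePoint]
    constructor
    · intro h1
      refine ⟨δ, ?_, ho⟩
      by_contra h2
      exact h1 (by rw [if_neg h2, mul_zero])
    · rintro ⟨ξ, hξ, ho'⟩
      obtain rfl := Occupies.unique (base_posRoots hξ) hδ.1 ho' ho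
      rw [if_pos hξ, mul_one]
      exact hs0
  · rw [matrixOf_of_not_occupies fun δ hδ ho => h ⟨δ, hδ, ho⟩]
    constructor
    · simp
    · rintro ⟨ξ, hξ, ho⟩
      exact absurd ⟨ξ, base_subset hξ, ho⟩ h

theorem snd_tangentMatrix_ne_zero_iff (γ : nilRoots K ty P) (r c : Idx ty n) :
    (tangentMatrix γ r c).snd ≠ 0 ↔ Occupies γ.1 r c := by
  rw [tangentMatrix_eq]
  by_cases h : ∃ δ ∈ nilRoots K ty P, Occupies δ r c
  · obtain ⟨δ, hδ, ho⟩ := h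
    obtain ⟨s, hs, h⟩ := matrixOf_of_occupies (A := DualNumber K) (γ := ⟨δ, hδ⟩) ho
    have hs0 : (s : K) ≠ 0 := by rcases hs with rfl | rfl <;> simp
    rw [h, DualNumber.snd_mul, snd_dualEval, TrivSqZeroExt.snd_intCast,
      TrivSqZeroExt.fst_intCast, zero_mul, add_zero]
    constructor
    · intro h1
      by_cases h2 : (⟨δ, hδ⟩ : nilRoots K ty P) = γ
      · rw [← h2]
        exact ho
      · rw [pderiv_X_of_ne h2, map_zero, mul_zero] at h1
        exact absurd rfl h1
    · intro ho'
      have h2 : (⟨δ, hδ⟩ : nilRoots K ty P) = γ :=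
        Subtype.ext (Occupies.unique hδ.1 γ.2.1 ho ho')
      rw [h2, pderiv_X_self, map_one, mul_one]
      exact hs0
  · rw [matrixOf_of_not_occupies fun δ hδ ho => h ⟨δ, hδ, ho⟩]
    constructor
    · simp
    · exact fun ho => absurd ⟨γ.1, γ.2, ho⟩ h

theorem snd_tangentMatrix_eq_fst {γ : nilRoots K ty P} (hγ : γ.1 ∈ base K ty P) {r c : Idx ty n}
    (h : Occupies γ.1 r c) : (tangentMatrix γ r c).snd = (tangentMatrix γ r c).fst := by
  rw [tangentMatrix_eq]
  obtain ⟨s, -, h⟩ := matrixOf_of_occupies (A := DualNumber K) h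
  rw [h, DualNumber.snd_mul, TrivSqZeroExt.fst_mul, snd_dualEval, fst_dualEval, pderiv_X_self,
    TrivSqZeroExt.snd_intCast, eval_X, basePoint, if_pos hγ, map_one, zero_mul, add_zero]

theorem dualEval_pivotMinor (γ : nilRoots K ty P) (x y : Idx ty n) :
    dualEval (basePoint K ty P) γ (pivotMinor (basePositions K ty P) (formalMatrix K ty P) x y) =
      pivotMinor (basePositions K ty P) (tangentMatrix γ) x y :=
  map_pivotMinor (dualEval (basePoint K ty P) γ : CoordRing K ty P →+* DualNumber K) _ _ _ _

/-- The distance of the positions of a weight from the diagonal. -/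
def entryHeight (ty : ClassicalType) (γ : Weight n) : ℕ := (γ.entry ty).2 - (γ.entry ty).1

theorem Occupies.height_eq {γ : Weight n} {r c : Idx ty n} (h : Occupies γ r c) :
    entryHeight ty γ = c - r := by
  have := r.2
  have := c.2
  rcases h with h | h
  · rw [entryHeight, h]
  · rw [entryHeight, h]
    simp only [Fin.val_rev]
    omega

/-- Going down or left brings a position closer to the diagonal, so the apex is the only position of
its corner at the maximal distance. -/
theorem eq_of_entryHeight_le {ξ γ : Weight n} (hγ : γ ∈ posRoots ty n)
    {x y r c : Idx ty n} (hxy : Occupies ξ x y) (hrc : Occupies γ r c) (hxr : x ≤ r) (hcy : c ≤ y)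
    (h : entryHeight ty ξ ≤ entryHeight ty γ) : r = x ∧ c = y := by
  rw [hxy.height_eq, hrc.height_eq] at h
  have h1 : (r : ℕ) < c := hrc.lt (Or.inl hγ)
  have h2 : (x : ℕ) ≤ r := hxr
  have h3 : (c : ℕ) ≤ y := hcy
  exact ⟨Fin.ext (by omega), Fin.ext (by omega)⟩

/-- The root meets the corner of its minor only at the apex. There the coordinate is `1` and the
entry is linear in it, so the derivative equals the value of the minor at the base point. -/
theorem snd_dualEval_minorM_self {γ : nilRoots K ty P} (hγ : γ.1 ∈ base K ty P) :
    (dualEval (basePoint K ty P) γ (minorM K ty P γ.1)).snd ≠ 0 := by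
  have hF := symmetricRook_basePositions (K := K) (ty := ty) (P := P)
  have ho := (occupies_entry (ty := ty) γ.1).reflect
  have hxy := mem_basePositions.2 ⟨γ.1, hγ, ho⟩
  rw [minorM_eq γ.2.1, dualEval_pivotMinor, snd_pivotMinor_self hF (s := 1), one_mul]
  · exact fst_pivotMinor_ne_zero hF (fst_tangentMatrix_ne_zero_iff γ) hxy
  · intro r c hr hc
    by_cases h : Occupies γ.1 r c
    · rw [if_pos (eq_of_entryHeight_le γ.2.1 ho h hr hc le_rfl).1, one_mul,
        snd_tangentMatrix_eq_fst hγ h]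
    · rw [not_ne_iff.1 (mt (snd_tangentMatrix_ne_zero_iff γ r c).1 h)]
      split_ifs with hrx
      · by_contra h1
        rw [one_mul] at h1
        subst hrx
        have h2 := (fst_tangentMatrix_ne_zero_iff γ _ _).1 (Ne.symm h1)
        rw [hF.row_unique h2 hxy] at h
        exact h ho
      · rfl

/-- A different root at least as far from the diagonal has no position in the corner of the minor,
so its coordinate does not occur there. -/
theorem snd_dualEval_minorM {ξ : Weight n} {γ : nilRoots K ty P} (hξ : ξ ∈ base K ty P)
    (hne : ξ ≠ γ.1) (hle : entryHeight ty ξ ≤ entryHeight ty γ.1) :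
    (dualEval (basePoint K ty P) γ (minorM K ty P ξ)).snd = 0 := by
  have hF := symmetricRook_basePositions (K := K) (ty := ty) (P := P)
  have ho := (occupies_entry (ty := ty) ξ).reflect
  rw [minorM_eq (base_posRoots hξ), dualEval_pivotMinor, snd_pivotMinor_self hF (s := 0), zero_mul]
  intro r c hr hc
  rw [zero_mul, ite_self]
  by_contra h
  have h1 := (snd_tangentMatrix_ne_zero_iff γ r c).1 h
  obtain ⟨rfl, rfl⟩ := eq_of_entryHeight_le γ.2.1 ho h1 hr hc hle
  exact hne (Occupies.unique (base_posRoots hξ) γ.2.1 ho h1)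

end TangentMatrix

/-! ### Derivatives of the polynomials of admissible pairs in the directions of the base and of `Φ`.
-/

section Roots

variable {K : Type*} [Field K] {ty : ClassicalType} {n : ℕ} {P : BlockSizes n}
  {q q' : AdmissiblePair K ty P} {x y z w x' y' z' w' : Idx ty n}

theorem entry_rev_le {γ : Weight n} (hγ : γ ∈ posRoots ty n ∨ ∃ i, γ = .double i) :
    (γ.entry ty).2.rev ≤ (γ.entry ty).1 := by
  rcases hγ with h | ⟨i, rfl⟩
  · exact (entry_spec h).2.1
  · simp [Weight.entry, negIdx]

theorem IsChain.occupies_root (c : IsChain q x y z w) {φ : Weight n} (h : q.IsRoot φ) :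
    Occupies φ y w := by
  refine occupies_of_vec_eq (Or.inl h.1) ?_
  rw [h.2, vec_eq_entry c.root, c.occ_root, vec_eq_entry (Or.inl (base_posRoots q.ξ'_mem)),
    c.entry']
  ring

theorem IsChain.root_mem (c : IsChain q x y z w) {φ : Weight n} (h : q.IsRoot φ) :
    φ ∈ nilRoots K ty P :=
  (c.occupies_root h).mem_nilRoots_iff.2 ⟨h.1, c.block_eq ▸ c.block_lt'⟩

theorem phiSet_subset : phiSet K ty P ⊆ nilRoots K ty P := by
  rintro φ ⟨q, h⟩
  obtain ⟨x, y, z, w, c⟩ := exists_isChain q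
  exact c.root_mem h

/-- The position `(x, z)` is that of a root in `Φ` only in a self-dual situation. -/
theorem IsChain.self_dual (c : IsChain q x y z w) (c' : IsChain q' x' y' z' w') {φ : Weight n}
    (hφ : q'.IsRoot φ) (h : Occupies φ x z) :
    z = y.rev ∧ w = x.rev ∧ ty ≠ .symplectic ∧ Occupies φ y w := by
  have hF := symmetricRook_basePositions (K := K) (ty := ty) (P := P)
  -- If the two positions coincide directly, `(z', z)` is an element of the placement below the row
  -- `x`, contrary to the clear window. If they are reflections of each other, the second chain is
  -- the reflection of the first. Both middle entries then lie on or below the antidiagonal, hence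
  -- on it.
  rcases (c'.occupies_root hφ).eq_or_eq h with ⟨rfl, rfl⟩ | ⟨h1, h2⟩
  · exact (c.clear_columns _ _ c'.mem' c'.yz c.yz le_rfl).elim
  obtain rfl : w' = x.rev := by rw [h1, Fin.rev_rev]
  obtain rfl : y' = z.rev := by rw [h2, Fin.rev_rev]
  obtain rfl : z' = y.rev := hF.col_unique c'.mem' (hF.symm c.mem)
  obtain rfl : x' = w.rev := hF.col_unique c'.mem (hF.symm c.mem')
  have e1 : q'.ξ' = q.ξ := Occupies.unique (base_posRoots q'.ξ'_mem) (base_posRoots q.ξ_mem)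
    (Or.inl c'.entry') c.occ.reflect
  have h3 := c'.entry'
  rw [e1] at h3
  have h4 : z.rev ≤ y := by
    have := entry_rev_le (ty := ty) c.root
    rwa [c.occ_root] at this
  have h5 : y.rev.rev ≤ z.rev := by
    have := entry_rev_le (ty := ty) c'.root
    rwa [c'.occ_root] at this
  rw [Fin.rev_rev] at h5
  have hyz : y = z.rev := le_antisymm h5 h4
  have hzy : z = y.rev := by rw [hyz, Fin.rev_rev]
  have hw : w = x.rev := by
    refine hF.row_unique c.mem' ?_
    rw [hzy]
    exact hF.symm c.mem
  refine ⟨hzy, hw, ?_, ?_⟩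
  -- In the first shape the two descriptions of the entry of `ξ` would give `z = x`, against `x < y
  -- < z`.
  · rcases c.shape with ⟨h6, -⟩ | ⟨-, -, h6⟩
    · exfalso
      rw [h3, ← hzy] at h6
      have h7 := (Prod.mk.inj h6).1
      have h8 := IsChain.lt_of_block_lt c.block_lt
      rw [← h7] at h8
      exact absurd (h8.trans c.yz) (lt_irrefl _)
    · exact h6 hzy
  · have := c'.occupies_root hφ
    rwa [← hyz, ← hw] at this

theorem reflectSign_eq_of_orthogonal {F : Finset (Idx ty n × Idx ty n)} {t : Idx ty n}
    (hty : ty ≠ .symplectic) (hsw : southWest F t.rev x.rev = southWest F y.rev x.rev) :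
    reflectSign F x t = reflectSign F x y := by
  have hsign : ∀ v : Idx ty n, rowSign ℤ ty v = 1 := fun v => by simp [rowSign, hty]
  have hnot : ∀ v : Idx ty n, v.rev ∉ (southWest F v.rev x.rev).image Prod.fst := by
    intro v h
    obtain ⟨⟨r, c⟩, h, rfl⟩ := Finset.mem_image.1 h
    exact lt_irrefl _ (mem_southWest.1 h).2.1
  have hnot' := hnot t
  rw [hsw] at hnot'
  simp only [reflectSign, hsign, hsw, Finset.prod_insert (hnot y), Finset.prod_insert hnot']

theorem IsChain.snd_dualEval_polyL (c : IsChain q x y z w) (γ : nilRoots K ty P) :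
    ∃ σ : ℤ, σ * σ = 1 ∧ (dualEval (basePoint K ty P) γ (polyL K ty P q)).snd =
      (σ : K) * ((pivotMinor (basePositions K ty P) (tangentMatrix γ) x y).fst *
        (pivotMinor (basePositions K ty P) (tangentMatrix γ) y w).snd +
        (pivotMinor (basePositions K ty P) (tangentMatrix γ) x z).snd *
        (pivotMinor (basePositions K ty P) (tangentMatrix γ) z w).fst) := by
  obtain ⟨σ, hσ, h⟩ := c.polyL_eq_sum
  refine ⟨σ, hσ, ?_⟩
  rw [h, map_mul, map_intCast, DualNumber.snd_mul, TrivSqZeroExt.snd_intCast, zero_mul, add_zero,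
    TrivSqZeroExt.fst_intCast, ← snd_sum_pivotMinor symmetricRook_basePositions
    (fst_tangentMatrix_ne_zero_iff γ) c.mem c.mem' c.clear_columns c.clear_rows c.yz.le, map_sum]
  simp only [map_mul, dualEval_pivotMinor]

/-- To first order at the base point the polynomial sees only the positions `(x, z)` and `(y, w)`.
-/
theorem IsChain.snd_dualEval_polyL_eq_zero (c : IsChain q x y z w) {γ : nilRoots K ty P}
    (h : ¬ Occupies γ.1 x z) (h' : ¬ Occupies γ.1 y w) :
    (dualEval (basePoint K ty P) γ (polyL K ty P q)).snd = 0 := by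
  have hF := symmetricRook_basePositions (K := K) (ty := ty) (P := P)
  have hX := fst_tangentMatrix_ne_zero_iff γ
  obtain ⟨σ, -, h1⟩ := c.snd_dualEval_polyL γ
  rw [h1, not_ne_iff.1 (mt (snd_pivotMinor_ne_zero_iff hF hX c.mem c.clear_columns c.yz).1
      (mt (snd_tangentMatrix_ne_zero_iff γ _ _).1 h)),
    not_ne_iff.1 (mt (snd_pivotMinor_ne_zero_iff_of_row hF hX c.mem' c.clear_rows c.yz).1
      (mt (snd_tangentMatrix_ne_zero_iff γ _ _).1 h'))]
  ring

/-- A base root at `(x, z)` would share the row of `(x, y)`, and one at `(y, w)` the column of `(z,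
w)`. -/
theorem snd_dualEval_polyL_base (q : AdmissiblePair K ty P) {γ : nilRoots K ty P}
    (hγ : γ.1 ∈ base K ty P) : (dualEval (basePoint K ty P) γ (polyL K ty P q)).snd = 0 := by
  have hF := symmetricRook_basePositions (K := K) (ty := ty) (P := P)
  obtain ⟨x, y, z, w, c⟩ := exists_isChain q
  refine c.snd_dualEval_polyL_eq_zero (fun h => ?_) fun h => ?_
  · exact c.yz.ne (hF.row_unique c.mem (mem_basePositions.2 ⟨_, hγ, h⟩))
  · exact c.yz.ne (hF.col_unique (mem_basePositions.2 ⟨_, hγ, h⟩) c.mem')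

theorem snd_dualEval_polyL_of_ne {φ : Weight n} {γ : nilRoots K ty P} (hφ : q.IsRoot φ)
    (hγ : q'.IsRoot γ.1) (hne : φ ≠ γ.1) :
    (dualEval (basePoint K ty P) γ (polyL K ty P q)).snd = 0 := by
  obtain ⟨x, y, z, w, c⟩ := exists_isChain q
  obtain ⟨x', y', z', w', c'⟩ := exists_isChain q'
  have key : ¬ Occupies γ.1 y w := fun h =>
    hne (Occupies.unique hφ.1 γ.2.1 (c.occupies_root hφ) h)
  exact c.snd_dualEval_polyL_eq_zero (fun h => key (c.self_dual c' hγ h).2.2.2) key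

/-- The position `(y, w)` always contributes. The only danger is cancellation with `(x, z)` in the
self-dual case. There reflection exchanges the two contributions, and its signs agree, so they add
up to twice a nonzero term. -/
theorem snd_dualEval_polyL_self [CharZero K] {γ : nilRoots K ty P} (hγ : q.IsRoot γ.1) :
    (dualEval (basePoint K ty P) γ (polyL K ty P q)).snd ≠ 0 := by
  have hF := symmetricRook_basePositions (K := K) (ty := ty) (P := P)
  have hX := fst_tangentMatrix_ne_zero_iff γ
  obtain ⟨x, y, z, w, c⟩ := exists_isChain q
  obtain ⟨σ, hσ, h1⟩ := c.snd_dualEval_polyL γ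
  have hσ0 : (σ : K) ≠ 0 := by
    intro h
    have : ((σ * σ : ℤ) : K) = 0 := by rw [Int.cast_mul, h, zero_mul]
    rw [hσ, Int.cast_one] at this
    exact one_ne_zero this
  have hu := fst_pivotMinor_ne_zero hF hX c.mem
  have hw := (snd_pivotMinor_ne_zero_iff_of_row hF hX c.mem' c.clear_rows c.yz).2
    ((snd_tangentMatrix_ne_zero_iff γ _ _).2 (c.occupies_root hγ))
  rw [h1]
  refine mul_ne_zero hσ0 ?_
  by_cases h : Occupies γ.1 x z
  · obtain ⟨hz, hwx, hty, -⟩ := c.self_dual c hγ h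
    have hrs : reflectSign (basePositions K ty P) x z = reflectSign (basePositions K ty P) x y := by
      refine reflectSign_eq_of_orthogonal hty ?_
      rw [southWest_reflect hF, southWest_reflect hF,
        southWest_eq_of_clear hF c.mem c.clear_columns c.yz.le le_rfl]
    have e1 := pivotMinor_reflect hF (tangentMatrix_mem γ).1 x z
    have e2 := pivotMinor_reflect hF (tangentMatrix_mem γ).1 x y
    rw [hrs, ← hwx, show z.rev = y by rw [hz, Fin.rev_rev]] at e1
    rw [← hwx, ← hz] at e2
    have e1' := congrArg TrivSqZeroExt.snd e1
    have e2' := congrArg TrivSqZeroExt.fst e2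
    rw [DualNumber.snd_mul, TrivSqZeroExt.snd_intCast, zero_mul, add_zero,
      TrivSqZeroExt.fst_intCast] at e1'
    rw [TrivSqZeroExt.fst_mul, TrivSqZeroExt.fst_intCast] at e2'
    rw [e1', mul_right_comm, ← e2', ← two_mul]
    exact mul_ne_zero two_ne_zero (mul_ne_zero hu hw)
  · rw [not_ne_iff.1 (mt (snd_pivotMinor_ne_zero_iff hF hX c.mem c.clear_columns c.yz).1
      (mt (snd_tangentMatrix_ne_zero_iff γ _ _).1 h)), zero_mul, add_zero]
    exact mul_ne_zero hu hw

end Roots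

/-! ### Algebraic independence and the transcendence degree. -/

section Main

variable {K : Type*} [Field K] [CharZero K] {ty : ClassicalType} {n : ℕ} {P : BlockSizes n}

theorem algebraicIndependent_minorM_polyL (q : phiSet K ty P → AdmissiblePair K ty P)
    (hq : ∀ φ, (q φ).IsRoot φ.1) : AlgebraicIndependent K
      (Sum.elim (fun ξ : base K ty P => minorM K ty P ξ.1)
        (fun φ : phiSet K ty P => polyL K ty P (q φ))) := by
  refine algebraicIndependent_of_dualEval _
    (Sum.elim (fun ξ => ⟨ξ.1, base_subset ξ.2⟩) fun φ => ⟨φ.1, phiSet_subset φ.2⟩)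
    -- The polynomials of `Φ` get the key `0` and the minors a positive one, because a minor may
    -- vary in the directions of `Φ` while the former do not vary in those of the base. Among the
    -- minors the distance from the diagonal decides.
    (basePoint K ty P) (Sum.elim (fun ξ => entryHeight ty ξ.1 + 1) fun _ => 0) ?_ ?_
  · rintro (ξ | φ)
    · exact snd_dualEval_minorM_self (γ := ⟨ξ.1, base_subset ξ.2⟩) ξ.2
    · exact snd_dualEval_polyL_self (γ := ⟨φ.1, phiSet_subset φ.2⟩) (hq φ)
  · rintro (ξ | φ) (ξ' | φ') hne hle
    · exact snd_dualEval_minorM (γ := ⟨ξ'.1, base_subset ξ'.2⟩) ξ.2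
        (fun h => hne (by rw [Subtype.ext h])) (Nat.le_of_succ_le_succ hle)
    · exact absurd hle (by simp)
    · exact snd_dualEval_polyL_base (γ := ⟨ξ'.1, base_subset ξ'.2⟩) (q φ) ξ'.2
    · exact snd_dualEval_polyL_of_ne (γ := ⟨φ'.1, phiSet_subset φ'.2⟩) (hq φ) (hq φ')
        fun h => hne (by rw [Subtype.ext h])

theorem algebraMap_mem_invariantField {f : CoordRing K ty P} (hf : f ∈ invariantRing K ty P) :
    algebraMap (CoordRing K ty P) (FunctionField K ty P) f ∈ invariantField K ty P := by
  intro g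
  have h : adField K ty P g (algebraMap _ _ f) =
      algebraMap (CoordRing K ty P) (FunctionField K ty P) (adPoly K ty P g.1 f) :=
    (IsFractionRing.liftAlgHom_apply _ _).trans (IsFractionRing.lift_algebraMap _ _)
  rw [h, hf g.1 g.2]

theorem ncard_add_ncard_le_trdeg : (((base K ty P).ncard + (phiSet K ty P).ncard : ℕ) :
    Cardinal) ≤ Algebra.trdeg K (invariantField K ty P) := by
  choose q hq using fun φ : phiSet K ty P => φ.2
  have hmem : ∀ i, algebraMap (CoordRing K ty P) (FunctionField K ty P)
      (Sum.elim (fun ξ : base K ty P => minorM K ty P ξ.1)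
        (fun φ : phiSet K ty P => polyL K ty P (q φ)) i) ∈ invariantField K ty P := by
    rintro (ξ | φ)
    · exact algebraMap_mem_invariantField (minorM_mem_invariantRing ξ.2)
    · exact algebraMap_mem_invariantField (polyL_mem_invariantRing (q φ))
  have h : AlgebraicIndependent K fun i => (⟨_, hmem i⟩ : invariantField K ty P) := by
    refine AlgebraicIndependent.of_comp (invariantField K ty P).val ?_
    exact (algebraicIndependent_minorM_polyL q hq).map'
      (f := IsScalarTower.toAlgHom K (CoordRing K ty P) (FunctionField K ty P))
      (IsFractionRing.injective (CoordRing K ty P) (FunctionField K ty P))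
  have h1 := h.lift_cardinalMk_le_trdeg
  have h2 : (((base K ty P).ncard + (phiSet K ty P).ncard : ℕ) : Cardinal.{0}) =
      Cardinal.mk (base K ty P ⊕ phiSet K ty P) := by
    rw [Cardinal.mk_sum, Cardinal.lift_id, Cardinal.lift_id, Nat.cast_add,
      Set.cast_ncard (Set.toFinite _), Set.cast_ncard (Set.toFinite _)]
  rw [← h2, Cardinal.lift_natCast] at h1
  simpa using h1

end Main

end ParabolicInvariants

theorem theorem15 (K : Type*) [Field K] [IsAlgClosed K] [CharZero K]
    (ty : ParabolicInvariants.ClassicalType) (n : ℕ) (hn : 0 < n)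
    (P : ParabolicInvariants.BlockSizes n) :
    (∀ ξ ∈ ParabolicInvariants.base K ty P,
      ParabolicInvariants.minorM K ty P ξ ∈ ParabolicInvariants.invariantRing K ty P) ∧
    (∀ q : ParabolicInvariants.AdmissiblePair K ty P,
      ParabolicInvariants.polyL K ty P q ∈ ParabolicInvariants.invariantRing K ty P) ∧
    (∀ q : ParabolicInvariants.phiSet K ty P → ParabolicInvariants.AdmissiblePair K ty P,
      (∀ φ, (q φ).IsRoot φ.1) →
      AlgebraicIndependent K
        (Sum.elim
          (fun ξ : ParabolicInvariants.base K ty P => ParabolicInvariants.minorM K ty P ξ.1)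
          (fun φ : ParabolicInvariants.phiSet K ty P =>
            ParabolicInvariants.polyL K ty P (q φ)))) ∧
    (((ParabolicInvariants.base K ty P).ncard + (ParabolicInvariants.phiSet K ty P).ncard : ℕ) :
        Cardinal) ≤ Algebra.trdeg K (ParabolicInvariants.invariantField K ty P) := by
  exact ⟨fun _ => ParabolicInvariants.minorM_mem_invariantRing,
    ParabolicInvariants.polyL_mem_invariantRing,
    ParabolicInvariants.algebraicIndependent_minorM_polyL,
    ParabolicInvariants.ncard_add_ncard_le_trdeg⟩
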